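/- Let $(X_k,Y_k)_{k\in\mathbb N}$ be an iid sequence of random vectors in $\mathbb R^2$. For points $(x_1,y_1),\dots,(x_n,y_n)$ arrange them so that $x_{(1)}\le\dots\le x_{(n)}$, ties among the $x_i$ being broken uniformly at random (independently of everything else), let $y_{(i)}$ be the second coordinate of the $i$-th arranged point, $r_i=\#\{j: y_{(j)}\le y_{(i)}\}$ and $l_i=\#\{j: y_{(j)}\ge y_{(i)}\}$. Chatterjee's rank correlation is $$\xi_n = 1-\frac{3\sum_{i=1}^{n-1}|r_{i+1}-r_i|}{n^2-1}\ \text{ if there are no ties among the } y_i,\qquad \xi_n = 1-\frac{n\sum_{i=1}^{n-1}|r_{i+1}-r_i|}{2\sum_{i=1}^n l_i(n-l_i)}\ \text{ otherwise}$$ (with $0/0=0$). Let $\xi_n$ now be computed from $(X_1,Y_1),\dots,(X_n,Y_n)$ and put $T_n=\sqrt n(\xi_n-\mathbb E\xi_n)$. Let $m=m(n)\le n$ satisfy $m\to\infty$ as $n\to\infty$, draw $m$ of the observations $(X_1,Y_1),\dots,(X_n,Y_n)$ uniformly at random without replacement, let $\xi_m^*$ be the rank correlation of this subsample, and $$T^*_{m,n}=\sqrt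 m\left(\xi_m^*-\mathbb E[\xi_m^*\mid (X_1,Y_1),\dots,(X_n,Y_n)]\right).$$ Suppose that $(T_n)_{n\in\mathbb N}$ is uniformly square-integrable, and that one of the following two conditions holds: (i) $T_n\to\mathcal N(0,\sigma^2)$ in distribution for some $\sigma>0$, and $m=o(\sqrt n)$; (ii) $(X_1,Y_1)$ has a continuous distribution function, $Y_1$ is not almost surely equal to a measurable function of $X_1$, and $m=o(n)$; in this case $T_n\to\mathcal N(0,\sigma^2)$ in distribution for some $\sigma>0$ (this is part of the conclusion), and $\sigma$ denotes this constant. Then for every continuous $f:\mathbb R\to\mathbb R$ such that, for some $C>0$, $|f(x)|\le C(1+x^2)$ for all $x\in\mathbb R$, $$\mathbb E\left[f(T^*_{m,n})\right]\longrightarrow\mathbb E\left[f(\sigma Z)\right]\qquad(n\to\infty),\qquad Z\sim\mathcal N(0,1),$$ where all these expectations exist and are finite. In particular $\mathbb E[(T^*_{m,n})^2]\to\sigma^2$; equivalently, the bootstrap variance estimator $\sigma^{*2}_{m,n}=\mathrm{Var}\left(\sqrt m\,\xi_m^*\mid (X_1,Y_1),\dots,(X_n,Y_n)\right)$ satisfies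 $\mathbb E[\sigma^{*2}_{m,n}]\to\sigma^2$. -/

import Mathlib

open MeasureTheory ProbabilityTheory Filter Topology Asymptotics

namespace Chatterjee

/-- Finite sets of permutations carry the discrete sigma-algebra. -/
instance permMeasurableSpace (n : ℕ) : MeasurableSpace (Equiv.Perm (Fin n)) := ⊤

/-- Finite sets of injections carry the discrete sigma-algebra. -/
instance embMeasurableSpace (k n : ℕ) : MeasurableSpace (Fin k ↪ Fin n) := ⊤

/-- The rank of `y i`: the number of indices `j` with `y j ≤ y i`. -/
noncomputable def rank {n : ℕ} (y : Fin n → ℝ) (i : Fin n) : ℕ :=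
  Nat.card {j : Fin n // y j ≤ y i}

/-- The number of indices `j` with `y j ≥ y i`. -/
noncomputable def upperRank {n : ℕ} (y : Fin n → ℝ) (i : Fin n) : ℕ :=
  Nat.card {j : Fin n // y i ≤ y j}

/-- The sum of `|r_{i+1} - r_i|` over consecutive positions of the list `y`. -/
noncomputable def rankVariation {n : ℕ} (y : Fin n → ℝ) : ℝ :=
  ∑ i : Fin n, if h : i.val + 1 < n then |(rank y ⟨i.val + 1, h⟩ : ℝ) - (rank y i : ℝ)| else 0

open Classical in
/-- Chatterjee's coefficient of a list `y` of responses that is already arranged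
by increasing covariate. (Quotients with denominator `0` are `0`.) -/
noncomputable def xiOrdered {n : ℕ} (y : Fin n → ℝ) : ℝ :=
  if Function.Injective y then
    1 - 3 * rankVariation y / ((n : ℝ) ^ 2 - 1)
  else
    1 - n * rankVariation y /
      (2 * ∑ i : Fin n, (upperRank y i : ℝ) * ((n : ℝ) - (upperRank y i : ℝ)))

/-- The permutation that arranges the indices by increasing `x i`, where indices with equal `x i`
are arranged by increasing label `τ i`. -/
noncomputable def sortOrder {n : ℕ} (x : Fin n → ℝ) (τ : Equiv.Perm (Fin n)) :
    Equiv.Perm (Fin n) :=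
  Tuple.sort (fun i => toLex (x i, τ i))

/-- Chatterjee's rank correlation of the points `z i = (x i, y i)`, where ties among the `x i` are
broken by the labels `τ`; for a uniformly distributed `τ`, ties are broken at random. -/
noncomputable def xi {n : ℕ} (z : Fin n → ℝ × ℝ) (τ : Equiv.Perm (Fin n)) : ℝ :=
  xiOrdered (fun i => (z (sortOrder (fun j => (z j).1) τ i)).2)

variable {Ω : Type*} [MeasurableSpace Ω]

/-- `R` is uniformly distributed on its range `α` and independent of `D`. -/
def IsUniformIndep {α β : Type*} [MeasurableSpace α] [MeasurableSpace β]
    (R : Ω → α) (D : Ω → β) (P : Measure Ω) : Prop :=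
  Measurable R ∧ P.map R = uniformOn Set.univ ∧ IndepFun R D P

/-- The sample consisting of the first `n` observations. -/
def sample (X Y : ℕ → Ω → ℝ) (n : ℕ) (ω : Ω) : Fin n → ℝ × ℝ :=
  fun i => (X i ω, Y i ω)

/-- The sigma-algebra generated by the first `n` observations. -/
abbrev sampleSigma (X Y : ℕ → Ω → ℝ) (n : ℕ) : MeasurableSpace Ω :=
  MeasurableSpace.comap (sample X Y n) inferInstance

/-- `ξ_n`, with ties among the covariates broken by the labels `τ n`. -/
noncomputable def xiSample (X Y : ℕ → Ω → ℝ) (τ : (n : ℕ) → Ω → Equiv.Perm (Fin n))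
    (n : ℕ) (ω : Ω) : ℝ :=
  xi (sample X Y n ω) (τ n ω)

/-- `T_n = √n (ξ_n - E ξ_n)`. -/
noncomputable def T (P : Measure Ω) (X Y : ℕ → Ω → ℝ)
    (τ : (n : ℕ) → Ω → Equiv.Perm (Fin n)) (n : ℕ) (ω : Ω) : ℝ :=
  Real.sqrt n * (xiSample X Y τ n ω - ∫ ω', xiSample X Y τ n ω' ∂P)

/-- `ξ*_m`: the coefficient of the subsample with indices `S n`, drawn without replacement from
the first `n` observations, with ties broken by the labels `ρ n`. -/
noncomputable def xiBoot (X Y : ℕ → Ω → ℝ) (m : ℕ → ℕ) (S : (n : ℕ) → Ω → (Fin (m n) ↪ Fin n))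
    (ρ : (n : ℕ) → Ω → Equiv.Perm (Fin (m n))) (n : ℕ) (ω : Ω) : ℝ :=
  xi (fun k => sample X Y n ω (S n ω k)) (ρ n ω)

/-- `T*_{m,n} = √m (ξ*_m - E[ξ*_m | (X_1, Y_1), …, (X_n, Y_n)])`. -/
noncomputable def TBoot (P : Measure Ω) (X Y : ℕ → Ω → ℝ) (m : ℕ → ℕ)
    (S : (n : ℕ) → Ω → (Fin (m n) ↪ Fin n)) (ρ : (n : ℕ) → Ω → Equiv.Perm (Fin (m n)))
    (n : ℕ) (ω : Ω) : ℝ :=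
  Real.sqrt (m n) *
    (xiBoot X Y m S ρ n ω - condExp (sampleSigma X Y n) P (xiBoot X Y m S ρ n) ω)

/-- The bootstrap variance estimator `Var(√m ξ*_m | (X_1, Y_1), …, (X_n, Y_n))`. -/
noncomputable def bootVariance (P : Measure Ω) (X Y : ℕ → Ω → ℝ) (m : ℕ → ℕ)
    (S : (n : ℕ) → Ω → (Fin (m n) ↪ Fin n)) (ρ : (n : ℕ) → Ω → Equiv.Perm (Fin (m n)))
    (n : ℕ) : Ω → ℝ :=
  condVar (sampleSigma X Y n) (fun ω => Real.sqrt (m n) * xiBoot X Y m S ρ n ω) P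

/-- `T_n` converges in distribution to the normal law `N(0, σ²)`. -/
def AsympNormal (P : Measure Ω) [IsProbabilityMeasure P] (X Y : ℕ → Ω → ℝ)
    (τ : (n : ℕ) → Ω → Equiv.Perm (Fin n)) (σ : ℝ) : Prop :=
  TendstoInDistribution (T P X Y τ) atTop (fun z : ℝ => z) (fun _ => P)
    (gaussianReal 0 (Real.toNNReal (σ ^ 2)))

/-- Convergence of the means of `f (T*_{m,n})` to `E f(σ Z)`, `Z` standard normal, for
all continuous `f` of at most quadratic growth; in particular, convergence of the second moments
to `σ²`, and of the mean of the bootstrap variance estimator. -/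
def BootMomentsConverge (P : Measure Ω) (X Y : ℕ → Ω → ℝ) (m : ℕ → ℕ)
    (S : (n : ℕ) → Ω → (Fin (m n) ↪ Fin n)) (ρ : (n : ℕ) → Ω → Equiv.Perm (Fin (m n)))
    (σ : ℝ) : Prop :=
  (∀ (f : ℝ → ℝ) (C : ℝ), Continuous f → 0 < C → (∀ x, |f x| ≤ C * (1 + x ^ 2)) →
    (∀ n, Integrable (fun ω => f (TBoot P X Y m S ρ n ω)) P) ∧
    Integrable (fun z => f (σ * z)) (gaussianReal 0 1) ∧
    Tendsto (fun n => ∫ ω, f (TBoot P X Y m S ρ n ω) ∂P) atTop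
      (𝓝 (∫ z, f (σ * z) ∂(gaussianReal 0 1)))) ∧
  Tendsto (fun n => ∫ ω, (TBoot P X Y m S ρ n ω) ^ 2 ∂P) atTop (𝓝 (σ ^ 2)) ∧
  Tendsto (fun n => ∫ ω, bootVariance P X Y m S ρ n ω ∂P) atTop (𝓝 (σ ^ 2))

end Chatterjee

set_option linter.unusedSectionVars false

namespace Chatterjee

/-! Bootstrap. The argument needs only `m = o(n)` and asymptotic normality of `T_n`. Given the data,
the mean of `ξ*_m` is an average of one kernel over all subsamples, a U-statistic of order `m`.
Comparing it with the average over `⌊n/m⌋` disjoint blocks, as Hoeffding did, bounds its variance by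
`Var ξ_m / ⌊n/m⌋` (`variance_condExp_xiBoot_le`). Since `ξ*_m` has the law of `ξ_m`
(`identDistrib_xiBoot`) and `m Var ξ_m = E T_m²` tends to `σ²` by uniform square-integrability,
centring at the conditional instead of the unconditional mean changes `T*` only by a term vanishing
in `L²`. So `T*` inherits the limit law of `T_m`, its second moment converges to `σ²`, and these two
facts yield all continuous functions of quadratic growth (`tendsto_integral_of_quadratic_growth`).

Central limit theorem under (ii). Write `Y = q (X, W)` with `W` uniform and independent of `X`.
Without ties, `√n ξ_n = √n - 3 * rankStat`, where `rankStat` is a normalized sum of rank differences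
over neighbours in the order of the covariate. It is approximated by `n^(-1/2)` times a sum of
`linPart` over observations and of `degDist` over neighbours, where `degDist` is the distance of the
levels `F(y)`, centred given the covariates. `linPart` is chosen so that deleting one observation
changes statistic and approximation by nearly the same amount; the Efron-Stein inequality then makes
the variance of the difference vanish (`tendsto_variance_remainder`). This uses that neighbours have
nearly the same conditional law: a half-line separates at most one pair of neighbours, and from
half-lines one passes to all integrable functions of the covariate (`tendsto_neighbourDist`). Laws
of large numbers over neighbours follow (`tendsto_adjSum_lln`).

In the approximation, the conditional means of `linPart` given the covariates form an iid sum. The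
rest, with responses revealed by increasing covariate, is a sum of martingale differences: each term
involves an observation and its left neighbour. The product of the factors `1 + i t N_j` therefore
has conditional mean one, and once the mean square of the terms converges, the exponential of the
sum may be replaced by this product times a Gaussian factor (`tendsto_charFun_neighbourTerm`). The
limit variance is positive because a vanishing second moment of `degDist` would make the response a
function of the covariate (`rankVar_pos`). -/

lemma integral_comp_measurePreserving {α β : Type*} [MeasurableSpace α] [MeasurableSpace β]
    {μ : Measure α} {ν : Measure β} {f : α → β} (hf : MeasurePreserving f μ ν) {E : Type*}
    [NormedAddCommGroup E] [NormedSpace ℝ E] {g : β → E} (hg : AEStronglyMeasurable g ν) :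
    ∫ a, g (f a) ∂μ = ∫ b, g b ∂ν := by
  rw [← hf.map_eq] at hg ⊢
  exact (integral_map hf.measurable.aemeasurable hg).symm

/-! ### The Efron-Stein inequality for bounded statistics. -/

section EfronStein

variable {ι α : Type*} [Fintype ι] [DecidableEq ι] [MeasurableSpace α]

/-- From a family of pairs, take the second entries on `s` and the first entries elsewhere. -/
def mixed (s : Finset ι) (p : ι → α × α) : ι → α :=
  fun i => if i ∈ s then (p i).2 else (p i).1

/-- Swap the two entries of the pairs with index in `s`. -/
def swapOn (s : Finset ι) (p : ι → α × α) : ι → α × α :=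
  fun i => if i ∈ s then (p i).swap else p i

lemma measurable_mixed (s : Finset ι) : Measurable (mixed s : (ι → α × α) → ι → α) := by
  refine measurable_pi_lambda _ fun i => ?_
  unfold mixed
  split_ifs <;> fun_prop

variable (l : Measure α) [IsProbabilityMeasure l]

lemma measurePreserving_mixed (s : Finset ι) :
    MeasurePreserving (mixed s) (Measure.pi fun _ : ι => l.prod l) (Measure.pi fun _ : ι => l) := by
  have h := measurePreserving_pi (fun _ : ι => l.prod l) (fun _ : ι => l)
    (f := fun i p => if i ∈ s then p.2 else p.1) (fun i => by
      by_cases h : i ∈ s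
      · simpa [h] using measurePreserving_snd (μ := l) (ν := l)
      · simpa [h] using measurePreserving_fst (μ := l) (ν := l))
  exact h

lemma measurePreserving_swapOn (s : Finset ι) :
    MeasurePreserving (swapOn s) (Measure.pi fun _ : ι => l.prod l)
      (Measure.pi fun _ : ι => l.prod l) := by
  have h := measurePreserving_pi (fun _ : ι => l.prod l) (fun _ : ι => l.prod l)
    (f := fun i p => if i ∈ s then p.swap else p) (fun i => by
      by_cases h : i ∈ s
      · simpa [h] using Measure.measurePreserving_swap (μ := l) (ν := l)
      · simp only [h, if_false]
        exact MeasurePreserving.id _)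
  exact h

/-- Swapping entries preserves the law of iid pairs, so these identities let one difference of mixed
vectors be exchanged for another inside an integral. The swap of `k` is used for symmetrization, the
swap of `s` to undo the replacements already made. -/
lemma mixed_swapOn_of_mem {s : Finset ι} {k : ι} (hk : k ∉ s) (p : ι → α × α) :
    mixed s (swapOn {k} p) = mixed (insert k s) p ∧
    mixed (insert k s) (swapOn {k} p) = mixed s p ∧
    mixed ∅ (swapOn {k} p) = mixed {k} p ∧
    mixed {k} (swapOn {k} p) = mixed ∅ p ∧
    mixed s (swapOn s p) = mixed ∅ p ∧
    mixed (insert k s) (swapOn s p) = mixed {k} p := by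
  refine ⟨?_, ?_, ?_, ?_, ?_, ?_⟩ <;> funext i <;> simp only [mixed, swapOn] <;>
    by_cases h1 : i = k <;> by_cases h2 : i ∈ s <;> simp_all

/-- The variance is the mean of `f(z) (f(z) - f(z'))` for an independent copy `z'`. Replacing the
coordinates of `z` by those of `z'` one at a time telescopes the second factor. Symmetrizing the
increment at `k` by swapping the pair `k` turns it into half the mean of a product of two
differences with the same second moment. -/
theorem resample_variance_le {f : (ι → α) → ℝ} (hf : Measurable f) {C : ℝ}
    (hC : ∀ z, |f z| ≤ C) :
    (∫ z, f z ^ 2 ∂Measure.pi fun _ : ι => l) - (∫ z, f z ∂Measure.pi fun _ : ι => l) ^ 2 ≤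
      2⁻¹ * ∑ k, ∫ p, (f (mixed ∅ p) - f (mixed {k} p)) ^ 2 ∂Measure.pi fun _ : ι => l.prod l := by
  set Q := Measure.pi fun _ : ι => l.prod l
  have hm (s : Finset ι) : Measurable fun p : ι → α × α => f (mixed s p) :=
    hf.comp (measurable_mixed s)
  have hi (s t : Finset ι) : Integrable (fun p => f (mixed s p) * f (mixed t p)) Q := by
    refine Integrable.of_bound ((hm s).mul (hm t)).aestronglyMeasurable (C * C) (ae_of_all _ fun p => ?_)
    rw [Real.norm_eq_abs, abs_mul]
    exact mul_le_mul (hC _) (hC _) (abs_nonneg _) ((abs_nonneg _).trans (hC (mixed ∅ p)))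
  have hd (s t u v : Finset ι) : Integrable
      (fun p => f (mixed s p) * f (mixed t p) - f (mixed u p) * f (mixed v p)) Q :=
    (hi s t).sub (hi u v)
  have isq (s t : Finset ι) : Integrable (fun p => (f (mixed s p) - f (mixed t p)) ^ 2) Q := by
    have := ((hi s s).sub ((hi s t).const_mul 2)).add (hi t t)
    refine this.congr (ae_of_all _ fun p => ?_)
    simp only [Pi.add_apply, Pi.sub_apply]
    ring
  -- The telescoping is an induction over the set of coordinates already replaced.
  have key (s : Finset ι) : ∫ p, (f (mixed ∅ p) * f (mixed ∅ p) - f (mixed ∅ p) * f (mixed s p)) ∂Q ≤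
      2⁻¹ * ∑ k ∈ s, ∫ p, (f (mixed ∅ p) - f (mixed {k} p)) ^ 2 ∂Q := by
    induction s using Finset.induction_on with
    | empty => simp
    | insert k s hk ih =>
      rw [Finset.sum_insert hk, mul_add]
      have e1 : ∫ p, (f (mixed ∅ p) * f (mixed s p) - f (mixed ∅ p) * f (mixed (insert k s) p)) ∂Q =
          ∫ p, (f (mixed {k} p) * f (mixed (insert k s) p) - f (mixed {k} p) * f (mixed s p)) ∂Q := by
        rw [← integral_comp_measurePreserving (measurePreserving_swapOn l {k}) (hd _ _ _ _).1]
        simp only [mixed_swapOn_of_mem hk]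
        rfl
      have e2 : ∫ p, (f (mixed s p) - f (mixed (insert k s) p)) ^ 2 ∂Q =
          ∫ p, (f (mixed ∅ p) - f (mixed {k} p)) ^ 2 ∂Q := by
        rw [← integral_comp_measurePreserving (measurePreserving_swapOn l s) (isq _ _).1]
        simp only [mixed_swapOn_of_mem hk]
        rfl
      have e3 : ∫ p, (f (mixed ∅ p) * f (mixed s p) - f (mixed ∅ p) * f (mixed (insert k s) p)) ∂Q ≤
          2⁻¹ * ∫ p, (f (mixed ∅ p) - f (mixed {k} p)) ^ 2 ∂Q := by
        have h2 : 2 * ∫ p, (f (mixed ∅ p) * f (mixed s p) -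
            f (mixed ∅ p) * f (mixed (insert k s) p)) ∂Q ≤
            ∫ p, (f (mixed ∅ p) - f (mixed {k} p)) ^ 2 ∂Q := by
          have h3 : ∫ p, ((f (mixed ∅ p) * f (mixed s p) -
            f (mixed ∅ p) * f (mixed (insert k s) p)) + (f (mixed {k} p) * f (mixed (insert k s) p)
              - f (mixed {k} p) * f (mixed s p))) ∂Q ≤
            ∫ p, (2⁻¹ * (f (mixed ∅ p) - f (mixed {k} p)) ^ 2 +
              2⁻¹ * (f (mixed s p) - f (mixed (insert k s) p)) ^ 2) ∂Q := by
            refine integral_mono ((hd _ _ _ _).add (hd _ _ _ _))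
              (((isq _ _).const_mul _).add ((isq _ _).const_mul _)) fun p => ?_
            have := sq_nonneg ((f (mixed ∅ p) - f (mixed {k} p)) -
              (f (mixed s p) - f (mixed (insert k s) p)))
            simp only
            nlinarith
          rw [integral_add (hd _ _ _ _) (hd _ _ _ _), ← e1,
            integral_add ((isq _ _).const_mul _) ((isq _ _).const_mul _), integral_const_mul,
            integral_const_mul, e2] at h3
          linarith
        linarith
      have e4 : ∫ p, (f (mixed ∅ p) * f (mixed ∅ p) - f (mixed ∅ p) * f (mixed (insert k s) p)) ∂Q =
          ∫ p, (f (mixed ∅ p) * f (mixed ∅ p) - f (mixed ∅ p) * f (mixed s p)) ∂Q +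
          ∫ p, (f (mixed ∅ p) * f (mixed s p) - f (mixed ∅ p) * f (mixed (insert k s) p)) ∂Q := by
        rw [← integral_add (hd _ _ _ _) (hd _ _ _ _)]
        congr 1
        ext p
        ring
      linarith
  have h := key Finset.univ
  rw [integral_sub (hi _ _) (hi _ _)] at h
  have h1 : ∫ p, f (mixed ∅ p) * f (mixed ∅ p) ∂Q = ∫ z, f z ^ 2 ∂Measure.pi fun _ : ι => l := by
    rw [← (measurePreserving_mixed l ∅).map_eq, integral_map
      (measurable_mixed _).aemeasurable (hf.pow_const 2).aestronglyMeasurable]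
    simp only [sq]
    rfl
  have h2 : ∫ p, f (mixed ∅ p) * f (mixed Finset.univ p) ∂Q =
      (∫ z, f z ∂Measure.pi fun _ : ι => l) ^ 2 := by
    have eq1 : (mixed ∅ : (ι → α × α) → ι → α) = fun p i => (p i).1 := by
      funext p i; simp [mixed]
    have eq2 : (mixed Finset.univ : (ι → α × α) → ι → α) = fun p i => (p i).2 := by
      funext p i; simp [mixed]
    have hind : IndepFun (fun p : ι → α × α => (fun i => (p i).1)) (fun p => fun i => (p i).2) Q := by
      have := measurePreserving_arrowProdEquivProdArrow α α ι (fun _ => l) (fun _ => l)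
      rw [indepFun_iff_map_prod_eq_prod_map_map (by fun_prop : Measurable _).aemeasurable
        (by fun_prop : Measurable _).aemeasurable]
      have h1 := (measurePreserving_mixed l (∅ : Finset ι)).map_eq
      have h2 := (measurePreserving_mixed l (Finset.univ : Finset ι)).map_eq
      refine this.map_eq.trans ?_
      rw [eq1] at h1
      rw [eq2] at h2
      exact congrArg₂ Measure.prod h1.symm h2.symm
    have h3 := hind.comp hf hf
    have h4 := h3.integral_fun_mul_eq_mul_integral (hf.comp (by fun_prop)).aestronglyMeasurable
      (hf.comp (by fun_prop)).aestronglyMeasurable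
    have a1 : ∫ p, f (mixed ∅ p) ∂Q = ∫ z, f z ∂Measure.pi fun _ : ι => l := by
      rw [← (measurePreserving_mixed l ∅).map_eq, integral_map
        (measurable_mixed _).aemeasurable hf.aestronglyMeasurable]
    have a2 : ∫ p, f (mixed Finset.univ p) ∂Q = ∫ z, f z ∂Measure.pi fun _ : ι => l := by
      rw [← (measurePreserving_mixed l Finset.univ).map_eq, integral_map
        (measurable_mixed _).aemeasurable hf.aestronglyMeasurable]
    rw [eq1] at a1 ⊢
    rw [eq2] at a2 ⊢
    rw [sq]
    nth_rewrite 1 [← a1]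
    rw [← a2]
    exact h4
  rw [h1, h2] at h
  exact h

/-- The Efron-Stein inequality, with approximations not depending on one coordinate. -/
theorem variance_le_two_mul_sum {f : (ι → α) → ℝ} (hf : Measurable f) {C : ℝ}
    (hC : ∀ z, |f z| ≤ C) {g : ι → (ι → α) → ℝ} (hg : ∀ k, Measurable (g k)) {D : ℝ}
    (hD : ∀ k z, |g k z| ≤ D) (hgk : ∀ k z a, g k (Function.update z k a) = g k z) :
    Var[f; Measure.pi fun _ : ι => l] ≤
      2 * ∑ k, ∫ z, (f z - g k z) ^ 2 ∂Measure.pi fun _ : ι => l := by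
  have hmem : MemLp f 2 (Measure.pi fun _ : ι => l) :=
    MemLp.of_bound hf.aestronglyMeasurable C (ae_of_all _ hC)
  rw [variance_eq_sub hmem]
  refine (resample_variance_le l hf hC).trans ?_
  rw [Finset.mul_sum, Finset.mul_sum]
  refine Finset.sum_le_sum fun k _ => ?_
  have hs : Measurable fun z => (f z - g k z) ^ 2 := (hf.sub (hg k)).pow_const 2
  have hi : Integrable (fun z => (f z - g k z) ^ 2) (Measure.pi fun _ : ι => l) := by
    refine Integrable.of_bound hs.aestronglyMeasurable ((C + D) ^ 2) (ae_of_all _ fun z => ?_)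
    rw [Real.norm_eq_abs, abs_pow]
    have h1 : |f z - g k z| ≤ C + D := (abs_sub _ _).trans (add_le_add (hC z) (hD k z))
    gcongr
  have e (s : Finset ι) : ∫ p, (f (mixed s p) - g k (mixed s p)) ^ 2 ∂(Measure.pi fun _ : ι => l.prod l)
      = ∫ z, (f z - g k z) ^ 2 ∂Measure.pi fun _ : ι => l := by
    rw [← (measurePreserving_mixed l s).map_eq, integral_map
        (measurable_mixed _).aemeasurable hs.aestronglyMeasurable]
  have hi' (s : Finset ι) : Integrable (fun p => (f (mixed s p) - g k (mixed s p)) ^ 2)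
      (Measure.pi fun _ : ι => l.prod l) :=
    (measurePreserving_mixed l s).integrable_comp_of_integrable hi
  -- As `g k` ignores coordinate `k`, it is a common centre for `f` before and after resampling that
  -- coordinate; then `(a - b)² ≤ 2 (a - g)² + 2 (b - g)²`.
  have hg' (p : ι → α × α) : g k (mixed {k} p) = g k (mixed ∅ p) := by
    rw [← hgk k (mixed ∅ p) (p k).2]
    congr 1
    funext i
    by_cases h : i = k
    · subst h; simp [mixed]
    · simp [mixed, h]
  have : ∫ p, (f (mixed ∅ p) - f (mixed {k} p)) ^ 2 ∂(Measure.pi fun _ : ι => l.prod l) ≤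
      ∫ p, (2 * (f (mixed ∅ p) - g k (mixed ∅ p)) ^ 2 +
        2 * (f (mixed {k} p) - g k (mixed {k} p)) ^ 2) ∂(Measure.pi fun _ : ι => l.prod l) := by
    refine integral_mono_of_nonneg (ae_of_all _ fun p => sq_nonneg _)
      (((hi' _).const_mul _).add ((hi' _).const_mul _)) (ae_of_all _ fun p => ?_)
    simp only
    rw [hg']
    nlinarith [sq_nonneg (f (mixed ∅ p) - g k (mixed ∅ p) + (f (mixed {k} p) - g k (mixed ∅ p)))]
  rw [integral_add ((hi' _).const_mul _) ((hi' _).const_mul _), integral_const_mul,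
    integral_const_mul, e, e] at this
  linarith

end EfronStein

/-! ### Redrawing a single coordinate of an iid vector. -/

section Resample

variable {ι α β : Type*} [Fintype ι] [DecidableEq ι] [MeasurableSpace α] [MeasurableSpace β]

/-- Changing one coordinate of a random vector with iid entries by a random map that preserves
the law of the entries preserves the law of the vector. -/
lemma measurePreserving_update (l : Measure α) [IsProbabilityMeasure l] (b : Measure β)
    [IsProbabilityMeasure b] {Φ : α × β → α} (hΦ : MeasurePreserving Φ (l.prod b) l) (k : ι) :
    MeasurePreserving (fun p : (ι → α) × β => Function.update p.1 k (Φ (p.1 k, p.2)))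
      ((Measure.pi fun _ : ι => l).prod b) (Measure.pi fun _ : ι => l) := by
  -- An independent extra variable is attached to every coordinate, although only the one at `k` is
  -- used: the update thus becomes a coordinatewise map of a product measure.
  have h1 : MeasurePreserving (fun w : ι → α × β => (fun i => (w i).1, (w k).2))
      (Measure.pi fun _ : ι => l.prod b) ((Measure.pi fun _ : ι => l).prod b) :=
    ((MeasurePreserving.id _).prod (measurePreserving_eval (fun _ : ι => b) k)).comp
      (measurePreserving_arrowProdEquivProdArrow α β ι (fun _ => l) (fun _ => b))
  have h2 : MeasurePreserving (fun w : ι → α × β => fun i => if i = k then Φ (w i) else (w i).1)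
      (Measure.pi fun _ : ι => l.prod b) (Measure.pi fun _ : ι => l) := by
    refine measurePreserving_pi (fun _ : ι => l.prod b) (fun _ : ι => l)
      (f := fun i w => if i = k then Φ w else w.1) (fun i => ?_)
    by_cases h : i = k
    · simpa [h] using hΦ
    · simpa [h] using measurePreserving_fst (μ := l) (ν := b)
  have hm : Measurable (fun p : (ι → α) × β => Function.update p.1 k (Φ (p.1 k, p.2))) := by
    refine measurable_pi_lambda _ fun i => ?_
    by_cases h : i = k
    · subst h
      simp only [Function.update_self]
      exact hΦ.measurable.comp (by fun_prop)
    · simp only [Function.update_of_ne h]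
      fun_prop
  refine ⟨hm, ?_⟩
  rw [← h1.map_eq, Measure.map_map hm h1.measurable, ← h2.map_eq]
  congr 1
  funext w i
  by_cases h : i = k
  · subst h; simp
  · simp [h]

lemma measurePreserving_resample (l : Measure α) [IsProbabilityMeasure l] (k : ι) :
    MeasurePreserving (fun p : (ι → α) × α => Function.update p.1 k p.2)
      ((Measure.pi fun _ : ι => l).prod l) (Measure.pi fun _ : ι => l) :=
  measurePreserving_update l l (measurePreserving_snd (μ := l) (ν := l)) k

lemma measurePreserving_resample_snd (l : Measure α) [IsProbabilityMeasure l] (b : Measure β)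
    [IsProbabilityMeasure b] (k : ι) :
    MeasurePreserving
      (fun p : (ι → α × β) × β => Function.update p.1 k ((p.1 k).1, p.2))
      ((Measure.pi fun _ : ι => l.prod b).prod b) (Measure.pi fun _ : ι => l.prod b) := by
  refine measurePreserving_update (l.prod b) b (Φ := fun p => (p.1.1, p.2)) ?_ k
  have h := (measurePreserving_fst (μ := l) (ν := b)).prod (MeasurePreserving.id b)
  exact h

end Resample

/-! ### Neighbours in the order of the covariate, and sums over them. -/

section Adjacency

variable {ι : Type*} [Fintype ι] [DecidableEq ι]

/-- `j` is the right neighbour of `i` when the indices in `s` are arranged by increasing `x`. -/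
def Adj (s : Finset ι) (x : ι → ℝ) (i j : ι) : Prop :=
  i ∈ s ∧ j ∈ s ∧ x i < x j ∧ ∀ l ∈ s, x l ≤ x i ∨ x j ≤ x l

open Classical in
/-- The indicator of adjacency. -/
noncomputable def adjInd (s : Finset ι) (x : ι → ℝ) (i j : ι) : ℝ :=
  if Adj s x i j then 1 else 0

/-- The sum of `w i j` over adjacent pairs. -/
noncomputable def adjSum (s : Finset ι) (x : ι → ℝ) (w : ι → ι → ℝ) : ℝ :=
  ∑ i, ∑ j, adjInd s x i j * w i j

variable {s : Finset ι} {x : ι → ℝ}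

lemma adjInd_nonneg (s : Finset ι) (x : ι → ℝ) (i j : ι) : 0 ≤ adjInd s x i j := by
  unfold adjInd; split_ifs <;> norm_num

lemma adjInd_le_one (s : Finset ι) (x : ι → ℝ) (i j : ι) : adjInd s x i j ≤ 1 := by
  unfold adjInd; split_ifs <;> norm_num

lemma adjInd_self (s : Finset ι) (x : ι → ℝ) (i : ι) : adjInd s x i i = 0 := by
  simp [adjInd, Adj]

lemma adjInd_of_adj {i j : ι} (h : Adj s x i j) : adjInd s x i j = 1 := by simp [adjInd, h]

lemma adjInd_of_not_adj {i j : ι} (h : ¬ Adj s x i j) : adjInd s x i j = 0 := by simp [adjInd, h]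

lemma Adj.unique_left (hx : Function.Injective x) {i i' k : ι} (h : Adj s x i k)
    (h' : Adj s x i' k) : i = i' := by
  obtain ⟨a1, -, a3, a4⟩ := h
  obtain ⟨b1, -, b3, b4⟩ := h'
  refine hx (le_antisymm ?_ ?_)
  · exact (b4 i a1).resolve_right (not_le.2 a3)
  · exact (a4 i' b1).resolve_right (not_le.2 b3)

lemma Adj.unique_right (hx : Function.Injective x) {i j j' : ι} (h : Adj s x i j)
    (h' : Adj s x i j') : j = j' := by
  obtain ⟨-, a1, a3, a4⟩ := h
  obtain ⟨-, b1, b3, b4⟩ := h'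
  refine hx (le_antisymm ?_ ?_)
  · exact (a4 j' b1).resolve_left (not_le.2 b3)
  · exact (b4 j a1).resolve_left (not_le.2 a3)

lemma sum_adjInd_left_eq (hx : Function.Injective x) {p k : ι} (h : Adj s x p k) (w : ι → ℝ) :
    ∑ i, adjInd s x i k * w i = w p := by
  rw [Finset.sum_eq_single p]
  · rw [adjInd_of_adj h, one_mul]
  · intro i _ hi
    rw [adjInd_of_not_adj fun h' => hi (h'.unique_left hx h), zero_mul]
  · simp

lemma sum_adjInd_right_eq (hx : Function.Injective x) {k q : ι} (h : Adj s x k q) (w : ι → ℝ) :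
    ∑ j, adjInd s x k j * w j = w q := by
  rw [Finset.sum_eq_single q]
  · rw [adjInd_of_adj h, one_mul]
  · intro i _ hi
    rw [adjInd_of_not_adj fun h' => hi (h'.unique_right hx h), zero_mul]
  · simp

lemma sum_adjInd_left_eq_zero {k : ι} (h : ∀ i, ¬ Adj s x i k) (w : ι → ℝ) :
    ∑ i, adjInd s x i k * w i = 0 :=
  Finset.sum_eq_zero fun i _ => by rw [adjInd_of_not_adj (h i), zero_mul]

lemma sum_adjInd_right_eq_zero {k : ι} (h : ∀ j, ¬ Adj s x k j) (w : ι → ℝ) :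
    ∑ j, adjInd s x k j * w j = 0 :=
  Finset.sum_eq_zero fun i _ => by rw [adjInd_of_not_adj (h i), zero_mul]

lemma sum_adjInd_left_le (hx : Function.Injective x) (k : ι) : ∑ i, adjInd s x i k ≤ 1 := by
  by_cases h : ∃ i, Adj s x i k
  · obtain ⟨i, hi⟩ := h
    simpa using (sum_adjInd_left_eq hx hi fun _ => 1).le
  · push Not at h
    have := sum_adjInd_left_eq_zero h fun _ => 1
    simp only [mul_one] at this
    linarith

lemma sum_adjInd_right_le (hx : Function.Injective x) (k : ι) : ∑ j, adjInd s x k j ≤ 1 := by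
  by_cases h : ∃ i, Adj s x k i
  · obtain ⟨i, hi⟩ := h
    simpa using (sum_adjInd_right_eq hx hi fun _ => 1).le
  · push Not at h
    have := sum_adjInd_right_eq_zero h fun _ => 1
    simp only [mul_one] at this
    linarith

lemma adjSum_add (s : Finset ι) (x : ι → ℝ) (w w' : ι → ι → ℝ) :
    adjSum s x (fun i j => w i j + w' i j) = adjSum s x w + adjSum s x w' := by
  simp [adjSum, mul_add, Finset.sum_add_distrib]

lemma adjSum_sub (s : Finset ι) (x : ι → ℝ) (w w' : ι → ι → ℝ) :
    adjSum s x (fun i j => w i j - w' i j) = adjSum s x w - adjSum s x w' := by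
  simp [adjSum, mul_sub, Finset.sum_sub_distrib]

lemma adjSum_const_mul (s : Finset ι) (x : ι → ℝ) (c : ℝ) (w : ι → ι → ℝ) :
    adjSum s x (fun i j => c * w i j) = c * adjSum s x w := by
  simp only [adjSum, Finset.mul_sum]
  exact Finset.sum_congr rfl fun i _ => Finset.sum_congr rfl fun j _ => by ring

lemma adjSum_mono {w w' : ι → ι → ℝ} (h : ∀ i j, w i j ≤ w' i j) :
    adjSum s x w ≤ adjSum s x w' :=
  Finset.sum_le_sum fun i _ => Finset.sum_le_sum fun j _ =>
    mul_le_mul_of_nonneg_left (h i j) (adjInd_nonneg s x i j)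

lemma adjSum_nonneg {w : ι → ι → ℝ} (h : ∀ i j, 0 ≤ w i j) : 0 ≤ adjSum s x w :=
  Finset.sum_nonneg fun i _ => Finset.sum_nonneg fun j _ =>
    mul_nonneg (adjInd_nonneg s x i j) (h i j)

lemma abs_adjSum_le (w : ι → ι → ℝ) : |adjSum s x w| ≤ adjSum s x fun i j => |w i j| := by
  refine (Finset.abs_sum_le_sum_abs _ _).trans (Finset.sum_le_sum fun i _ => ?_)
  refine (Finset.abs_sum_le_sum_abs _ _).trans (Finset.sum_le_sum fun j _ => ?_)
  rw [abs_mul, abs_of_nonneg (adjInd_nonneg s x i j)]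

lemma adjSum_fst (s : Finset ι) (x : ι → ℝ) (a : ι → ℝ) :
    adjSum s x (fun i _ => a i) = ∑ i, (∑ j, adjInd s x i j) * a i := by
  simp [adjSum, Finset.sum_mul]

lemma adjSum_snd (s : Finset ι) (x : ι → ℝ) (a : ι → ℝ) :
    adjSum s x (fun _ j => a j) = ∑ j, (∑ i, adjInd s x i j) * a j := by
  simp only [adjSum, Finset.sum_mul]
  exact Finset.sum_comm

lemma adjSum_fst_le (hx : Function.Injective x) {a : ι → ℝ} (ha : ∀ i, 0 ≤ a i) :
    adjSum s x (fun i _ => a i) ≤ ∑ i, a i := by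
  rw [adjSum_fst]
  exact Finset.sum_le_sum fun i _ =>
    mul_le_of_le_one_left (ha i) (sum_adjInd_right_le hx i)

lemma adjSum_snd_le (hx : Function.Injective x) {a : ι → ℝ} (ha : ∀ i, 0 ≤ a i) :
    adjSum s x (fun _ j => a j) ≤ ∑ i, a i := by
  rw [adjSum_snd]
  exact Finset.sum_le_sum fun i _ =>
    mul_le_of_le_one_left (ha i) (sum_adjInd_left_le hx i)

lemma adjSum_le_card (hx : Function.Injective x) {w : ι → ι → ℝ} {C : ℝ} (hC : 0 ≤ C)
    (hw : ∀ i j, w i j ≤ C) : adjSum s x w ≤ Fintype.card ι * C := by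
  refine (adjSum_mono hw).trans ((adjSum_fst_le hx (a := fun _ => C) fun _ => hC).trans ?_)
  simp

lemma abs_adjSum_le_card (hx : Function.Injective x) {w : ι → ι → ℝ} {C : ℝ} (hC : 0 ≤ C)
    (hw : ∀ i j, |w i j| ≤ C) : |adjSum s x w| ≤ Fintype.card ι * C :=
  (abs_adjSum_le w).trans (adjSum_le_card hx hC hw)

/-- All pairs are counted, so no injectivity of the covariates is required. The bound is of the
wrong order, but it holds at every configuration and serves for integrability. -/
lemma abs_adjSum_le_sq {w : ι → ι → ℝ} {C : ℝ}
    (hw : ∀ i j, |w i j| ≤ C) : |adjSum s x w| ≤ Fintype.card ι * (Fintype.card ι * C) := by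
  refine (abs_adjSum_le w).trans ?_
  have : adjSum s x (fun i j => |w i j|) ≤ ∑ _i : ι, ∑ _j : ι, C := by
    refine Finset.sum_le_sum fun i _ => Finset.sum_le_sum fun j _ => ?_
    exact (mul_le_of_le_one_left (abs_nonneg _) (adjInd_le_one s x i j)).trans (hw i j)
  simpa using this

lemma exists_adj_right {i k : ι} (hi : i ∈ s) (hk : k ∈ s) (h : x i < x k) :
    ∃ j, Adj s x i j := by
  obtain ⟨j, hj, hmin⟩ := Finset.exists_min_image (s.filter fun l => x i < x l) x
    ⟨k, by simp [hk, h]⟩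
  rw [Finset.mem_filter] at hj
  refine ⟨j, hi, hj.1, hj.2, fun l hl => ?_⟩
  by_cases h' : x i < x l
  · exact Or.inr (hmin l (by simp [hl, h']))
  · exact Or.inl (not_lt.1 h')

lemma exists_adj_left {k j : ι} (hk : k ∈ s) (hj : j ∈ s) (h : x k < x j) :
    ∃ i, Adj s x i j := by
  obtain ⟨i, hi, hmax⟩ := Finset.exists_max_image (s.filter fun l => x l < x j) x
    ⟨k, by simp [hk, h]⟩
  rw [Finset.mem_filter] at hi
  refine ⟨i, hi.1, hj, hi.2, fun l hl => ?_⟩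
  by_cases h' : x l < x j
  · exact Or.inl (hmax l (by simp [hl, h']))
  · exact Or.inr (not_lt.1 h')

/-- Only the index with the largest covariate lacks a right neighbour. -/
lemma sum_one_sub_right_le (hx : Function.Injective x) :
    ∑ i, (1 - ∑ j, adjInd Finset.univ x i j) ≤ 1 := by
  by_cases h : ∃ i, ∀ j, ¬ Adj Finset.univ x i j
  · obtain ⟨i, hi⟩ := h
    have hmax (k : ι) : x k ≤ x i := by
      by_contra! hk
      obtain ⟨j, hj⟩ := exists_adj_right (Finset.mem_univ i) (Finset.mem_univ k) hk
      exact hi j hj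
    rw [Finset.sum_eq_single i]
    · have : 0 ≤ ∑ j, adjInd Finset.univ x i j := Finset.sum_nonneg fun j _ => adjInd_nonneg _ _ _ _
      linarith
    · intro k _ hk
      obtain ⟨j, hj⟩ := exists_adj_right (Finset.mem_univ k) (Finset.mem_univ i)
        (lt_of_le_of_ne (hmax k) (hx.ne hk))
      have := sum_adjInd_right_eq hx hj fun _ => 1
      simp only [mul_one] at this
      rw [this, sub_self]
    · simp
  · push Not at h
    refine (Finset.sum_nonpos fun i _ => ?_).trans zero_le_one
    obtain ⟨j, hj⟩ := h i
    have := sum_adjInd_right_eq hx hj fun _ => 1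
    simp only [mul_one] at this
    rw [this, sub_self]

lemma sum_one_sub_left_le (hx : Function.Injective x) :
    ∑ j, (1 - ∑ i, adjInd Finset.univ x i j) ≤ 1 := by
  by_cases h : ∃ j, ∀ i, ¬ Adj Finset.univ x i j
  · obtain ⟨i, hi⟩ := h
    have hmin (k : ι) : x i ≤ x k := by
      by_contra! hk
      obtain ⟨j, hj⟩ := exists_adj_left (Finset.mem_univ k) (Finset.mem_univ i) hk
      exact hi j hj
    rw [Finset.sum_eq_single i]
    · have : 0 ≤ ∑ j, adjInd Finset.univ x j i := Finset.sum_nonneg fun j _ => adjInd_nonneg _ _ _ _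
      linarith
    · intro k _ hk
      obtain ⟨j, hj⟩ := exists_adj_left (Finset.mem_univ i) (Finset.mem_univ k)
        (lt_of_le_of_ne (hmin k) (hx.ne hk.symm))
      have := sum_adjInd_left_eq hx hj fun _ => 1
      simp only [mul_one] at this
      rw [this, sub_self]
    · simp
  · push Not at h
    refine (Finset.sum_nonpos fun i _ => ?_).trans zero_le_one
    obtain ⟨j, hj⟩ := h i
    have := sum_adjInd_left_eq hx hj fun _ => 1
    simp only [mul_one] at this
    rw [this, sub_self]

/-- Removing an index from the arrangement. -/
lemma adjInd_erase (hx : Function.Injective x) {k : ι} (hk : k ∈ s) (i j : ι) :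
    adjInd s x i j = adjInd (s.erase k) x i j + (if j = k then adjInd s x i k else 0) +
      (if i = k then adjInd s x k j else 0) - adjInd s x i k * adjInd s x k j := by
  by_cases hi : i = k
  · subst hi
    have : adjInd (s.erase i) x i j = 0 := adjInd_of_not_adj fun h => by simp [Adj] at h
    by_cases hj : j = i
    · subst hj; simp [this, adjInd_self]
    · simp [this, hj, adjInd_self]
  by_cases hj : j = k
  · subst hj
    have : adjInd (s.erase j) x i j = 0 := adjInd_of_not_adj fun h => by simp [Adj] at h
    simp [this, hi, adjInd_self]
  simp only [hi, hj, if_false, add_zero]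
  -- After `k` is erased, two indices are adjacent if they were before or if `k` alone lay between
  -- them; injectivity excludes an index tied with `k`.
  have key : Adj (s.erase k) x i j ↔ Adj s x i j ∨ (Adj s x i k ∧ Adj s x k j) := by
    constructor
    · rintro ⟨h1, h2, h3, h4⟩
      rw [Finset.mem_erase] at h1 h2
      by_cases h5 : x k ≤ x i ∨ x j ≤ x k
      · refine Or.inl ⟨h1.2, h2.2, h3, fun l hl => ?_⟩
        by_cases hlk : l = k
        · rwa [hlk]
        · exact h4 l (Finset.mem_erase.2 ⟨hlk, hl⟩)
      · push Not at h5
        refine Or.inr ⟨⟨h1.2, hk, h5.1, fun l hl => ?_⟩, ⟨hk, h2.2, h5.2, fun l hl => ?_⟩⟩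
        · by_cases hlk : l = k
          · right; rw [hlk]
          · exact (h4 l (Finset.mem_erase.2 ⟨hlk, hl⟩)).imp_right fun h => h5.2.le.trans h
        · by_cases hlk : l = k
          · left; rw [hlk]
          · exact (h4 l (Finset.mem_erase.2 ⟨hlk, hl⟩)).imp_left fun h => h.trans h5.1.le
    · rintro (⟨h1, h2, h3, h4⟩ | ⟨⟨h1, h2, h3, h4⟩, ⟨g1, g2, g3, g4⟩⟩)
      · exact ⟨Finset.mem_erase.2 ⟨hi, h1⟩, Finset.mem_erase.2 ⟨hj, h2⟩, h3,
          fun l hl => h4 l (Finset.mem_of_mem_erase hl)⟩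
      · refine ⟨Finset.mem_erase.2 ⟨hi, h1⟩, Finset.mem_erase.2 ⟨hj, g2⟩, h3.trans g3,
          fun l hl => ?_⟩
        rw [Finset.mem_erase] at hl
        have hne := hx.ne hl.1
        rcases h4 l hl.2 with h | h
        · exact Or.inl h
        · exact Or.inr ((g4 l hl.2).resolve_left fun h' => hne (le_antisymm h' h))
  -- The two alternatives exclude each other, so their indicators add.
  have excl : Adj s x i j → ¬ (Adj s x i k ∧ Adj s x k j) := by
    rintro ⟨h1, h2, h3, h4⟩ ⟨⟨-, -, g3, -⟩, ⟨-, -, f3, -⟩⟩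
    rcases h4 k hk with h | h <;> linarith
  unfold adjInd
  by_cases h1 : Adj s x i j <;> by_cases h2 : Adj s x i k <;> by_cases h3 : Adj s x k j <;>
    simp_all

/-- The effect on `adjSum` of removing an index. -/
lemma adjSum_erase (hx : Function.Injective x) {k : ι} (hk : k ∈ s) (w : ι → ι → ℝ) :
    adjSum s x w = adjSum (s.erase k) x w + ∑ i, adjInd s x i k * w i k +
      ∑ j, adjInd s x k j * w k j - ∑ i, adjInd s x i k * ∑ j, adjInd s x k j * w i j := by
  have h (i j : ι) : adjInd s x i j * w i j = adjInd (s.erase k) x i j * w i j +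
      (if j = k then adjInd s x i k * w i k else 0) + (if i = k then adjInd s x k j * w k j else 0) -
      adjInd s x i k * (adjInd s x k j * w i j) := by
    rw [adjInd_erase hx hk]
    split_ifs <;> subst_vars <;> ring
  unfold adjSum
  simp only [Finset.mul_sum]
  rw [Finset.sum_congr rfl fun i _ => Finset.sum_congr rfl fun j _ => h i j]
  simp only [Finset.sum_add_distrib, Finset.sum_sub_distrib, Finset.sum_ite_eq', Finset.mem_univ,
    if_true]
  congr 2
  rw [Finset.sum_comm]
  simp

/-- At most one pair of neighbours is separated by a given level. -/
lemma adjSum_crossing_le (hx : Function.Injective x) (a : ℝ) :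
    adjSum s x (fun i j => |(Set.Iic a).indicator 1 (x i) - (Set.Iic a).indicator 1 (x j)|) ≤ 1 := by
  classical
  have h0 (i j : ι) (h : ¬ (Adj s x i j ∧ x i ≤ a ∧ a < x j)) : adjInd s x i j *
      |(Set.Iic a).indicator (1 : ℝ → ℝ) (x i) - (Set.Iic a).indicator 1 (x j)| = 0 := by
    by_cases hadj : Adj s x i j
    · have h1 := hadj.2.2.1
      by_cases hi : x i ≤ a
      · have hj : x j ≤ a := by
          by_contra! hj
          exact h ⟨hadj, hi, hj⟩
        simp [hi, hj]
      · have hj : ¬ x j ≤ a := fun hj => hi (h1.le.trans hj)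
        simp [hi, hj]
    · rw [adjInd_of_not_adj hadj, zero_mul]
  have hle (i j : ι) : adjInd s x i j *
      |(Set.Iic a).indicator (1 : ℝ → ℝ) (x i) - (Set.Iic a).indicator 1 (x j)| ≤ 1 := by
    refine mul_le_one₀ (adjInd_le_one _ _ _ _) (abs_nonneg _) ?_
    by_cases hi : x i ≤ a <;> by_cases hj : x j ≤ a <;> simp [hi, hj]
  by_cases h : ∃ i j, Adj s x i j ∧ x i ≤ a ∧ a < x j
  · obtain ⟨i, j, hij, hi, hj⟩ := h
    unfold adjSum
    rw [Finset.sum_eq_single i, Finset.sum_eq_single j]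
    · exact hle i j
    · rintro j' - hj'
      exact h0 _ _ fun h => hj' (h.1.unique_right hx hij)
    · simp
    · rintro i' - hi'
      refine Finset.sum_eq_zero fun j' _ => h0 _ _ fun h => hi' ?_
      refine hx (le_antisymm ?_ ?_)
      · exact (hij.2.2.2 i' h.1.1).resolve_right (not_le.2 (h.2.1.trans_lt hj))
      · exact (h.1.2.2.2 i hij.1).resolve_right (not_le.2 (hi.trans_lt h.2.2))
    · simp
  · refine (Finset.sum_nonpos fun i _ => Finset.sum_nonpos fun j _ => ?_).trans zero_le_one
    exact (h0 i j fun h' => h ⟨i, j, h'⟩).le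

lemma measurableSet_adj (s : Finset ι) (i j : ι) : MeasurableSet {x : ι → ℝ | Adj s x i j} := by
  have : {x : ι → ℝ | Adj s x i j} = {_x | i ∈ s} ∩ ({_x | j ∈ s} ∩ ({x | x i < x j} ∩
      ⋂ l ∈ s, ({x | x l ≤ x i} ∪ {x | x j ≤ x l}))) := by
    ext x; simp [Adj]
  rw [this]
  refine (MeasurableSet.const _).inter ((MeasurableSet.const _).inter
    ((measurableSet_lt (measurable_pi_apply i) (measurable_pi_apply j)).inter ?_))
  exact Finset.measurableSet_biInter s fun l _ =>
    (measurableSet_le (measurable_pi_apply l) (measurable_pi_apply i)).union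
      (measurableSet_le (measurable_pi_apply j) (measurable_pi_apply l))

@[fun_prop]
lemma measurable_adjInd (s : Finset ι) (i j : ι) : Measurable fun x : ι → ℝ => adjInd s x i j := by
  unfold adjInd
  exact Measurable.ite (measurableSet_adj s i j) measurable_const measurable_const

/-- This makes sums over the arrangement without `k` admissible as approximations in the Efron-Stein
inequality. -/
lemma adjInd_update_erase (s : Finset ι) (x : ι → ℝ) (k : ι) (a : ℝ) (i j : ι) :
    adjInd (s.erase k) (Function.update x k a) i j = adjInd (s.erase k) x i j := by
  have : Adj (s.erase k) (Function.update x k a) i j ↔ Adj (s.erase k) x i j := by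
    unfold Adj
    refine and_congr_right fun hi => and_congr_right fun hj => ?_
    rw [Function.update_of_ne (Finset.ne_of_mem_erase hi),
      Function.update_of_ne (Finset.ne_of_mem_erase hj)]
    refine and_congr_right fun _ => forall₂_congr fun l hl => ?_
    rw [Function.update_of_ne (Finset.ne_of_mem_erase hl)]
  by_cases h : Adj (s.erase k) x i j
  · rw [adjInd_of_adj h, adjInd_of_adj (this.2 h)]
  · rw [adjInd_of_not_adj h, adjInd_of_not_adj fun h' => h (this.1 h')]

end Adjacency

/-! ### Absence of ties under an atomless law. -/

section Injective

variable {ι : Type*} [Fintype ι] [DecidableEq ι] (ν : Measure ℝ) [IsProbabilityMeasure ν]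

lemma ae_injective_pi [NullSingletonClass ν] :
    ∀ᵐ x : ι → ℝ ∂Measure.pi fun _ => ν, Function.Injective x := by
  have h (i j : ι) (hij : i ≠ j) : ∀ᵐ x : ι → ℝ ∂Measure.pi fun _ => ν, x i ≠ x j := by
    have hm : MeasurableSet {x : ι → ℝ | x i ≠ x j} :=
      (measurableSet_eq_fun (measurable_pi_apply i) (measurable_pi_apply j)).compl
    -- With all other coordinates fixed, a fresh draw of coordinate `i` hits the value `x j` with
    -- probability zero.
    rw [← (measurePreserving_resample ν i).map_eq,
      ae_map_iff (measurePreserving_resample ν i).measurable.aemeasurable hm]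
    refine (Measure.ae_prod_iff_ae_ae ?_).2 (ae_of_all _ fun x => ?_)
    · exact (measurePreserving_resample ν i).measurable hm
    · have : ∀ᵐ a ∂ν, a ≠ x j := by
        rw [ae_iff]
        simp
      filter_upwards [this] with a ha
      simpa [Function.update_of_ne hij.symm] using ha
  have h2 : ∀ᵐ x : ι → ℝ ∂Measure.pi fun _ => ν, ∀ i j, i ≠ j → x i ≠ x j := by
    simp only [ae_all_iff]
    exact fun i j hij => h i j hij
  filter_upwards [h2] with x hx i j hij
  by_contra hne
  exact hx i j hne hij

variable {β : Type*} [MeasurableSpace β] (b : Measure β) [IsProbabilityMeasure b]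

lemma measurePreserving_fst_pi : MeasurePreserving (fun (z : ι → ℝ × β) i => (z i).1)
    (Measure.pi fun _ => ν.prod b) (Measure.pi fun _ => ν) :=
  measurePreserving_pi (fun _ : ι => ν.prod b) (fun _ : ι => ν) (f := fun _ => Prod.fst)
    fun _ => measurePreserving_fst

lemma ae_injective_fst [NullSingletonClass ν] :
    ∀ᵐ z : ι → ℝ × β ∂Measure.pi fun _ => ν.prod b, Function.Injective fun i => (z i).1 :=
  (measurePreserving_fst_pi ν b).quasiMeasurePreserving.ae (ae_injective_pi ν)

end Injective

/-! ### Functions of the covariate take close values at neighbours. -/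

section NeighbourContinuity

variable (ν : Measure ℝ) [IsProbabilityMeasure ν] [NullSingletonClass ν]

/-- The mean of `|f (x i) - f (x j)|` over neighbours, for `n` iid covariates. -/
noncomputable def neighbourDist (n : ℕ) (f : ℝ → ℝ) : ℝ :=
  (n : ℝ)⁻¹ * ∫ x, adjSum Finset.univ x (fun i j => |f (x i) - f (x j)|)
    ∂Measure.pi fun _ : Fin n => ν

variable {ν}

lemma integrable_adjSum_abs_sub {n : ℕ} {f : ℝ → ℝ} (hf : Integrable f ν) :
    Integrable (fun x => adjSum Finset.univ x (fun i j => |f (x i) - f (x j)|))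
      (Measure.pi fun _ : Fin n => ν) := by
  refine integrable_finsetSum _ fun i _ => integrable_finsetSum _ fun j _ => ?_
  have hi (i : Fin n) : Integrable (fun x : Fin n → ℝ => f (x i)) (Measure.pi fun _ => ν) :=
    (measurePreserving_eval (fun _ : Fin n => ν) i).integrable_comp_of_integrable hf
  refine ((hi i).sub (hi j)).abs.bdd_mul (c := 1) (by fun_prop : Measurable _).aestronglyMeasurable
    (ae_of_all _ fun x => ?_)
  rw [Real.norm_eq_abs, abs_of_nonneg (adjInd_nonneg _ _ _ _)]
  exact adjInd_le_one _ _ _ _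

lemma neighbourDist_nonneg (n : ℕ) (f : ℝ → ℝ) : 0 ≤ neighbourDist ν n f :=
  mul_nonneg (by positivity) (integral_nonneg fun x => adjSum_nonneg fun i j => abs_nonneg _)

lemma integral_sum_eval {n : ℕ} {f : ℝ → ℝ} (hf : Integrable f ν) :
    ∫ x, ∑ i, f (x i) ∂(Measure.pi fun _ : Fin n => ν) = n * ∫ x, f x ∂ν := by
  rw [integral_finsetSum]
  · simp [integral_comp_measurePreserving (measurePreserving_eval (fun _ : Fin n => ν) _) hf.1]
  · exact fun i _ =>
      (measurePreserving_eval (fun _ : Fin n => ν) i).integrable_comp_of_integrable hf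

/-- By the triangle inequality each pair costs the error at both of its members, and an index
belongs to at most two pairs, once on the left and once on the right; hence the factor 2. -/
lemma neighbourDist_le_add {n : ℕ} {f g : ℝ → ℝ} (hf : Integrable f ν) (hg : Integrable g ν) :
    neighbourDist ν n f ≤ neighbourDist ν n g + 2 * ∫ x, |f x - g x| ∂ν := by
  have hd : Integrable (fun x => |f x - g x|) ν := (hf.sub hg).abs
  have hs : Integrable (fun x : Fin n → ℝ => ∑ i, |f (x i) - g (x i)|) (Measure.pi fun _ => ν) :=
    integrable_finsetSum _ fun i _ =>
      (measurePreserving_eval (fun _ : Fin n => ν) i).integrable_comp_of_integrable hd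
  have h : ∫ x, adjSum Finset.univ x (fun i j => |f (x i) - f (x j)|)
      ∂(Measure.pi fun _ : Fin n => ν) ≤ ∫ x, (adjSum Finset.univ x
        (fun i j => |g (x i) - g (x j)|) + 2 * ∑ i, |f (x i) - g (x i)|)
          ∂(Measure.pi fun _ : Fin n => ν) := by
    refine integral_mono_ae (integrable_adjSum_abs_sub hf)
      ((integrable_adjSum_abs_sub hg).add (hs.const_mul 2)) ?_
    filter_upwards [ae_injective_pi (ι := Fin n) ν] with x hx
    have h1 : adjSum Finset.univ x (fun i j => |f (x i) - f (x j)|) ≤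
        adjSum Finset.univ x (fun i j => (|g (x i) - g (x j)| + |f (x i) - g (x i)|) +
          |f (x j) - g (x j)|) := by
      refine adjSum_mono fun i j => ?_
      have : f (x i) - f (x j) = (g (x i) - g (x j)) + (f (x i) - g (x i)) - (f (x j) - g (x j)) := by
        ring
      rw [this]
      exact (abs_sub _ _).trans (add_le_add_left (abs_add_le _ _) _)
    rw [adjSum_add, adjSum_add] at h1
    have h2 := adjSum_fst_le (s := Finset.univ) hx (a := fun i => |f (x i) - g (x i)|)
      fun _ => abs_nonneg _
    have h3 := adjSum_snd_le (s := Finset.univ) hx (a := fun i => |f (x i) - g (x i)|)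
      fun _ => abs_nonneg _
    linarith
  rw [integral_add (integrable_adjSum_abs_sub hg) (hs.const_mul 2), integral_const_mul,
    integral_sum_eval hd] at h
  unfold neighbourDist
  rcases Nat.eq_zero_or_pos n with rfl | hn
  · simp only [CharP.cast_eq_zero, inv_zero, zero_mul, zero_add]
    exact mul_nonneg zero_le_two (integral_nonneg fun x => abs_nonneg _)
  · have hn' : (0 : ℝ) < n := by exact_mod_cast hn
    refine (mul_le_mul_of_nonneg_left h (by positivity)).trans (le_of_eq ?_)
    field_simp

lemma neighbourDist_add_le {n : ℕ} {f g : ℝ → ℝ} (hf : Integrable f ν) (hg : Integrable g ν) :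
    neighbourDist ν n (fun x => f x + g x) ≤ neighbourDist ν n f + neighbourDist ν n g := by
  have hfg : Integrable (fun x => f x + g x) ν := hf.add hg
  have h : ∫ x, adjSum Finset.univ x (fun i j => |f (x i) + g (x i) - (f (x j) + g (x j))|)
      ∂(Measure.pi fun _ : Fin n => ν) ≤ ∫ x, (adjSum Finset.univ x
        (fun i j => |f (x i) - f (x j)|) + adjSum Finset.univ x (fun i j => |g (x i) - g (x j)|))
          ∂(Measure.pi fun _ : Fin n => ν) := by
    refine integral_mono_ae (integrable_adjSum_abs_sub (f := fun x => f x + g x) hfg)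
      ((integrable_adjSum_abs_sub hf).add (integrable_adjSum_abs_sub hg)) (ae_of_all _ fun x => ?_)
    have h1 : adjSum Finset.univ x (fun i j => |f (x i) + g (x i) - (f (x j) + g (x j))|) ≤
        adjSum Finset.univ x (fun i j => |f (x i) - f (x j)| + |g (x i) - g (x j)|) := by
      refine adjSum_mono fun i j => ?_
      rw [add_sub_add_comm]
      exact abs_add_le _ _
    rw [adjSum_add] at h1
    exact h1
  rw [integral_add (integrable_adjSum_abs_sub hf) (integrable_adjSum_abs_sub hg)] at h
  unfold neighbourDist
  rw [← mul_add]
  exact mul_le_mul_of_nonneg_left h (by positivity)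

lemma neighbourDist_const_mul (n : ℕ) (c : ℝ) (f : ℝ → ℝ) :
    neighbourDist ν n (fun x => c * f x) = |c| * neighbourDist ν n f := by
  unfold neighbourDist
  simp only [← mul_sub, abs_mul, adjSum_const_mul, integral_const_mul]
  ring

lemma tendsto_neighbourDist_of_forall {f : ℝ → ℝ} (h : ∀ ε > 0, ∃ u : ℕ → ℝ,
    Tendsto u atTop (𝓝 0) ∧ ∀ n, neighbourDist ν n f ≤ u n + ε) :
    Tendsto (fun n => neighbourDist ν n f) atTop (𝓝 0) := by
  rw [Metric.tendsto_atTop]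
  intro ε hε
  obtain ⟨u, hu, hle⟩ := h (ε / 2) (by positivity)
  obtain ⟨N, hN⟩ := (Metric.tendsto_atTop.1 hu) (ε / 2) (by positivity)
  refine ⟨N, fun n hn => ?_⟩
  have := hN n hn
  rw [Real.dist_eq, sub_zero] at this ⊢
  rw [abs_of_nonneg (neighbourDist_nonneg _ _)]
  linarith [hle n, le_abs_self (u n)]

/-- A half-line separates at most one pair of neighbours, so its value is at most `1/n`. Complements
separate the same pairs, and a disjoint union is an `L¹`-limit of finite unions, uniformly in `n` by
`neighbourDist_le_add`; Dynkin's theorem gives all Borel sets. -/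
lemma tendsto_neighbourDist_indicator {A : Set ℝ} (hA : MeasurableSet A) :
    Tendsto (fun n => neighbourDist ν n (A.indicator 1)) atTop (𝓝 0) := by
  have hint (A : Set ℝ) (hA : MeasurableSet A) : Integrable (A.indicator (1 : ℝ → ℝ)) ν :=
    (integrable_const (1 : ℝ)).indicator hA
  induction A, hA using MeasurableSpace.induction_on_inter (borel_eq_generateFrom_Iic ℝ)
    isPiSystem_Iic with
  | empty => simp [neighbourDist, adjSum]
  | basic t ht =>
    obtain ⟨a, rfl⟩ := ht
    refine squeeze_zero (fun n => neighbourDist_nonneg _ _) (fun n => ?_)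
      tendsto_inv_atTop_nhds_zero_nat
    refine mul_le_of_le_one_right (by positivity) ?_
    refine (integral_mono_ae (integrable_adjSum_abs_sub (hint _ measurableSet_Iic))
      (integrable_const (1 : ℝ)) ?_).trans (by simp)
    filter_upwards [ae_injective_pi (ι := Fin n) ν] with x hx
    exact adjSum_crossing_le hx a
  | compl t ht ih =>
    refine ih.congr fun n => ?_
    unfold neighbourDist
    congr 2
    funext x
    congr 1
    funext i j
    by_cases h1 : x i ∈ t <;> by_cases h2 : x j ∈ t <;> simp [h1, h2]
  | iUnion f hd hf ih =>
    refine tendsto_neighbourDist_of_forall fun ε hε => ?_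
    have hlim : Tendsto (fun K => ∫ x, |(⋃ k, f k).indicator (1 : ℝ → ℝ) x -
        ∑ k ∈ Finset.range K, (f k).indicator (1 : ℝ → ℝ) x| ∂ν) atTop (𝓝 (∫ _, (0 : ℝ) ∂ν)) := by
      have hs (K : ℕ) (x : ℝ) : ∑ k ∈ Finset.range K, (f k).indicator (1 : ℝ → ℝ) x =
          (⋃ k ∈ Finset.range K, f k).indicator 1 x := by
        rw [Finset.indicator_biUnion_apply]
        exact fun i _ j _ hij => hd hij
      refine tendsto_integral_of_dominated_convergence (fun _ => 1) (fun K => ?_)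
        (integrable_const _) (fun K => ae_of_all _ fun x => ?_) (ae_of_all _ fun x => ?_)
      · exact ((hint _ (MeasurableSet.iUnion hf)).sub
          (integrable_finsetSum _ fun k _ => hint _ (hf k))).abs.1
      · rw [hs, Real.norm_eq_abs, abs_abs]
        classical
        simp only [Set.indicator_apply]
        split_ifs <;> simp
      · by_cases h1 : x ∈ ⋃ k, f k
        · obtain ⟨k, hk⟩ := Set.mem_iUnion.1 h1
          refine tendsto_const_nhds.congr' ?_
          filter_upwards [eventually_gt_atTop k] with K hK
          rw [hs, Set.indicator_of_mem h1, Set.indicator_of_mem]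
          · simp
          · exact Set.mem_biUnion (Finset.mem_coe.2 (Finset.mem_range.2 hK)) hk
        · refine tendsto_const_nhds.congr fun K => ?_
          rw [hs, Set.indicator_of_notMem h1, Set.indicator_of_notMem]
          · simp
          · simp only [Set.mem_iUnion, not_exists] at h1 ⊢
            exact fun k _ => h1 k
    rw [integral_zero] at hlim
    obtain ⟨K, hK⟩ := (hlim.eventually (gt_mem_nhds (half_pos hε))).exists
    refine ⟨fun n => ∑ k ∈ Finset.range K, neighbourDist ν n ((f k).indicator 1), ?_, fun n => ?_⟩
    · simpa using tendsto_finsetSum (Finset.range K) fun k _ => ih k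
    · refine (neighbourDist_le_add (hint _ (MeasurableSet.iUnion hf))
        (integrable_finsetSum (Finset.range K) fun k _ => hint _ (hf k))).trans
          (add_le_add ?_ (by linarith))
      clear hK
      induction K with
      | zero => simp [neighbourDist, adjSum]
      | succ K ihK =>
        simp only [Finset.sum_range_succ]
        exact (neighbourDist_add_le (integrable_finsetSum (Finset.range K) fun k _ => hint _ (hf k))
          (hint _ (hf K))).trans (add_le_add_left ihK _)

/-- An integrable function of the covariate takes close values at neighbours, on average. -/
theorem tendsto_neighbourDist {f : ℝ → ℝ} (hf : Integrable f ν) :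
    Tendsto (fun n => neighbourDist ν n f) atTop (𝓝 0) := by
  -- Indicators generate the integrable functions under scaling, sums and `L¹`-limits;
  -- `neighbourDist_le_add` makes the class closed.
  refine Integrable.induction (fun f => Tendsto (fun n => neighbourDist ν n f) atTop (𝓝 0))
    ?_ ?_ ?_ ?_ hf
  · intro c s hs _
    have := (tendsto_neighbourDist_indicator (ν := ν) hs).const_mul |c|
    rw [mul_zero] at this
    refine this.congr fun n => ?_
    rw [← neighbourDist_const_mul]
    congr 1
    funext x
    simp [Set.indicator]
  · intro f g _ hf hg ihf ihg
    refine squeeze_zero (fun n => neighbourDist_nonneg _ _) (fun n => neighbourDist_add_le hf hg) ?_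
    simpa using ihf.add ihg
  · refine isClosed_of_closure_subset fun f hf => ?_
    refine tendsto_neighbourDist_of_forall fun ε hε => ?_
    obtain ⟨g, hg, hfg⟩ := Metric.mem_closure_iff.1 hf (ε / 2) (by positivity)
    refine ⟨_, hg, fun n => (neighbourDist_le_add (L1.integrable_coeFn f)
      (L1.integrable_coeFn g)).trans (add_le_add_right ?_ _)⟩
    rw [L1.dist_eq_integral_dist] at hfg
    simp only [Real.dist_eq] at hfg
    linarith
  · intro f g hfg hf ih
    refine squeeze_zero (fun n => neighbourDist_nonneg _ _) (fun n => ?_) ih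
    refine (neighbourDist_le_add (hf.congr hfg) hf).trans (le_of_eq ?_)
    rw [integral_eq_zero_of_ae, mul_zero, add_zero]
    filter_upwards [hfg] with x hx
    simp [hx]

variable {β : Type*} [MeasurableSpace β] (b : Measure β) [IsProbabilityMeasure b]

/-- The `L¹`-distance between the sections `p (x, ·)` and `p (x', ·)`. -/
noncomputable def sectionDist (p : ℝ × β → ℝ) (x x' : ℝ) : ℝ := ∫ w, |p (x, w) - p (x', w)| ∂b

lemma measurable_sectionDist {p : ℝ × β → ℝ} (hp : Measurable p) :
    Measurable fun q : ℝ × ℝ => sectionDist b p q.1 q.2 := by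
  refine (StronglyMeasurable.integral_prod_right
    (f := fun (q : ℝ × ℝ) w => |p (q.1, w) - p (q.2, w)|) ?_).measurable
  exact (by fun_prop : Measurable _).stronglyMeasurable

lemma sectionDist_nonneg (p : ℝ × β → ℝ) (x x' : ℝ) : 0 ≤ sectionDist b p x x' :=
  integral_nonneg fun _ => abs_nonneg _

/-- Fubini moves the noise `w` outside. For fixed `w` the section is an integrable function of the
covariate alone, to which `tendsto_neighbourDist` applies; dominated convergence over `w` finishes.
-/
lemma tendsto_adjSum_sectionDist {p : ℝ × β → ℝ} (hp : Measurable p) (hb : ∀ z, |p z| ≤ 1) :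
    Tendsto (fun n : ℕ => (n : ℝ)⁻¹ * ∫ x, adjSum Finset.univ x
      (fun i j => sectionDist b p (x i) (x j)) ∂Measure.pi fun _ : Fin n => ν) atTop (𝓝 0) := by
  have hle (x x' : ℝ) (w : β) : |p (x, w) - p (x', w)| ≤ 2 :=
    (abs_sub _ _).trans (by linarith [hb (x, w), hb (x', w)])
  have hadj (n : ℕ) : Measurable fun q : (Fin n → ℝ) × β => adjSum Finset.univ q.1
      (fun i j => |p (q.1 i, q.2) - p (q.1 j, q.2)|) := by
    unfold adjSum
    fun_prop
  have hbd (n : ℕ) (q : (Fin n → ℝ) × β) : ‖adjSum Finset.univ q.1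
      (fun i j => |p (q.1 i, q.2) - p (q.1 j, q.2)|)‖ ≤ n * (n * 2) := by
    have := abs_adjSum_le_sq (s := Finset.univ) (x := q.1)
      (w := fun i j => |p (q.1 i, q.2) - p (q.1 j, q.2)|) (C := 2)
      fun i j => by rw [abs_abs]; exact hle _ _ _
    simpa using this
  have hint (x : ℝ) : Integrable (fun w => p (x, w)) b :=
    Integrable.of_bound (by fun_prop : Measurable _).aestronglyMeasurable 1
      (ae_of_all _ fun w => hb _)
  have e (n : ℕ) : (n : ℝ)⁻¹ * ∫ x, adjSum Finset.univ x
      (fun i j => sectionDist b p (x i) (x j)) ∂(Measure.pi fun _ : Fin n => ν) =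
      ∫ w, neighbourDist ν n (fun x => p (x, w)) ∂b := by
    unfold neighbourDist
    rw [integral_const_mul]
    congr 1
    rw [← integral_integral_swap (f := fun (x : Fin n → ℝ) w => adjSum Finset.univ x
      (fun i j => |p (x i, w) - p (x j, w)|))]
    · congr 1
      funext x
      unfold adjSum sectionDist
      rw [integral_finsetSum]
      · refine Finset.sum_congr rfl fun i _ => ?_
        rw [integral_finsetSum]
        · exact Finset.sum_congr rfl fun j _ => (integral_const_mul _ _).symm
        · exact fun j _ => ((hint _).sub (hint _)).abs.const_mul _
      · exact fun i _ => integrable_finsetSum _ fun j _ => ((hint _).sub (hint _)).abs.const_mul _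
    · exact Integrable.of_bound (hadj n).aestronglyMeasurable (n * (n * 2))
        (ae_of_all _ fun q => hbd n q)
  simp only [e]
  rw [← integral_zero β ℝ (μ := b)]
  refine tendsto_integral_of_dominated_convergence (fun _ => 2) (fun n => ?_)
    (integrable_const _) (fun n => ae_of_all _ fun w => ?_) (ae_of_all _ fun w => ?_)
  · unfold neighbourDist
    exact ((StronglyMeasurable.integral_prod_left (hadj n).stronglyMeasurable).const_mul
      _).aestronglyMeasurable
  · rw [Real.norm_eq_abs, abs_of_nonneg (neighbourDist_nonneg _ _)]
    have hi : Integrable (fun x => p (x, w)) ν :=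
      Integrable.of_bound (by fun_prop : Measurable _).aestronglyMeasurable 1
        (ae_of_all _ fun x => hb _)
    refine (neighbourDist_le_add hi (integrable_const (0 : ℝ))).trans ?_
    have h0 : neighbourDist ν n (fun _ => (0 : ℝ)) = 0 := by simp [neighbourDist, adjSum]
    have h1 : ∫ x, |p (x, w) - 0| ∂ν ≤ 1 := by
      refine (integral_mono (hi.sub (integrable_const (0 : ℝ))).abs (integrable_const (1 : ℝ))
        fun x => ?_).trans (by simp)
      simpa using hb (x, w)
    rw [h0]
    linarith
  · exact tendsto_neighbourDist (Integrable.of_bound (by fun_prop : Measurable _).aestronglyMeasurable 1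
      (ae_of_all _ fun x => hb _))

end NeighbourContinuity

/-! ### Variance bounds and the law of large numbers in mean. -/

section BoundedVariance

variable {ι α : Type*} [Fintype ι] [DecidableEq ι] [MeasurableSpace α]
  (l : Measure α) [IsProbabilityMeasure l]

/-- This is nonnegativity of the variance of the absolute deviation. -/
lemma integral_abs_sub_integral_le {P : Measure α} [IsProbabilityMeasure P] {f : α → ℝ}
    (hf : MemLp f 2 P) : ∫ z, |f z - ∫ y, f y ∂P| ∂P ≤ √(Var[f; P]) := by
  have h1 : MemLp (fun z => |f z - ∫ y, f y ∂P|) 2 P := (hf.sub (memLp_const _)).abs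
  have h2 := variance_nonneg (fun z => |f z - ∫ y, f y ∂P|) P
  rw [variance_eq_sub h1] at h2
  refine Real.le_sqrt_of_sq_le ?_
  rw [variance_eq_integral hf.1.aemeasurable]
  simp only [Pi.pow_apply, sq_abs] at h2
  linarith

lemma variance_le_of_abs_sub_le {f : (ι → α) → ℝ} (hf : Measurable f) {C : ℝ}
    (hC : ∀ z, |f z| ≤ C) {g : ι → (ι → α) → ℝ} (hg : ∀ k, Measurable (g k)) {D : ℝ}
    (hD : ∀ k z, |g k z| ≤ D) (hgk : ∀ k z a, g k (Function.update z k a) = g k z)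
    {c : ℝ} (hc : ∀ k, ∀ᵐ z ∂Measure.pi fun _ : ι => l, |f z - g k z| ≤ c) :
    Var[f; Measure.pi fun _ : ι => l] ≤ 2 * (Fintype.card ι * c ^ 2) := by
  refine (variance_le_two_mul_sum l hf hC hg hD hgk).trans ?_
  refine mul_le_mul_of_nonneg_left ?_ zero_le_two
  have : ∀ k ∈ (Finset.univ : Finset ι),
      ∫ z, (f z - g k z) ^ 2 ∂(Measure.pi fun _ : ι => l) ≤ c ^ 2 := by
    intro k _
    have h1 : ∫ z, (f z - g k z) ^ 2 ∂(Measure.pi fun _ : ι => l) ≤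
        ∫ _, c ^ 2 ∂(Measure.pi fun _ : ι => l) := by
      refine integral_mono_of_nonneg (ae_of_all _ fun z => sq_nonneg _) (integrable_const _) ?_
      filter_upwards [hc k] with z hz
      exact sq_le_sq' (by linarith [neg_abs_le (f z - g k z)]) ((le_abs_self _).trans hz)
    simpa using h1
  simpa using Finset.sum_le_card_nsmul _ _ _ this

/-- Evaluating a statistic at one of the observations, compared with evaluating it at an
independent copy. -/
lemma integral_abs_eval_le {G : (ι → α) → α → ℝ} (hG : Measurable (Function.uncurry G))
    {Gk : (ι → α) → α → ℝ} (hGk : Measurable (Function.uncurry Gk)) (k : ι)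
    (hk : ∀ z a y, Gk (Function.update z k a) y = Gk z y) {C : ℝ} (hC : ∀ z y, |G z y| ≤ C)
    (hCk : ∀ z y, |Gk z y| ≤ C)
    {δ : ℝ} (hδ : ∀ᵐ z ∂Measure.pi fun _ : ι => l, ∀ y, |G z y - Gk z y| ≤ δ) :
    ∫ z, |G z (z k)| ∂(Measure.pi fun _ : ι => l) ≤
      2 * δ + ∫ y, ∫ z, |G z y| ∂(Measure.pi fun _ : ι => l) ∂l := by
  have hmk : Measurable fun z : ι → α => |Gk z (z k)| := by fun_prop
  have hm : Measurable fun z : ι → α => |G z (z k)| := by fun_prop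
  -- Replacing `G` by `Gk`, which does not see coordinate `k`, and later returning to `G` costs `δ`
  -- each time.
  have h1 : ∫ z, |G z (z k)| ∂(Measure.pi fun _ : ι => l) ≤
      ∫ z, (δ + |Gk z (z k)|) ∂(Measure.pi fun _ : ι => l) := by
    refine integral_mono_ae (Integrable.of_bound hm.aestronglyMeasurable C (ae_of_all _ fun z => ?_))
      ((integrable_const _).add (Integrable.of_bound hmk.aestronglyMeasurable C
        (ae_of_all _ fun z => ?_))) ?_
    · simpa using hC _ _
    · simpa using hCk _ _
    · filter_upwards [hδ] with z hz
      have := abs_sub_abs_le_abs_sub (G z (z k)) (Gk z (z k))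
      linarith [hz (z k)]
  have hik : Integrable (fun z : ι → α => |Gk z (z k)|) (Measure.pi fun _ : ι => l) :=
    Integrable.of_bound hmk.aestronglyMeasurable C (ae_of_all _ fun z => by simpa using hCk _ _)
  rw [integral_add (integrable_const _) hik] at h1
  have hi2 : Integrable (fun p : (ι → α) × α => |Gk p.1 p.2|)
      ((Measure.pi fun _ : ι => l).prod l) :=
    Integrable.of_bound (by fun_prop : Measurable _).aestronglyMeasurable C
      (ae_of_all _ fun z => by simpa using hCk _ _)
  have hi3 : Integrable (fun p : (ι → α) × α => |G p.1 p.2|)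
      ((Measure.pi fun _ : ι => l).prod l) :=
    Integrable.of_bound (by fun_prop : Measurable _).aestronglyMeasurable C
      (ae_of_all _ fun z => by simpa using hC _ _)
  -- Redrawing coordinate `k` leaves `Gk` unchanged, so the point of evaluation is independent of
  -- it.
  have h2 : ∫ z, |Gk z (z k)| ∂(Measure.pi fun _ : ι => l) =
      ∫ y, ∫ z, |Gk z y| ∂(Measure.pi fun _ : ι => l) ∂l := by
    rw [← integral_comp_measurePreserving (measurePreserving_resample l k) hmk.aestronglyMeasurable]
    simp only [hk, Function.update_self]
    exact integral_prod_symm _ hi2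
  have h3 : ∫ y, ∫ z, |Gk z y| ∂(Measure.pi fun _ : ι => l) ∂l ≤
      ∫ y, (δ + ∫ z, |G z y| ∂(Measure.pi fun _ : ι => l)) ∂l := by
    refine integral_mono hi2.integral_prod_right ((integrable_const _).add
      hi3.integral_prod_right) fun y => ?_
    have h4 : ∫ z, |Gk z y| ∂(Measure.pi fun _ : ι => l) ≤
        ∫ z, (δ + |G z y|) ∂(Measure.pi fun _ : ι => l) := by
      have hGy : Integrable (fun z => |G z y|) (Measure.pi fun _ : ι => l) :=
        Integrable.of_bound (by fun_prop : Measurable _).aestronglyMeasurable C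
          (ae_of_all _ fun z => by simpa using hC _ _)
      refine integral_mono_ae (Integrable.of_bound (by fun_prop : Measurable _).aestronglyMeasurable C
          (ae_of_all _ fun z => by simpa using hCk _ _)) ((integrable_const _).add hGy) ?_
      filter_upwards [hδ] with z hz
      have h5 := abs_sub_abs_le_abs_sub (Gk z y) (G z y)
      have h6 := hz y
      rw [abs_sub_comm] at h6
      linarith
    rwa [integral_add (integrable_const _) (Integrable.of_bound
      (by fun_prop : Measurable _).aestronglyMeasurable C
      (ae_of_all _ fun z => by simpa using hC _ _)), integral_const, probReal_univ, one_smul] at h4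
  rw [integral_add (integrable_const _) hi3.integral_prod_right] at h3
  simp only [integral_const, probReal_univ, one_smul] at h1 h3
  linarith

/-- The law of large numbers, in mean. -/
lemma tendsto_mean_abs_sub {d : α → ℝ} (hd : Measurable d) {B : ℝ} (hB : ∀ z, |d z| ≤ B) :
    Tendsto (fun n : ℕ => ∫ z, |(n : ℝ)⁻¹ * ∑ i, d (z i) - ∫ a, d a ∂l|
      ∂Measure.pi fun _ : Fin n => l) atTop (𝓝 0) := by
  have hdi : Integrable d l := Integrable.of_bound hd.aestronglyMeasurable B (ae_of_all _ hB)
  have hlim : Tendsto (fun n : ℕ => √(2 * B ^ 2 * (n : ℝ)⁻¹)) atTop (𝓝 0) := by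
    have : Tendsto (fun n : ℕ => √(2 * B ^ 2 * (n : ℝ)⁻¹)) atTop (𝓝 √(2 * B ^ 2 * 0)) :=
      (Real.continuous_sqrt.tendsto _).comp
        (tendsto_inv_atTop_nhds_zero_nat.const_mul (2 * B ^ 2))
    simpa using this
  refine squeeze_zero' (Eventually.of_forall fun n => integral_nonneg fun z => abs_nonneg _) ?_ hlim
  filter_upwards [eventually_gt_atTop 0] with n hn
  have hn' : (0 : ℝ) < n := by exact_mod_cast hn
  have hm (s : Finset (Fin n)) : Measurable fun z : Fin n → α => (n : ℝ)⁻¹ * ∑ i ∈ s, d (z i) := by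
    fun_prop
  have hbd (s : Finset (Fin n)) (z : Fin n → α) : |(n : ℝ)⁻¹ * ∑ i ∈ s, d (z i)| ≤
      (n : ℝ)⁻¹ * (s.card • B) := by
    rw [abs_mul, abs_of_pos (by positivity)]
    exact mul_le_mul_of_nonneg_left ((Finset.abs_sum_le_sum_abs _ _).trans
      (Finset.sum_le_card_nsmul _ _ _ fun i _ => hB _)) (by positivity)
  have hmean : ∫ z, (n : ℝ)⁻¹ * ∑ i, d (z i) ∂(Measure.pi fun _ : Fin n => l) = ∫ a, d a ∂l := by
    rw [integral_const_mul, integral_finsetSum]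
    · simp only [integral_comp_measurePreserving (measurePreserving_eval (fun _ : Fin n => l) _) hdi.1]
      simp
      field_simp
    · exact fun i _ =>
        (measurePreserving_eval (fun _ : Fin n => l) i).integrable_comp_of_integrable hdi
  have hB0 : 0 ≤ B := by
    obtain ⟨a⟩ : Nonempty α := nonempty_of_isProbabilityMeasure l
    exact (abs_nonneg _).trans (hB a)
  have h1 := integral_abs_sub_integral_le (P := Measure.pi fun _ : Fin n => l)
    (MemLp.of_bound (hm Finset.univ).aestronglyMeasurable _ (ae_of_all _ fun z => hbd _ z))
  rw [hmean] at h1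
  refine h1.trans (Real.sqrt_le_sqrt ?_)
  refine (variance_le_of_abs_sub_le l (hm Finset.univ) (fun z => hbd _ z)
    (g := fun k z => (n : ℝ)⁻¹ * ∑ i ∈ Finset.univ.erase k, d (z i)) (fun k => hm _)
    (D := (n : ℝ)⁻¹ * (n • B)) (fun k z => (hbd _ z).trans ?_) (fun k z a => ?_)
    (c := (n : ℝ)⁻¹ * B) (fun k => ae_of_all _ fun z => ?_)).trans (le_of_eq ?_)
  · gcongr
    simp
  · congr 1
    exact Finset.sum_congr rfl fun i hi => by rw [Function.update_of_ne (Finset.ne_of_mem_erase hi)]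
  · rw [← mul_sub, ← Finset.sum_erase_add _ _ (Finset.mem_univ k), add_sub_cancel_left, abs_mul,
      abs_of_pos (by positivity : (0 : ℝ) < (n : ℝ)⁻¹)]
    exact mul_le_mul_of_nonneg_left (hB _) (by positivity)
  · simp only [Fintype.card_fin]
    field_simp

end BoundedVariance

/-! ### Laws of large numbers for averages over neighbours. -/

section NeighbourLLN

variable {ι : Type*} [Fintype ι] [DecidableEq ι] (ν : Measure ℝ) [IsProbabilityMeasure ν]
variable {β : Type*} [MeasurableSpace β] (b : Measure β) [IsProbabilityMeasure b]

lemma integral_resample_snd {G : (ι → ℝ × β) → ℝ} (hG : Measurable G) {C : ℝ}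
    (hC : ∀ z, |G z| ≤ C) (k : ι) :
    ∫ z, G z ∂(Measure.pi fun _ : ι => ν.prod b) =
      ∫ z, ∫ w, G (Function.update z k ((z k).1, w)) ∂b ∂(Measure.pi fun _ : ι => ν.prod b) := by
  rw [← integral_comp_measurePreserving (measurePreserving_resample_snd ν b k)
    hG.aestronglyMeasurable]
  exact integral_prod _ (Integrable.of_bound
    (hG.comp (measurePreserving_resample_snd ν b k).measurable).aestronglyMeasurable C
    (ae_of_all _ fun z => hC _))

lemma fst_update (z : ι → ℝ × β) (k : ι) (w : β) :
    (fun i => (Function.update z k ((z k).1, w) i).1) = fun i => (z i).1 := by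
  funext i
  by_cases h : i = k
  · subst h; simp
  · simp [h]

/-- Given the covariates, the response noise of neighbours can be averaged independently. -/
lemma integral_adjSum_pair {ψ : ℝ × β → ℝ × β → ℝ} (hψ : Measurable (Function.uncurry ψ)) {B : ℝ}
    (hB : ∀ z z', |ψ z z'| ≤ B) (s : Finset ι) :
    ∫ z, adjSum s (fun i => (z i).1) (fun i j => ψ (z i) (z j))
      ∂(Measure.pi fun _ : ι => ν.prod b) =
    ∫ x, adjSum s x (fun i j => ∫ w, ∫ w', ψ (x i, w) (x j, w') ∂b ∂b)
      ∂(Measure.pi fun _ : ι => ν) := by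
  have hψ1 : Measurable (Function.uncurry fun (z : ℝ × β) (x' : ℝ) => ∫ w', ψ z (x', w') ∂b) := by
    refine (StronglyMeasurable.integral_prod_right
      (f := fun (q : (ℝ × β) × ℝ) w => ψ q.1 (q.2, w)) ?_).measurable
    exact (by fun_prop : Measurable _).stronglyMeasurable
  have hψ2 : Measurable (Function.uncurry fun (x x' : ℝ) => ∫ w, ∫ w', ψ (x, w) (x', w') ∂b ∂b) := by
    refine (StronglyMeasurable.integral_prod_right
      (f := fun (q : ℝ × ℝ) w => ∫ w', ψ (q.1, w) (q.2, w') ∂b) ?_).measurable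
    have : Measurable fun q : (ℝ × ℝ) × β => ∫ w', ψ (q.1.1, q.2) (q.1.2, w') ∂b :=
      hψ1.comp (by fun_prop : Measurable fun q : (ℝ × ℝ) × β => ((q.1.1, q.2), q.1.2))
    exact this.stronglyMeasurable
  have hB1 (z : ℝ × β) (x' : ℝ) : |∫ w', ψ z (x', w') ∂b| ≤ B := by
    have := norm_integral_le_of_norm_le_const (μ := b) (f := fun w' => ψ z (x', w'))
      (ae_of_all _ fun w' => hB _ _)
    simpa using this
  have hB2 (x x' : ℝ) : |∫ w, ∫ w', ψ (x, w) (x', w') ∂b ∂b| ≤ B := by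
    have := norm_integral_le_of_norm_le_const (μ := b) (f := fun w => ∫ w', ψ (x, w) (x', w') ∂b)
      (ae_of_all _ fun w' => hB1 _ _)
    simpa using this
  have habs (x : ι → ℝ) (i j : ι) {a : ℝ} (ha : |a| ≤ B) : |adjInd s x i j * a| ≤ B := by
    rw [abs_mul, abs_of_nonneg (adjInd_nonneg _ _ _ _)]
    exact (mul_le_of_le_one_left (abs_nonneg _) (adjInd_le_one _ _ _ _)).trans ha
  unfold adjSum
  have hterm (i j : ι) : ∫ z, adjInd s (fun i => (z i).1) i j * ψ (z i) (z j)
      ∂(Measure.pi fun _ : ι => ν.prod b) =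
      ∫ x, adjInd s x i j * ∫ w, ∫ w', ψ (x i, w) (x j, w') ∂b ∂b ∂(Measure.pi fun _ : ι => ν) := by
    -- The noise of two distinct indices is redrawn below; on the diagonal the adjacency indicator
    -- is zero.
    by_cases hij : i = j
    · subst hij
      simp [adjInd_self]
    have m0 : Measurable fun z : ι → ℝ × β => adjInd s (fun i => (z i).1) i j * ψ (z i) (z j) := by
      fun_prop
    have m1 : Measurable fun z : ι → ℝ × β => adjInd s (fun i => (z i).1) i j *
        ∫ w', ψ (z i) ((z j).1, w') ∂b :=
      (by fun_prop : Measurable fun z : ι → ℝ × β => adjInd s (fun i => (z i).1) i j).mul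
        (hψ1.comp (by fun_prop : Measurable fun z : ι → ℝ × β => (z i, (z j).1)))
    have m2 : Measurable fun x : ι → ℝ => adjInd s x i j *
        ∫ w, ∫ w', ψ (x i, w) (x j, w') ∂b ∂b :=
      (by fun_prop : Measurable fun x : ι → ℝ => adjInd s x i j).mul
        (hψ2.comp (by fun_prop : Measurable fun x : ι → ℝ => (x i, x j)))
    -- Only the noise is redrawn, so the covariates and hence the adjacency indicator remain fixed.
    rw [integral_resample_snd ν b m0 (fun z => habs _ _ _ (hB _ _)) j]
    simp only [fst_update, Function.update_self, Function.update_of_ne hij, integral_const_mul]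
    rw [integral_resample_snd ν b m1 (fun z => habs _ _ _ (hB1 _ _)) i]
    simp only [fst_update, Function.update_self, Function.update_of_ne (Ne.symm hij),
      integral_const_mul]
    exact integral_comp_measurePreserving (measurePreserving_fst_pi ν b) m2.aestronglyMeasurable
  have i1 (i j : ι) : Integrable (fun z : ι → ℝ × β => adjInd s (fun i => (z i).1) i j *
      ψ (z i) (z j)) (Measure.pi fun _ : ι => ν.prod b) :=
    Integrable.of_bound (by fun_prop : Measurable _).aestronglyMeasurable B
      (ae_of_all _ fun z => habs _ _ _ (hB _ _))
  have i2 (i j : ι) : Integrable (fun x : ι → ℝ => adjInd s x i j *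
        ∫ w, ∫ w', ψ (x i, w) (x j, w') ∂b ∂b) (Measure.pi fun _ : ι => ν) := by
    refine Integrable.of_bound (Measurable.aestronglyMeasurable ?_) B
      (ae_of_all _ fun z => habs _ _ _ (hB2 _ _))
    exact (by fun_prop : Measurable fun x : ι → ℝ => adjInd s x i j).mul
        (hψ2.comp (by fun_prop : Measurable fun x : ι → ℝ => (x i, x j)))
  rw [integral_finsetSum _ fun i _ => integrable_finsetSum _ fun j _ => i1 i j,
    integral_finsetSum _ fun i _ => integrable_finsetSum _ fun j _ => i2 i j]
  refine Finset.sum_congr rfl fun i _ => ?_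
  rw [integral_finsetSum _ fun j _ => i1 i j, integral_finsetSum _ fun j _ => i2 i j]
  exact Finset.sum_congr rfl fun j _ => hterm i j

/-- The change of `adjSum` when one index is removed. -/
lemma abs_adjSum_sub_erase_le {x : ι → ℝ} (hx : Function.Injective x) {s : Finset ι} {k : ι}
    (hk : k ∈ s) {w : ι → ι → ℝ} {B : ℝ} (hB : ∀ i j, |w i j| ≤ B) :
    |adjSum s x w - adjSum (s.erase k) x w| ≤ 3 * B := by
  have hB0 : 0 ≤ B := (abs_nonneg _).trans (hB k k)
  have aux (a c : ι → ℝ) (ha : ∀ i, 0 ≤ a i) (h1 : ∑ i, a i ≤ 1) (hc : ∀ i, |c i| ≤ B) :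
      |∑ i, a i * c i| ≤ B := by
    refine (Finset.abs_sum_le_sum_abs _ _).trans ?_
    have : ∑ i, |a i * c i| ≤ ∑ i, a i * B := Finset.sum_le_sum fun i _ => by
      rw [abs_mul, abs_of_nonneg (ha i)]
      exact mul_le_mul_of_nonneg_left (hc i) (ha i)
    rw [← Finset.sum_mul] at this
    exact this.trans (mul_le_of_le_one_left hB0 h1)
  rw [adjSum_erase hx hk w]
  have h1 := aux (fun i => adjInd s x i k) (fun i => w i k) (fun i => adjInd_nonneg _ _ _ _)
    (sum_adjInd_left_le hx k) (fun i => hB _ _)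
  have h2 := aux (fun j => adjInd s x k j) (fun j => w k j) (fun i => adjInd_nonneg _ _ _ _)
    (sum_adjInd_right_le hx k) (fun i => hB _ _)
  have h3 := aux (fun i => adjInd s x i k) (fun i => ∑ j, adjInd s x k j * w i j)
    (fun i => adjInd_nonneg _ _ _ _) (sum_adjInd_left_le hx k)
    (fun i => aux (fun j => adjInd s x k j) (fun j => w i j) (fun i => adjInd_nonneg _ _ _ _)
    (sum_adjInd_right_le hx k) (fun i => hB _ _))
  rw [abs_le] at h1 h2 h3 ⊢
  constructor <;> linarith [h1.1, h1.2, h2.1, h2.2, h3.1, h3.2]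

lemma adjSum_update_erase {x : ι → ℝ} {s : Finset ι} {k : ι} {x' : ι → ℝ}
    (hx : ∀ i, i ≠ k → x' i = x i) {w w' : ι → ι → ℝ}
    (hw : ∀ i j, i ≠ k → j ≠ k → w i j = w' i j) :
    adjSum (s.erase k) x' w = adjSum (s.erase k) x w' := by
  have hx' : x' = Function.update x k (x' k) := by
    funext i
    by_cases h : i = k
    · subst h; simp
    · simp [h, hx i h]
  unfold adjSum
  refine Finset.sum_congr rfl fun i _ => Finset.sum_congr rfl fun j _ => ?_
  rw [hx', adjInd_update_erase]
  by_cases h : Adj (s.erase k) x i j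
  · rw [hw i j (Finset.ne_of_mem_erase h.1) (Finset.ne_of_mem_erase h.2.1)]
  · rw [adjInd_of_not_adj h, zero_mul, zero_mul]

/-- A law of large numbers for averages over neighbours. -/
theorem tendsto_adjSum_lln [NullSingletonClass ν] {ψ : ℝ × β → ℝ × β → ℝ}
    (hψ : Measurable (Function.uncurry ψ)) {B : ℝ} (hB : ∀ z z', |ψ z z'| ≤ B)
    {ψ0 : ℝ → ℝ} (hψ0 : Measurable ψ0) (hB0 : ∀ x, |ψ0 x| ≤ B)
    {r : ℝ → ℝ → ℝ} (hr : ∀ x x', |∫ w, ∫ w', ψ (x, w) (x', w') ∂b ∂b - ψ0 x| ≤ r x x')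
    (hrm : Measurable (Function.uncurry r)) {R : ℝ} (hR : ∀ x x', |r x x'| ≤ R)
    (hlim : Tendsto (fun n : ℕ => (n : ℝ)⁻¹ * ∫ x, adjSum Finset.univ x
      (fun i j => r (x i) (x j)) ∂Measure.pi fun _ : Fin n => ν) atTop (𝓝 0)) :
    Tendsto (fun n : ℕ => ∫ z, |(n : ℝ)⁻¹ * adjSum Finset.univ (fun i => (z i).1)
      (fun i j => ψ (z i) (z j)) - ∫ x, ψ0 x ∂ν| ∂Measure.pi fun _ : Fin n => ν.prod b)
      atTop (𝓝 0) := by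
  have hBnn : 0 ≤ B := (abs_nonneg _).trans (hB0 0)
  have hlim1 : Tendsto (fun n : ℕ => √(18 * B ^ 2 * (n : ℝ)⁻¹)) atTop (𝓝 0) := by
    have : Tendsto (fun n : ℕ => √(18 * B ^ 2 * (n : ℝ)⁻¹)) atTop (𝓝 √(18 * B ^ 2 * 0)) :=
      (Real.continuous_sqrt.tendsto _).comp
        (tendsto_inv_atTop_nhds_zero_nat.const_mul (18 * B ^ 2))
    simpa using this
  have hlim2 := (hlim1.add hlim).add (tendsto_inv_atTop_nhds_zero_nat.const_mul B)
  simp only [add_zero, mul_zero] at hlim2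
  refine squeeze_zero' (Eventually.of_forall fun n => integral_nonneg fun z => abs_nonneg _) ?_ hlim2
  filter_upwards [eventually_gt_atTop 0] with n hn
  have hn' : (0 : ℝ) < n := by exact_mod_cast hn
  set Q := Measure.pi fun _ : Fin n => ν.prod b with hQ
  set f : Finset (Fin n) → (Fin n → ℝ × β) → ℝ := fun s z => (n : ℝ)⁻¹ *
    adjSum s (fun i => (z i).1) (fun i j => ψ (z i) (z j)) with hf
  have hm (s : Finset (Fin n)) : Measurable (f s) := by
    simp only [hf, adjSum]
    fun_prop
  have hbd (s : Finset (Fin n)) (z : Fin n → ℝ × β) : |f s z| ≤ (n : ℝ)⁻¹ * (n * (n * B)) := by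
    simp only [hf]
    rw [abs_mul, abs_of_pos (by positivity)]
    have := abs_adjSum_le_sq (s := s) (x := fun i => (z i).1) (w := fun i j => ψ (z i) (z j))
      (C := B) fun i j => hB _ _
    rw [Fintype.card_fin] at this
    exact mul_le_mul_of_nonneg_left this (by positivity)
  have hmem : MemLp (f Finset.univ) 2 Q := MemLp.of_bound (hm _).aestronglyMeasurable _
    (ae_of_all _ fun z => hbd _ z)
  have h1 := integral_abs_sub_integral_le hmem
  -- Erasing an index changes the sum over neighbours by at most `3 B`; the constant is `18 = 2 * 3
  -- ^ 2`.
  have hvar : Var[f Finset.univ; Q] ≤ 18 * B ^ 2 * (n : ℝ)⁻¹ := by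
    refine (variance_le_of_abs_sub_le (ν.prod b) (hm Finset.univ) (fun z => hbd _ z)
      (g := fun k => f (Finset.univ.erase k)) (fun k => hm _) (fun k z => hbd _ z)
      (fun k z a => ?_) (c := (n : ℝ)⁻¹ * (3 * B)) (fun k => ?_)).trans (le_of_eq ?_)
    · simp only [hf]
      congr 1
      refine adjSum_update_erase (fun i hi => ?_) fun i j hi hj => ?_
      · rw [Function.update_of_ne hi]
      · rw [Function.update_of_ne hi, Function.update_of_ne hj]
    · filter_upwards [ae_injective_fst (ι := Fin n) ν b] with z hz
      simp only [hf]
      rw [← mul_sub, abs_mul, abs_of_pos (by positivity : (0 : ℝ) < (n : ℝ)⁻¹)]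
      exact mul_le_mul_of_nonneg_left (abs_adjSum_sub_erase_le hz (Finset.mem_univ k)
        fun i j => hB _ _) (by positivity)
    · rw [Fintype.card_fin]
      field_simp
      ring
  have hψ0i : Integrable ψ0 ν := Integrable.of_bound hψ0.aestronglyMeasurable B (ae_of_all _ hB0)
  -- Averaging over the noise turns a pair into `ψ0 (x i)` up to `r`. The extra `B / n` pays for the
  -- last index, which has no right neighbour.
  have hmean : |∫ z, f Finset.univ z ∂Q - ∫ x, ψ0 x ∂ν| ≤ (n : ℝ)⁻¹ * ∫ x, adjSum Finset.univ x
      (fun i j => r (x i) (x j)) ∂(Measure.pi fun _ : Fin n => ν) + B * (n : ℝ)⁻¹ := by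
    have e1 : ∫ z, f Finset.univ z ∂Q = (n : ℝ)⁻¹ * ∫ x, adjSum Finset.univ x
        (fun i j => ∫ w, ∫ w', ψ (x i, w) (x j, w') ∂b ∂b) ∂(Measure.pi fun _ : Fin n => ν) := by
      simp only [hf]
      rw [integral_const_mul, integral_adjSum_pair ν b hψ hB]
    have e2 : ∫ x, ψ0 x ∂ν = (n : ℝ)⁻¹ * ∫ x, ∑ i, ψ0 (x i) ∂(Measure.pi fun _ : Fin n => ν) := by
      rw [integral_finsetSum]
      · simp only [integral_comp_measurePreserving (measurePreserving_eval (fun _ : Fin n => ν) _)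
          hψ0i.1]
        simp
        field_simp
      · exact fun i _ =>
          (measurePreserving_eval (fun _ : Fin n => ν) i).integrable_comp_of_integrable hψ0i
    have hψ2 : Measurable (Function.uncurry fun (x x' : ℝ) => ∫ w, ∫ w', ψ (x, w) (x', w') ∂b ∂b) := by
      refine (StronglyMeasurable.integral_prod_right
        (f := fun (q : ℝ × ℝ) w => ∫ w', ψ (q.1, w) (q.2, w') ∂b) ?_).measurable
      have : Measurable fun q : (ℝ × ℝ) × β => ∫ w', ψ (q.1.1, q.2) (q.1.2, w') ∂b :=
        (StronglyMeasurable.integral_prod_right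
          (f := fun (q : (ℝ × ℝ) × β) w' => ψ (q.1.1, q.2) (q.1.2, w'))
          (by fun_prop : Measurable _).stronglyMeasurable).measurable
      exact this.stronglyMeasurable
    have hB2 (x x' : ℝ) : |∫ w, ∫ w', ψ (x, w) (x', w') ∂b ∂b| ≤ B + R := by
      have h := (abs_le.1 (hr x x'))
      have h0 := abs_le.1 (hB0 x)
      have hR' := abs_le.1 (hR x x')
      rw [abs_le]
      constructor <;> linarith [h.1, h.2]
    have iadj (w : ℝ → ℝ → ℝ) (hw : Measurable (Function.uncurry w)) (C : ℝ)
        (hC : ∀ x x', |w x x'| ≤ C) : Integrable (fun x : Fin n → ℝ => adjSum Finset.univ x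
          (fun i j => w (x i) (x j))) (Measure.pi fun _ : Fin n => ν) := by
      refine Integrable.of_bound (Measurable.aestronglyMeasurable ?_) (n * (n * C))
        (ae_of_all _ fun x => ?_)
      · unfold adjSum
        refine Finset.measurable_fun_sum _ fun i _ => Finset.measurable_fun_sum _ fun j _ => ?_
        exact (measurable_adjInd _ i j).mul (hw.comp (by fun_prop : Measurable
          fun x : Fin n → ℝ => (x i, x j)))
      · have := abs_adjSum_le_sq (s := Finset.univ) (x := x) (w := fun i j => w (x i) (x j))
          (C := C) fun i j => hC _ _
        simpa using this
    have i1 := iadj _ hψ2 _ hB2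
    have i2 : Integrable (fun x : Fin n → ℝ => ∑ i, ψ0 (x i)) (Measure.pi fun _ : Fin n => ν) :=
      integrable_finsetSum _ fun i _ =>
          (measurePreserving_eval (fun _ : Fin n => ν) i).integrable_comp_of_integrable hψ0i
    have i3 := iadj _ hrm _ hR
    rw [e1, e2, ← mul_sub, ← integral_sub i1 i2, abs_mul,
      abs_of_pos (by positivity : (0 : ℝ) < (n : ℝ)⁻¹), mul_comm B, ← mul_add]
    refine mul_le_mul_of_nonneg_left ?_ (by positivity)
    refine (abs_integral_le_integral_abs).trans ?_
    have h2 : ∫ x, |adjSum Finset.univ x (fun i j => ∫ w, ∫ w', ψ (x i, w) (x j, w') ∂b ∂b) -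
        ∑ i, ψ0 (x i)| ∂(Measure.pi fun _ : Fin n => ν) ≤ ∫ x, (adjSum Finset.univ x
          (fun i j => r (x i) (x j)) + B) ∂(Measure.pi fun _ : Fin n => ν) := by
      refine integral_mono_ae (i1.sub i2).abs (i3.add (integrable_const _)) ?_
      filter_upwards [ae_injective_pi (ι := Fin n) ν] with x hx
      have g1 : |adjSum Finset.univ x (fun i j => ∫ w, ∫ w', ψ (x i, w) (x j, w') ∂b ∂b - ψ0 (x i))|
          ≤ adjSum Finset.univ x (fun i j => r (x i) (x j)) :=
        (abs_adjSum_le _).trans (adjSum_mono fun i j => hr _ _)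
      rw [adjSum_sub] at g1
      have g2 : |adjSum Finset.univ x (fun i _ => ψ0 (x i)) - ∑ i, ψ0 (x i)| ≤ B := by
        rw [adjSum_fst, ← Finset.sum_sub_distrib]
        refine (Finset.abs_sum_le_sum_abs _ _).trans ?_
        have : ∑ i, |(∑ j, adjInd Finset.univ x i j) * ψ0 (x i) - ψ0 (x i)| ≤
            ∑ i, (1 - ∑ j, adjInd Finset.univ x i j) * B := by
          refine Finset.sum_le_sum fun i _ => ?_
          have h3 := sum_adjInd_right_le (s := Finset.univ) hx i
          rw [← sub_one_mul, abs_mul, abs_sub_comm, abs_of_nonneg (sub_nonneg.2 h3)]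
          exact mul_le_mul_of_nonneg_left (hB0 _) (sub_nonneg.2 h3)
        rw [← Finset.sum_mul] at this
        exact this.trans (mul_le_of_le_one_left hBnn (sum_one_sub_right_le hx))
      rw [abs_le] at g1 g2 ⊢
      constructor <;> linarith [g1.1, g1.2, g2.1, g2.2]
    rw [integral_add i3 (integrable_const _)] at h2
    simpa using h2
  have hfi : Integrable (f Finset.univ) Q := hmem.integrable (by norm_num)
  have hfa : Integrable (fun z => |f Finset.univ z - ∫ y, f Finset.univ y ∂Q|) Q :=
    (hfi.sub (integrable_const _)).abs
  have h3 : ∫ z, |f Finset.univ z - ∫ x, ψ0 x ∂ν| ∂Q ≤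
      ∫ z, (|f Finset.univ z - ∫ y, f Finset.univ y ∂Q| +
        |∫ z, f Finset.univ z ∂Q - ∫ x, ψ0 x ∂ν|) ∂Q :=
    integral_mono (hfi.sub (integrable_const _)).abs (hfa.add
      (integrable_const _)) fun z => abs_sub_le _ _ _
  rw [integral_add hfa (integrable_const _), integral_const,
    probReal_univ, one_smul] at h3
  have h4 := Real.sqrt_le_sqrt hvar
  change ∫ z, |f Finset.univ z - ∫ x, ψ0 x ∂ν| ∂Q ≤ _
  linarith

end NeighbourLLN

/-! ### Exponentials of imaginary sums compared with products of linear factors. -/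

section ExpProduct

/-- Since `log (1 + i y) = i y + y² / 2` up to third order, dividing `exp (i y)` by `1 + i y` leaves
a Gaussian factor and a cubic error. -/
lemma exists_exp_eq_one_add_mul_exp {y : ℝ} (hy : |y| ≤ 1 / 2) : ∃ r : ℂ, ‖r‖ ≤ |y| ^ 3 ∧
    Complex.exp (y * Complex.I) = (1 + y * Complex.I) * Complex.exp (-(y ^ 2 : ℝ) / 2 + r) := by
  have hn : ‖(y * Complex.I : ℂ)‖ = |y| := by simp
  have h := Complex.norm_log_sub_logTaylor_le 2 (z := y * Complex.I) (by rw [hn]; linarith)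
  have ht : Complex.logTaylor 3 (y * Complex.I) = y * Complex.I + (y ^ 2 : ℝ) / 2 := by
    simp only [Complex.logTaylor_succ, Complex.logTaylor_zero]
    push_cast
    norm_num [Nat.factorial]
    linear_combination (-(y : ℂ) ^ 2) * Complex.I_sq
  rw [ht, hn] at h
  have hne : (1 + y * Complex.I : ℂ) ≠ 0 := by
    intro h0
    have := congrArg Complex.re h0
    simp at this
  refine ⟨-(Complex.log (1 + y * Complex.I) - (y * Complex.I + (y ^ 2 : ℝ) / 2)), ?_, ?_⟩
  · rw [norm_neg]
    refine h.trans ?_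
    have h1 : (1 - |y|)⁻¹ ≤ 2 := by
      rw [inv_le_comm₀ (by linarith) two_pos]
      linarith
    have h2 : 0 ≤ |y| ^ 3 := by positivity
    norm_num
    nlinarith
  · conv_rhs => rw [← Complex.exp_log hne, ← Complex.exp_add]
    rw [Complex.exp_log hne]
    congr 1
    ring

lemma norm_exp_sub_exp_le {w v : ℂ} (hw : ‖Complex.exp w‖ ≤ 1) (hv : ‖Complex.exp v‖ ≤ 1) :
    ‖Complex.exp w - Complex.exp v‖ ≤ 2 * ‖w - v‖ := by
  rcases le_total ‖w - v‖ 1 with h | h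
  · have : Complex.exp w - Complex.exp v = Complex.exp v * (Complex.exp (w - v) - 1) := by
      rw [mul_sub, ← Complex.exp_add]
      simp
    rw [this, norm_mul]
    exact (mul_le_of_le_one_left (norm_nonneg _) hv).trans (Complex.norm_exp_sub_one_le h)
  · refine (norm_sub_le _ _).trans ?_
    linarith

lemma one_le_norm_one_add_mul_I (y : ℝ) : 1 ≤ ‖(1 + y * Complex.I : ℂ)‖ := by
  have := Complex.abs_re_le_norm (1 + y * Complex.I)
  simpa using this

lemma norm_one_add_mul_I_le (y : ℝ) : ‖(1 + y * Complex.I : ℂ)‖ ≤ Real.exp (y ^ 2) := by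
  have h0 : ‖(1 + y * Complex.I : ℂ)‖ ^ 2 = 1 + y ^ 2 := by
    rw [← Complex.normSq_eq_norm_sq, Complex.normSq_apply]
    simp
    ring
  have h1 := one_le_norm_one_add_mul_I y
  have h2 : ‖(1 + y * Complex.I : ℂ)‖ ≤ 1 + y ^ 2 := by nlinarith
  exact h2.trans (by linarith [Real.add_one_le_exp (y ^ 2)])

/-- The exponential of an imaginary sum, compared with the product of the linear factors. -/
lemma norm_exp_sum_sub_prod_le {ι : Type*} (s : Finset ι) {y : ι → ℝ} {δ v : ℝ} (hδ : δ ≤ 1 / 2)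
    (hy : ∀ j ∈ s, |y j| ≤ δ) (hv : 0 ≤ v) :
    ‖Complex.exp ((∑ j ∈ s, y j : ℝ) * Complex.I) -
      (∏ j ∈ s, (1 + y j * Complex.I)) * Complex.exp (-(v : ℂ) / 2)‖ ≤
    Real.exp (∑ j ∈ s, y j ^ 2) * (|∑ j ∈ s, y j ^ 2 - v| + 2 * δ * ∑ j ∈ s, y j ^ 2) := by
  choose! r hr1 hr2 using fun j (hj : j ∈ s) => exists_exp_eq_one_add_mul_exp ((hy j hj).trans hδ)
  set w : ℂ := -(∑ j ∈ s, y j ^ 2 : ℝ) / 2 + ∑ j ∈ s, r j with hw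
  have e1 : Complex.exp ((∑ j ∈ s, y j : ℝ) * Complex.I) =
      (∏ j ∈ s, (1 + y j * Complex.I)) * Complex.exp w := by
    have : w = ∑ j ∈ s, (-(y j ^ 2 : ℝ) / 2 + r j) := by
      rw [hw, Finset.sum_add_distrib]
      push_cast
      rw [← Finset.sum_div, Finset.sum_neg_distrib]
    rw [this, Complex.exp_sum, ← Finset.prod_mul_distrib]
    push_cast
    rw [Finset.sum_mul, Complex.exp_sum]
    refine Finset.prod_congr rfl fun j hj => ?_
    rw [hr2 j hj]
    push_cast
    rfl
  have h1 : 1 ≤ ‖∏ j ∈ s, (1 + y j * Complex.I : ℂ)‖ := by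
    rw [norm_prod]
    calc (1 : ℝ) = ∏ j ∈ s, 1 := by simp
      _ ≤ _ := Finset.prod_le_prod (fun _ _ => zero_le_one) fun j _ => one_le_norm_one_add_mul_I _
  have h2 : ‖∏ j ∈ s, (1 + y j * Complex.I : ℂ)‖ ≤ Real.exp (∑ j ∈ s, y j ^ 2) := by
    rw [norm_prod, Real.exp_sum]
    exact Finset.prod_le_prod (fun _ _ => norm_nonneg _) fun j _ => norm_one_add_mul_I_le _
  -- The exponential of the imaginary sum has modulus one and the product of linear factors has
  -- modulus at least one, so the remaining factor is at most one. Without this bound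
  -- `norm_exp_sub_exp_le` would not apply.
  have hwn : ‖Complex.exp w‖ ≤ 1 := by
    have h3 := Complex.norm_exp_ofReal_mul_I (∑ j ∈ s, y j)
    rw [e1, norm_mul] at h3
    nlinarith [norm_nonneg (Complex.exp w)]
  have hvn : ‖Complex.exp (-(v : ℂ) / 2)‖ ≤ 1 := by
    have : (-(v : ℂ) / 2) = ((-v / 2 : ℝ) : ℂ) := by push_cast; ring
    rw [this, Complex.norm_exp_ofReal, Real.exp_le_one_iff]
    linarith
  rw [e1, ← mul_sub, norm_mul]
  refine mul_le_mul h2 ((norm_exp_sub_exp_le hwn hvn).trans ?_) (norm_nonneg _) (Real.exp_nonneg _)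
  have h4 : ‖∑ j ∈ s, r j‖ ≤ δ * ∑ j ∈ s, y j ^ 2 := by
    rw [Finset.mul_sum]
    refine (norm_sum_le _ _).trans (Finset.sum_le_sum fun j hj => (hr1 j hj).trans ?_)
    rw [pow_succ, sq_abs, mul_comm]
    exact mul_le_mul_of_nonneg_right (hy j hj) (sq_nonneg _)
  have h5 : w - -(v : ℂ) / 2 = ((-(∑ j ∈ s, y j ^ 2 - v) / 2 : ℝ) : ℂ) + ∑ j ∈ s, r j := by
    rw [hw]
    push_cast
    ring
  rw [h5]
  have h6 := norm_add_le ((-(∑ j ∈ s, y j ^ 2 - v) / 2 : ℝ) : ℂ) (∑ j ∈ s, r j)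
  rw [Complex.norm_real, Real.norm_eq_abs, abs_div, abs_neg, abs_two] at h6
  linarith

end ExpProduct

/-! ### The central limit theorem for martingale differences along the order of the covariate. -/

section NeighbourMartingale

variable {ι : Type*} [Fintype ι] [DecidableEq ι] (ν : Measure ℝ) [IsProbabilityMeasure ν]
variable {β : Type*} [MeasurableSpace β] (b : Measure β) [IsProbabilityMeasure b]

/-- The term of observation `j`: its own contribution and that of the pair it forms with its left
neighbour. -/
noncomputable def neighbourTerm (d : ℝ × β → ℝ) (c : ℝ × β → ℝ × β → ℝ) (z : ι → ℝ × β) (j : ι) :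
    ℝ :=
  d (z j) + ∑ i, adjInd Finset.univ (fun i => (z i).1) i j * c (z i) (z j)

variable {d : ℝ × β → ℝ} {c : ℝ × β → ℝ × β → ℝ} (hd : Measurable d)
  (hc : Measurable (Function.uncurry c)) {B : ℝ} (hdB : ∀ z, |d z| ≤ B) (hcB : ∀ z z', |c z z'| ≤ B)

include hd hc in
lemma measurable_neighbourTerm (j : ι) :
    Measurable fun z : ι → ℝ × β => neighbourTerm d c z j := by
  unfold neighbourTerm
  fun_prop

include hdB hcB in
lemma abs_neighbourTerm_le_card (z : ι → ℝ × β) (j : ι) :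
    |neighbourTerm d c z j| ≤ B + Fintype.card ι * B := by
  refine (abs_add_le _ _).trans (add_le_add (hdB _) ((Finset.abs_sum_le_sum_abs _ _).trans ?_))
  have : ∀ i ∈ (Finset.univ : Finset ι),
      |adjInd Finset.univ (fun i => (z i).1) i j * c (z i) (z j)| ≤ B := fun i _ => by
    rw [abs_mul, abs_of_nonneg (adjInd_nonneg _ _ _ _)]
    exact (mul_le_of_le_one_left (abs_nonneg _) (adjInd_le_one _ _ _ _)).trans (hcB _ _)
  simpa using Finset.sum_le_card_nsmul _ _ _ this

include hdB hcB in
lemma abs_neighbourTerm_le {z : ι → ℝ × β} (hz : Function.Injective fun i => (z i).1) (j : ι) :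
    |neighbourTerm d c z j| ≤ 2 * B := by
  have hB : 0 ≤ B := (abs_nonneg _).trans (hdB (z j))
  have : |∑ i, adjInd Finset.univ (fun i => (z i).1) i j * c (z i) (z j)| ≤ B := by
    by_cases h : ∃ i, Adj Finset.univ (fun i => (z i).1) i j
    · obtain ⟨i, hi⟩ := h
      rw [sum_adjInd_left_eq hz hi fun i => c (z i) (z j)]
      exact hcB _ _
    · push Not at h
      rw [sum_adjInd_left_eq_zero h fun i => c (z i) (z j), abs_zero]
      exact hB
  have h1 := abs_add_le (d (z j)) (∑ i, adjInd Finset.univ (fun i => (z i).1) i j * c (z i) (z j))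
  have h2 := hdB (z j)
  unfold neighbourTerm
  linarith

include hd hc hdB hcB in
-- The factor of `j` depends on the noise of `j` and of its left neighbour only. Hence the noise at
-- the largest covariate in `s` enters just one factor of the product, linearly and with mean zero,
-- and integrating it out replaces that factor by one.
lemma integral_prod_neighbourTerm (hd0 : ∀ x, ∫ w, d (x, w) ∂b = 0)
    (hc0 : ∀ z x', ∫ w', c z (x', w') ∂b = 0) (t : ℝ) (x : ι → ℝ) (s : Finset ι) :
    ∫ v, ∏ j ∈ s, (1 + (t * neighbourTerm d c (fun i => (x i, v i)) j : ℝ) * Complex.I)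
      ∂(Measure.pi fun _ : ι => b) = 1 := by
  have hm (j : ι) : Measurable fun v : ι → β => neighbourTerm d c (fun i => (x i, v i)) j :=
    (measurable_neighbourTerm hd hc j).comp
      (by fun_prop : Measurable fun (v : ι → β) i => (x i, v i))
  have hmp (s : Finset ι) : Measurable fun v : ι → β =>
      ∏ j ∈ s, (1 + (t * neighbourTerm d c (fun i => (x i, v i)) j : ℝ) * Complex.I) :=
    Finset.measurable_fun_prod _ fun j _ => by
      have := hm j
      fun_prop
  have hbp (s : Finset ι) (v : ι → β) :
      ‖∏ j ∈ s, (1 + (t * neighbourTerm d c (fun i => (x i, v i)) j : ℝ) * Complex.I)‖ ≤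
        (1 + |t| * (B + Fintype.card ι * B)) ^ s.card := by
    rw [norm_prod]
    refine (Finset.prod_le_prod (fun _ _ => norm_nonneg _) fun j _ => ?_).trans
      (Finset.prod_const _).le
    refine (norm_add_le _ _).trans ?_
    rw [norm_one, norm_mul, Complex.norm_I, mul_one, Complex.norm_real, Real.norm_eq_abs, abs_mul]
    have := abs_neighbourTerm_le_card hdB hcB (fun i => (x i, v i)) j
    gcongr
  induction s using Finset.induction_on_max_value x with
  | empty => simp
  | insert a s ha hmax ih =>
    -- A left neighbour has a strictly smaller covariate than `j ∈ s`, so it cannot be `a`, whose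
    -- covariate is at least that of `j`.
    have hupd (v : ι → β) (w : β) (j : ι) (hj : j ∈ s) :
        neighbourTerm d c (fun i => (x i, Function.update v a w i)) j =
          neighbourTerm d c (fun i => (x i, v i)) j := by
      have hja : j ≠ a := fun h => ha (h ▸ hj)
      unfold neighbourTerm
      simp only [Function.update_of_ne hja]
      congr 1
      refine Finset.sum_congr rfl fun i _ => ?_
      by_cases h : Adj Finset.univ x i j
      · have hia : i ≠ a := by
          rintro rfl
          exact absurd (hmax j hj) (not_le.2 h.2.2.1)
        rw [Function.update_of_ne hia]
      · simp only [adjInd_of_not_adj h, zero_mul]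
    have hint (v : ι → β) : ∫ w, neighbourTerm d c (fun i => (x i, Function.update v a w i)) a ∂b
        = 0 := by
      unfold neighbourTerm
      simp only [Function.update_self]
      have h1 (i : ι) : (fun w => adjInd Finset.univ x i a *
          c (x i, Function.update v a w i) (x a, w)) =
          fun w => adjInd Finset.univ x i a * c (x i, v i) (x a, w) := by
        funext w
        by_cases hia : i = a
        · subst hia; simp [adjInd_self]
        · rw [Function.update_of_ne hia]
      have hci (i : ι) : Integrable (fun w => adjInd Finset.univ x i a *
          c (x i, Function.update v a w i) (x a, w)) b := by
        rw [h1]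
        exact (Integrable.of_bound (by fun_prop : Measurable _).aestronglyMeasurable B
          (ae_of_all _ fun w => hcB _ _)).const_mul _
      rw [integral_add, hd0, integral_finsetSum _ fun i _ => hci i]
      · simp only [h1, integral_const_mul, hc0, mul_zero, Finset.sum_const_zero, add_zero]
      · exact Integrable.of_bound (by fun_prop : Measurable _).aestronglyMeasurable B
          (ae_of_all _ fun w => hdB _)
      · exact integrable_finsetSum _ fun i _ => hci i
    rw [← integral_comp_measurePreserving (measurePreserving_resample b a)
      (hmp (insert a s)).aestronglyMeasurable, integral_prod]
    · refine Eq.trans ?_ ih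
      congr 1
      funext v
      simp only [Finset.prod_insert ha]
      have h2 (w : β) : ∏ j ∈ s, (1 + ((t * neighbourTerm d c
          (fun i => (x i, Function.update v a w i)) j : ℝ) : ℂ) * Complex.I) =
          ∏ j ∈ s, (1 + ((t * neighbourTerm d c (fun i => (x i, v i)) j : ℝ) : ℂ) * Complex.I) :=
        Finset.prod_congr rfl fun j hj => by rw [hupd v w j hj]
      change ∫ w, (1 + ((t * neighbourTerm d c (fun i => (x i, Function.update v a w i)) a : ℝ) : ℂ)
        * Complex.I) * ∏ j ∈ s, (1 + ((t * neighbourTerm d c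
          (fun i => (x i, Function.update v a w i)) j : ℝ) : ℂ) * Complex.I) ∂b = _
      rw [integral_congr_ae (ae_of_all _ fun w => congrArg _ (h2 w)), integral_mul_const]
      have hti : Integrable (fun w => t * neighbourTerm d c
          (fun i => (x i, Function.update v a w i)) a) b := by
        refine (Integrable.of_bound (((hm a).comp (measurable_update v)).aestronglyMeasurable)
          (B + Fintype.card ι * B) (ae_of_all _ fun w => ?_)).const_mul _
        exact abs_neighbourTerm_le_card hdB hcB (fun i => (x i, Function.update v a w i)) a
      have hti' : Integrable (fun w => ((t * neighbourTerm d c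
          (fun i => (x i, Function.update v a w i)) a : ℝ) : ℂ) * Complex.I) b :=
        hti.ofReal.mul_const _
      have h3 : ∫ w, (1 + ((t * neighbourTerm d c
          (fun i => (x i, Function.update v a w i)) a : ℝ) : ℂ) * Complex.I) ∂b = 1 := by
        rw [integral_add (integrable_const _) hti', integral_mul_const, integral_complex_ofReal,
          integral_const_mul, hint]
        simp
      rw [h3, one_mul]
    · exact Integrable.of_bound
        ((hmp (insert a s)).comp (measurePreserving_resample b a).measurable).aestronglyMeasurable _
        (ae_of_all _ fun p => hbp _ _)

include hd hc hdB hcB in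
-- Conditioning on the covariates is integration over the noise alone. The factor `A` leaves room
-- for the exponential of an iid sum of functions of the covariates.
lemma integral_mul_prod_neighbourTerm (hd0 : ∀ x, ∫ w, d (x, w) ∂b = 0)
    (hc0 : ∀ z x', ∫ w', c z (x', w') ∂b = 0) (t : ℝ) {A : (ι → ℝ) → ℂ} (hA : Measurable A)
    (hA1 : ∀ x, ‖A x‖ ≤ 1) :
    ∫ z, A (fun i => (z i).1) * ∏ j, (1 + (t * neighbourTerm d c z j : ℝ) * Complex.I)
      ∂(Measure.pi fun _ : ι => ν.prod b) = ∫ x, A x ∂(Measure.pi fun _ : ι => ν) := by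
  have hm : Measurable fun z : ι → ℝ × β => A (fun i => (z i).1) *
      ∏ j, (1 + (t * neighbourTerm d c z j : ℝ) * Complex.I) := by
    have (j : ι) := measurable_neighbourTerm hd hc j
    fun_prop
  have hmp := (measurePreserving_arrowProdEquivProdArrow ℝ β ι (fun _ => ν) (fun _ => b)).symm
  rw [← integral_comp_measurePreserving hmp hm.aestronglyMeasurable, integral_prod]
  · congr 1
    funext x
    have := integral_prod_neighbourTerm b hd hc hdB hcB hd0 hc0 t x Finset.univ
    change ∫ v, A x * ∏ j, (1 + (t * neighbourTerm d c (fun i => (x i, v i)) j : ℝ) * Complex.I)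
      ∂(Measure.pi fun _ : ι => b) = A x
    rw [integral_const_mul, this, mul_one]
  · refine Integrable.of_bound (hm.comp hmp.measurable).aestronglyMeasurable
      ((1 + |t| * (B + Fintype.card ι * B)) ^ (Finset.univ : Finset ι).card) (ae_of_all _ fun p => ?_)
    rw [norm_mul, norm_prod]
    refine (mul_le_of_le_one_left (Finset.prod_nonneg fun _ _ => norm_nonneg _) (hA1 _)).trans ?_
    refine (Finset.prod_le_prod (fun _ _ => norm_nonneg _) fun j _ => ?_).trans
      (Finset.prod_const _).le
    refine (norm_add_le _ _).trans ?_
    rw [norm_one, norm_mul, Complex.norm_I, mul_one, Complex.norm_real, Real.norm_eq_abs, abs_mul]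
    have := abs_neighbourTerm_le_card hdB hcB
      ((MeasurableEquiv.arrowProdEquivProdArrow ℝ β ι).symm p) j
    gcongr

include hd hc hdB hcB in
/-- A central limit theorem for sums over neighbours that form martingale differences when the
observations are revealed by increasing covariate. -/
theorem tendsto_charFun_neighbourTerm [NullSingletonClass ν] (hd0 : ∀ x, ∫ w, d (x, w) ∂b = 0)
    (hc0 : ∀ z x', ∫ w', c z (x', w') ∂b = 0) {τ2 : ℝ} (hτ2 : 0 ≤ τ2)
    (hV : Tendsto (fun n : ℕ => ∫ z, |(n : ℝ)⁻¹ * ∑ j, neighbourTerm d c z j ^ 2 - τ2|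
      ∂(Measure.pi fun _ : Fin n => ν.prod b)) atTop (𝓝 0))
    {A : (n : ℕ) → (Fin n → ℝ) → ℂ} (hA : ∀ n, Measurable (A n)) (hA1 : ∀ n x, ‖A n x‖ ≤ 1) (s : ℝ) :
    Tendsto (fun n : ℕ => (∫ z, A n (fun i => (z i).1) *
      Complex.exp ((s * ((√n)⁻¹ * ∑ j, neighbourTerm d c z j) : ℝ) * Complex.I)
        ∂(Measure.pi fun _ : Fin n => ν.prod b)) -
      Complex.exp (-((s ^ 2 * τ2 : ℝ) : ℂ) / 2) * ∫ x, A n x ∂(Measure.pi fun _ : Fin n => ν))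
      atTop (𝓝 0) := by
  have hB0 : 0 ≤ B := by
    obtain ⟨a⟩ : Nonempty (ℝ × β) := nonempty_of_isProbabilityMeasure (ν.prod b)
    exact (abs_nonneg _).trans (hdB a)
  have hsq : Tendsto (fun n : ℕ => (√(n : ℝ))⁻¹) atTop (𝓝 0) :=
    tendsto_inv_atTop_zero.comp (Real.tendsto_sqrt_atTop.comp tendsto_natCast_atTop_atTop)
  -- Without ties every term is at most `2 B`, so the squares of the scaled terms sum to at most `4
  -- s² B²`, the exponent in `norm_exp_sum_sub_prod_le`.
  set K := Real.exp (4 * s ^ 2 * B ^ 2)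
  have hlim : Tendsto (fun n : ℕ => K * (s ^ 2 * (∫ z, |(n : ℝ)⁻¹ * ∑ j, neighbourTerm d c z j ^ 2
      - τ2| ∂(Measure.pi fun _ : Fin n => ν.prod b)) +
      (16 * |s| * B * s ^ 2 * B ^ 2) * (√(n : ℝ))⁻¹)) atTop (𝓝 0) := by
    have := ((hV.const_mul (s ^ 2)).add (hsq.const_mul (16 * |s| * B * s ^ 2 * B ^ 2))).const_mul K
    simpa using this
  have hsmall : ∀ᶠ n : ℕ in atTop, 2 * |s| * B * (√(n : ℝ))⁻¹ ≤ 1 / 2 := by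
    have := hsq.const_mul (2 * |s| * B)
    rw [mul_zero] at this
    exact (this.eventually (gt_mem_nhds (by norm_num : (0 : ℝ) < 1 / 2))).mono fun _ h => h.le
  refine squeeze_zero_norm' ?_ hlim
  filter_upwards [hsmall, eventually_gt_atTop 0] with n hδ hn
  have hn' : (0 : ℝ) < n := by exact_mod_cast hn
  set Q := Measure.pi fun _ : Fin n => ν.prod b
  set t := s * (√(n : ℝ))⁻¹ with ht
  have hm := measurable_neighbourTerm (ι := Fin n) hd hc
  have hAm : Measurable fun z : Fin n → ℝ × β => A n (fun i => (z i).1) :=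
    (hA n).comp (by fun_prop)
  have hmP : Measurable fun z : Fin n → ℝ × β =>
      ∏ j, (1 + (t * neighbourTerm d c z j : ℝ) * Complex.I) := by fun_prop
  have hts (z : Fin n → ℝ × β) : s * ((√(n : ℝ))⁻¹ * ∑ j, neighbourTerm d c z j) =
      ∑ j, t * neighbourTerm d c z j := by
    rw [← mul_assoc, Finset.mul_sum]
  have iexp : Integrable (fun z => A n (fun i => (z i).1) *
      Complex.exp ((∑ j, t * neighbourTerm d c z j : ℝ) * Complex.I)) Q := by
    refine Integrable.of_bound (by fun_prop : Measurable _).aestronglyMeasurable 1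
      (ae_of_all _ fun z => ?_)
    rw [norm_mul, Complex.norm_exp_ofReal_mul_I, mul_one]
    exact hA1 _ _
  have iprod : Integrable (fun z => A n (fun i => (z i).1) *
      ∏ j, (1 + (t * neighbourTerm d c z j : ℝ) * Complex.I)) Q := by
    refine Integrable.of_bound (hAm.mul hmP).aestronglyMeasurable
      ((1 + |t| * (B + n * B)) ^ n) (ae_of_all _ fun z => ?_)
    rw [norm_mul, norm_prod]
    refine (mul_le_of_le_one_left (Finset.prod_nonneg fun _ _ => norm_nonneg _) (hA1 _ _)).trans ?_
    refine (Finset.prod_le_prod (fun _ _ => norm_nonneg _) fun j _ => ?_).trans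
      ((Finset.prod_const _).trans (by rw [Finset.card_univ, Fintype.card_fin])).le
    refine (norm_add_le _ _).trans ?_
    rw [norm_one, norm_mul, Complex.norm_I, mul_one, Complex.norm_real, Real.norm_eq_abs, abs_mul]
    have := abs_neighbourTerm_le_card hdB hcB z j
    rw [Fintype.card_fin] at this
    gcongr
  have iV : Integrable (fun z => |(n : ℝ)⁻¹ * ∑ j, neighbourTerm d c z j ^ 2 - τ2|) Q := by
    refine Integrable.abs (Integrable.sub (Integrable.const_mul
      (integrable_finsetSum _ fun j _ => ?_) _) (integrable_const _))
    refine Integrable.of_bound ((hm j).pow_const 2).aestronglyMeasurable ((B + n * B) ^ 2)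
      (ae_of_all _ fun z => ?_)
    rw [Real.norm_eq_abs, abs_pow]
    have := abs_neighbourTerm_le_card hdB hcB z j
    rw [Fintype.card_fin] at this
    gcongr
  simp only [hts]
  -- As the product has conditional mean one, it may be inserted into the mean of `A`. The
  -- difference of the two means is then the mean of a pointwise difference.
  have hAT : ∫ x, A n x ∂(Measure.pi fun _ : Fin n => ν) = ∫ z, A n (fun i => (z i).1) *
      ∏ j, (1 + (t * neighbourTerm d c z j : ℝ) * Complex.I) ∂Q :=
    (integral_mul_prod_neighbourTerm ν b hd hc hdB hcB hd0 hc0 t (hA n) (hA1 n)).symm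
  rw [hAT, ← integral_const_mul, ← integral_sub iexp (iprod.const_mul _)]
  have hrhs : K * (s ^ 2 * (∫ z, |(n : ℝ)⁻¹ * ∑ j, neighbourTerm d c z j ^ 2 - τ2| ∂Q) +
      (16 * |s| * B * s ^ 2 * B ^ 2) * (√(n : ℝ))⁻¹) =
      ∫ z, K * (s ^ 2 * |(n : ℝ)⁻¹ * ∑ j, neighbourTerm d c z j ^ 2 - τ2| +
        (16 * |s| * B * s ^ 2 * B ^ 2) * (√(n : ℝ))⁻¹) ∂Q := by
    rw [integral_const_mul, integral_add (iV.const_mul _) (integrable_const _), integral_const_mul]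
    simp
  rw [hrhs]
  refine norm_integral_le_of_norm_le (((iV.const_mul _).add (integrable_const _)).const_mul _) ?_
  filter_upwards [ae_injective_fst (ι := Fin n) ν b] with z hz
  have hy : ∀ j ∈ (Finset.univ : Finset (Fin n)), |t * neighbourTerm d c z j| ≤
      2 * |s| * B * (√(n : ℝ))⁻¹ := fun j _ => by
    rw [abs_mul, ht, abs_mul, abs_of_nonneg (by positivity : (0 : ℝ) ≤ (√(n : ℝ))⁻¹)]
    have := abs_neighbourTerm_le hdB hcB hz j
    calc |s| * (√(n : ℝ))⁻¹ * |neighbourTerm d c z j| ≤ |s| * (√(n : ℝ))⁻¹ * (2 * B) := by gcongr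
      _ = _ := by ring
  have hsum : ∑ j, (t * neighbourTerm d c z j) ^ 2 =
      s ^ 2 * ((n : ℝ)⁻¹ * ∑ j, neighbourTerm d c z j ^ 2) := by
    simp only [mul_pow, ← Finset.mul_sum, ht]
    rw [inv_pow, Real.sq_sqrt hn'.le]
    ring
  have hsumle : ∑ j, (t * neighbourTerm d c z j) ^ 2 ≤ 4 * s ^ 2 * B ^ 2 := by
    rw [hsum]
    have h1 : ∑ j, neighbourTerm d c z j ^ 2 ≤ n * (2 * B) ^ 2 := by
      have : ∀ j ∈ (Finset.univ : Finset (Fin n)), neighbourTerm d c z j ^ 2 ≤ (2 * B) ^ 2 :=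
        fun j _ => sq_le_sq' (by linarith [(abs_le.1 (abs_neighbourTerm_le hdB hcB hz j)).1])
          (abs_le.1 (abs_neighbourTerm_le hdB hcB hz j)).2
      simpa using Finset.sum_le_card_nsmul _ _ _ this
    calc s ^ 2 * ((n : ℝ)⁻¹ * ∑ j, neighbourTerm d c z j ^ 2) ≤
        s ^ 2 * ((n : ℝ)⁻¹ * (n * (2 * B) ^ 2)) := by gcongr
      _ = _ := by field_simp; ring
  have key := norm_exp_sum_sub_prod_le Finset.univ hδ hy (v := s ^ 2 * τ2) (by positivity)
  have e : A n (fun i => (z i).1) * Complex.exp ((∑ j, t * neighbourTerm d c z j : ℝ) * Complex.I) -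
      Complex.exp (-((s ^ 2 * τ2 : ℝ) : ℂ) / 2) * (A n (fun i => (z i).1) *
        ∏ j, (1 + (t * neighbourTerm d c z j : ℝ) * Complex.I)) =
      A n (fun i => (z i).1) * (Complex.exp ((∑ j, t * neighbourTerm d c z j : ℝ) * Complex.I) -
        (∏ j, (1 + (t * neighbourTerm d c z j : ℝ) * Complex.I)) *
          Complex.exp (-((s ^ 2 * τ2 : ℝ) : ℂ) / 2)) := by ring
  rw [e, norm_mul]
  refine (mul_le_of_le_one_left (norm_nonneg _) (hA1 _ _)).trans (key.trans ?_)
  refine mul_le_mul (Real.exp_le_exp.2 hsumle) (add_le_add (le_of_eq ?_) ?_) (by positivity)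
    (Real.exp_nonneg _)
  · rw [hsum, ← mul_sub, abs_mul, abs_of_nonneg (sq_nonneg s)]
  · calc 2 * (2 * |s| * B * (√(n : ℝ))⁻¹) * ∑ j, (t * neighbourTerm d c z j) ^ 2 ≤
        2 * (2 * |s| * B * (√(n : ℝ))⁻¹) * (4 * s ^ 2 * B ^ 2) := by gcongr
      _ = _ := by ring

end NeighbourMartingale

/-! ### The distance of levels and its centring given the covariates. -/

section DegenerateKernel

variable {β : Type*} [MeasurableSpace β] (b : Measure β) [IsProbabilityMeasure b]

/-- The mean distance between `p z` and the level of an independent response given `x`. -/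
noncomputable def meanDist (p : ℝ × β → ℝ) (x : ℝ) (z : ℝ × β) : ℝ := ∫ w, |p (x, w) - p z| ∂b

/-- The mean distance between the levels of independent responses given `x` and `x'`. -/
noncomputable def meanDist₂ (p : ℝ × β → ℝ) (x x' : ℝ) : ℝ := ∫ w, meanDist b p x (x', w) ∂b

/-- The distance of levels, centred given the covariates. -/
noncomputable def degDist (p : ℝ × β → ℝ) (z z' : ℝ × β) : ℝ :=
  |p z - p z'| - meanDist b p z'.1 z - meanDist b p z.1 z' + meanDist₂ b p z.1 z'.1

variable {p : ℝ × β → ℝ} (hp : Measurable p) (hp0 : ∀ z, 0 ≤ p z) (hp1 : ∀ z, p z ≤ 1)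

include hp0 hp1 in
lemma abs_level_sub_le_one (z z' : ℝ × β) : |p z - p z'| ≤ 1 := by
  rw [abs_le]; constructor <;> linarith [hp0 z, hp0 z', hp1 z, hp1 z']

include hp in
lemma measurable_meanDist : Measurable (Function.uncurry (meanDist b p)) := by
  refine (StronglyMeasurable.integral_prod_right
    (f := fun (q : ℝ × (ℝ × β)) w => |p (q.1, w) - p q.2|) ?_).measurable
  exact (by fun_prop : Measurable _).stronglyMeasurable

include hp in
lemma measurable_meanDist₂ : Measurable (Function.uncurry (meanDist₂ b p)) := by
  refine (StronglyMeasurable.integral_prod_right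
    (f := fun (q : ℝ × ℝ) w => meanDist b p q.1 (q.2, w)) ?_).measurable
  have : Measurable fun q : (ℝ × ℝ) × β => meanDist b p q.1.1 (q.1.2, q.2) :=
    (measurable_meanDist b hp).comp
      (by fun_prop : Measurable fun q : (ℝ × ℝ) × β => (q.1.1, (q.1.2, q.2)))
  exact this.stronglyMeasurable

include hp in
lemma measurable_degDist : Measurable (Function.uncurry (degDist b p)) := by
  have h1 : Measurable fun q : (ℝ × β) × (ℝ × β) => meanDist b p q.2.1 q.1 :=
    (measurable_meanDist b hp).comp
      (by fun_prop : Measurable fun q : (ℝ × β) × (ℝ × β) => (q.2.1, q.1))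
  have h2 : Measurable fun q : (ℝ × β) × (ℝ × β) => meanDist b p q.1.1 q.2 :=
    (measurable_meanDist b hp).comp
      (by fun_prop : Measurable fun q : (ℝ × β) × (ℝ × β) => (q.1.1, q.2))
  have h3 : Measurable fun q : (ℝ × β) × (ℝ × β) => meanDist₂ b p q.1.1 q.2.1 :=
    (measurable_meanDist₂ b hp).comp
      (by fun_prop : Measurable fun q : (ℝ × β) × (ℝ × β) => (q.1.1, q.2.1))
  exact (((by fun_prop : Measurable fun q : (ℝ × β) × (ℝ × β) => |p q.1 - p q.2|).sub h1).sub
    h2).add h3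

lemma meanDist_nonneg (x : ℝ) (z : ℝ × β) : 0 ≤ meanDist b p x z :=
  integral_nonneg fun _ => abs_nonneg _

include hp hp0 hp1 in
lemma integrable_abs_level_sub (x : ℝ) (z : ℝ × β) : Integrable (fun w => |p (x, w) - p z|) b :=
  Integrable.of_bound (by fun_prop : Measurable _).aestronglyMeasurable 1
    (ae_of_all _ fun w => by simpa using abs_level_sub_le_one hp0 hp1 (x, w) z)

include hp hp0 hp1 in
lemma integrable_abs_section_sub (x x' : ℝ) : Integrable (fun w => |p (x, w) - p (x', w)|) b :=
  Integrable.of_bound (by fun_prop : Measurable _).aestronglyMeasurable 1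
    (ae_of_all _ fun w => by simpa using abs_level_sub_le_one hp0 hp1 (x, w) (x', w))

include hp hp0 hp1 in
lemma meanDist_le_one (x : ℝ) (z : ℝ × β) : meanDist b p x z ≤ 1 := by
  refine (integral_mono (integrable_abs_level_sub b hp hp0 hp1 x z) (integrable_const (1 : ℝ))
    fun w => abs_level_sub_le_one hp0 hp1 (x, w) z).trans (by simp)

include hp hp0 hp1 in
lemma integrable_meanDist (x x' : ℝ) : Integrable (fun w => meanDist b p x (x', w)) b := by
  have : Measurable fun w => meanDist b p x (x', w) :=
    (measurable_meanDist b hp).comp (by fun_prop : Measurable fun w : β => (x, (x', w)))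
  refine Integrable.of_bound this.aestronglyMeasurable 1 (ae_of_all _ fun w => ?_)
  rw [Real.norm_eq_abs, abs_of_nonneg (meanDist_nonneg b _ _)]
  exact meanDist_le_one b hp hp0 hp1 _ _

lemma meanDist₂_nonneg (x x' : ℝ) : 0 ≤ meanDist₂ b p x x' :=
  integral_nonneg fun _ => meanDist_nonneg b _ _

include hp hp0 hp1 in
lemma meanDist₂_le_one (x x' : ℝ) : meanDist₂ b p x x' ≤ 1 :=
  (integral_mono (integrable_meanDist b hp hp0 hp1 x x') (integrable_const (1 : ℝ))
    fun w => meanDist_le_one b hp hp0 hp1 _ _).trans (by simp)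

include hp hp0 hp1 in
lemma abs_degDist_le (z z' : ℝ × β) : |degDist b p z z'| ≤ 2 := by
  unfold degDist
  have h1 := abs_level_sub_le_one hp0 hp1 z z'
  have h2 := meanDist_le_one b hp hp0 hp1 z'.1 z
  have h3 := meanDist_le_one b hp hp0 hp1 z.1 z'
  have h4 := meanDist₂_le_one b hp hp0 hp1 z.1 z'.1
  have g1 := abs_nonneg (p z - p z')
  have g2 := meanDist_nonneg b (p := p) z'.1 z
  have g3 := meanDist_nonneg b (p := p) z.1 z'
  have g4 := meanDist₂_nonneg b (p := p) z.1 z'.1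
  rw [abs_le]
  constructor <;> linarith

include hp hp0 hp1 in
lemma abs_meanDist_sub_le (x x' : ℝ) (z : ℝ × β) :
    |meanDist b p x z - meanDist b p x' z| ≤ sectionDist b p x x' := by
  unfold meanDist sectionDist
  rw [← integral_sub (integrable_abs_level_sub b hp hp0 hp1 _ _)
    (integrable_abs_level_sub b hp hp0 hp1 _ _)]
  refine abs_integral_le_integral_abs.trans (integral_mono ((integrable_abs_level_sub b hp hp0 hp1
    _ _).sub (integrable_abs_level_sub b hp hp0 hp1 _ _)).abs
    (integrable_abs_section_sub b hp hp0 hp1 _ _) fun w => ?_)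
  have := abs_abs_sub_abs_le (p (x, w) - p z) (p (x', w) - p z)
  simpa using this

include hp hp0 hp1 in
lemma abs_meanDist_sub_le' (x : ℝ) (z z' : ℝ × β) :
    |meanDist b p x z - meanDist b p x z'| ≤ |p z - p z'| := by
  unfold meanDist
  rw [← integral_sub (integrable_abs_level_sub b hp hp0 hp1 _ _)
    (integrable_abs_level_sub b hp hp0 hp1 _ _)]
  have : |p z - p z'| = ∫ _, |p z - p z'| ∂b := by simp
  rw [this]
  refine abs_integral_le_integral_abs.trans (integral_mono ((integrable_abs_level_sub b hp hp0 hp1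
    _ _).sub (integrable_abs_level_sub b hp hp0 hp1 _ _)).abs (integrable_const _) fun w => ?_)
  have := abs_abs_sub_abs_le (p (x, w) - p z) (p (x, w) - p z')
  rw [sub_sub_sub_cancel_left, abs_sub_comm (p z')] at this
  exact this

include hp hp0 hp1 in
lemma abs_meanDist₂_sub_le (x x' x'' : ℝ) :
    |meanDist₂ b p x'' x - meanDist₂ b p x'' x'| ≤ sectionDist b p x x' := by
  unfold meanDist₂ sectionDist
  rw [← integral_sub (integrable_meanDist b hp hp0 hp1 _ _) (integrable_meanDist b hp hp0 hp1 _ _)]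
  exact abs_integral_le_integral_abs.trans (integral_mono ((integrable_meanDist b hp hp0 hp1 _
    _).sub (integrable_meanDist b hp hp0 hp1 _ _)).abs
    (integrable_abs_section_sub b hp hp0 hp1 _ _)
    fun w => abs_meanDist_sub_le' b hp hp0 hp1 _ _ _)

include hp hp0 hp1 in
lemma meanDist₂_comm (x x' : ℝ) : meanDist₂ b p x x' = meanDist₂ b p x' x := by
  unfold meanDist₂ meanDist
  rw [integral_integral_swap]
  · simp only [abs_sub_comm]
  · exact Integrable.of_bound (by fun_prop : Measurable _).aestronglyMeasurable 1
      (ae_of_all _ fun w => by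
        simpa [Function.uncurry] using abs_level_sub_le_one hp0 hp1 (x, w.2) (x', w.1))

include hp hp0 hp1 in
lemma integral_degDist_right (z : ℝ × β) (x' : ℝ) : ∫ w', degDist b p z (x', w') ∂b = 0 := by
  have i1 : Integrable (fun w' => |p z - p (x', w')|) b := by
    simp only [abs_sub_comm (p z)]
    exact integrable_abs_level_sub b hp hp0 hp1 _ _
  have e1 : ∫ w', |p z - p (x', w')| ∂b = meanDist b p x' z := by
    simp only [abs_sub_comm (p z)]
    rfl
  have i2 : Integrable (fun w' => |p z - p (x', w')| - meanDist b p x' z) b :=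
    i1.sub (integrable_const _)
  have i3 : Integrable (fun w' => |p z - p (x', w')| - meanDist b p x' z -
      meanDist b p z.1 (x', w')) b := i2.sub (integrable_meanDist b hp hp0 hp1 _ _)
  simp only [degDist]
  rw [integral_add i3 (integrable_const _), integral_sub i2 (integrable_meanDist b hp hp0 hp1 _ _),
    integral_sub i1 (integrable_const _), e1]
  simp [meanDist₂]

include hp hp0 hp1 in
lemma degDist_comm (z z' : ℝ × β) : degDist b p z z' = degDist b p z' z := by
  unfold degDist
  rw [abs_sub_comm, meanDist₂_comm b hp hp0 hp1]
  ring

include hp hp0 hp1 in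
-- The covariate of the second argument is changed with its noise kept. Two of the four terms of the
-- kernel move by the change of the level, the other two by the distance of the sections. This
-- allows neighbours to be treated as if their covariates were equal.
lemma abs_degDist_sub_le (x x' : ℝ) (w w' : β) :
    |degDist b p (x, w) (x', w') - degDist b p (x, w) (x, w')| ≤
      2 * |p (x', w') - p (x, w')| + 2 * sectionDist b p x x' := by
  unfold degDist
  have h1 := abs_abs_sub_abs_le (p (x, w) - p (x', w')) (p (x, w) - p (x, w'))
  rw [sub_sub_sub_cancel_left, abs_sub_comm (p (x, w'))] at h1
  have h2 := abs_meanDist_sub_le b hp hp0 hp1 x x' (x, w)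
  have h3 := abs_meanDist_sub_le' b hp hp0 hp1 x (x', w') (x, w')
  have h4 := abs_meanDist₂_sub_le b hp hp0 hp1 x x' x
  simp only
  rw [abs_le] at h1 h2 h3 h4 ⊢
  constructor <;> linarith [h1.1, h1.2, h2.1, h2.2, h3.1, h3.2, h4.1, h4.2]

end DegenerateKernel

/-! ### The effect of deleting one index on a sum over neighbours. -/

section Removal

variable {ι : Type*} [Fintype ι] [DecidableEq ι] {x : ι → ℝ}

/-- The contribution of `k` and its neighbours to `adjSum`, minus the contribution of the pair
formed after removing `k`. -/
noncomputable def removalSum (x : ι → ℝ) (k : ι) (w : ι → ι → ℝ) : ℝ :=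
  ∑ i, adjInd Finset.univ x i k * w i k + ∑ j, adjInd Finset.univ x k j * w k j -
    ∑ i, adjInd Finset.univ x i k * ∑ j, adjInd Finset.univ x k j * w i j

lemma adjSum_univ_eq (hx : Function.Injective x) (k : ι) (w : ι → ι → ℝ) :
    adjSum Finset.univ x w = adjSum (Finset.univ.erase k) x w + removalSum x k w := by
  rw [adjSum_erase hx (Finset.mem_univ k) w, removalSum]
  ring

lemma removalSum_sub (k : ι) (w w' : ι → ι → ℝ) :
    removalSum x k (fun i j => w i j - w' i j) = removalSum x k w - removalSum x k w' := by
  simp only [removalSum, mul_sub, Finset.sum_sub_distrib]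
  ring

lemma removalSum_const_mul (k : ι) (a : ℝ) (w : ι → ι → ℝ) :
    removalSum x k (fun i j => a * w i j) = a * removalSum x k w := by
  have h (u v : ℝ) : u * (a * v) = a * (u * v) := by ring
  simp only [removalSum, h, ← Finset.mul_sum]
  ring

/-- With `p` and `r` the left and right neighbours of `k`, at most the three pairs `(p, k)`, `(k,
r)`, `(p, r)` occur. So `e` is counted three times, and each of `a p`, `a r`, `a k` twice. -/
lemma abs_removalSum_le_sum (k : ι) {w : ι → ι → ℝ} {a : ι → ℝ} {e : ℝ}
    (hx : Function.Injective x) (ha : ∀ i, 0 ≤ a i) (he : 0 ≤ e)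
    (hw : ∀ i j, |w i j| ≤ e + a i + a j) :
    |removalSum x k w| ≤ 3 * e + 2 * ∑ i, adjInd Finset.univ x i k * a i +
      2 * ∑ j, adjInd Finset.univ x k j * a j + 2 * a k := by
  have hl := sum_adjInd_left_le (s := Finset.univ) hx k
  have hr := sum_adjInd_right_le (s := Finset.univ) hx k
  have hP : 0 ≤ ∑ i, adjInd Finset.univ x i k * a i :=
    Finset.sum_nonneg fun i _ => mul_nonneg (adjInd_nonneg _ _ _ _) (ha i)
  have hS : 0 ≤ ∑ j, adjInd Finset.univ x k j * a j :=
    Finset.sum_nonneg fun i _ => mul_nonneg (adjInd_nonneg _ _ _ _) (ha i)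
  have h1 : |∑ i, adjInd Finset.univ x i k * w i k| ≤
      e + ∑ i, adjInd Finset.univ x i k * a i + a k := by
    refine (Finset.abs_sum_le_sum_abs _ _).trans ?_
    have : ∑ i, |adjInd Finset.univ x i k * w i k| ≤
        ∑ i, adjInd Finset.univ x i k * (e + a i + a k) := Finset.sum_le_sum fun i _ => by
      rw [abs_mul, abs_of_nonneg (adjInd_nonneg _ _ _ _)]
      exact mul_le_mul_of_nonneg_left (hw _ _) (adjInd_nonneg _ _ _ _)
    simp only [mul_add, Finset.sum_add_distrib, ← Finset.sum_mul] at this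
    nlinarith [ha k]
  have h2' (i : ι) : |∑ j, adjInd Finset.univ x k j * w i j| ≤
      e + a i + ∑ j, adjInd Finset.univ x k j * a j := by
    refine (Finset.abs_sum_le_sum_abs _ _).trans ?_
    have : ∑ j, |adjInd Finset.univ x k j * w i j| ≤
        ∑ j, adjInd Finset.univ x k j * (e + a i + a j) := Finset.sum_le_sum fun j _ => by
      rw [abs_mul, abs_of_nonneg (adjInd_nonneg _ _ _ _)]
      exact mul_le_mul_of_nonneg_left (hw _ _) (adjInd_nonneg _ _ _ _)
    simp only [mul_add, Finset.sum_add_distrib, ← Finset.sum_mul] at this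
    nlinarith [ha i]
  have h2 := h2' k
  have h3 : |∑ i, adjInd Finset.univ x i k * ∑ j, adjInd Finset.univ x k j * w i j| ≤
      e + ∑ i, adjInd Finset.univ x i k * a i + ∑ j, adjInd Finset.univ x k j * a j := by
    refine (Finset.abs_sum_le_sum_abs _ _).trans ?_
    have : ∑ i, |adjInd Finset.univ x i k * ∑ j, adjInd Finset.univ x k j * w i j| ≤
        ∑ i, adjInd Finset.univ x i k * (e + a i + ∑ j, adjInd Finset.univ x k j * a j) :=
      Finset.sum_le_sum fun i _ => by
        rw [abs_mul, abs_of_nonneg (adjInd_nonneg _ _ _ _)]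
        exact mul_le_mul_of_nonneg_left (h2' i) (adjInd_nonneg _ _ _ _)
    simp only [mul_add, Finset.sum_add_distrib, ← Finset.sum_mul] at this
    nlinarith
  unfold removalSum
  rw [abs_le] at h1 h2 h3 ⊢
  constructor <;> linarith [h1.1, h1.2, h2.1, h2.2, h3.1, h3.2]

lemma abs_removalSum_le (k : ι) {w : ι → ι → ℝ} {e : ℝ} (hx : Function.Injective x)
    (hw : ∀ i j, |w i j| ≤ e) : |removalSum x k w| ≤ 3 * e := by
  have := abs_removalSum_le_sum k (a := fun _ => 0) hx (fun _ => le_rfl)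
    ((abs_nonneg _).trans (hw k k)) (fun i j => by simpa using hw i j)
  simpa using this

variable {β : Type*} [MeasurableSpace β] (b : Measure β) [IsProbabilityMeasure b]
  {p : ℝ × β → ℝ} (hp : Measurable p) (hp0 : ∀ z, 0 ≤ p z) (hp1 : ∀ z, p z ≤ 1)

include hp hp0 hp1 in
-- If the three covariates agreed, each pair would contribute `E i + E j - F` with a common `F`, and
-- the combination `(p, k) + (k, r) - (p, r)` would collapse to `2 E k - F`. The section distances
-- measure the disagreement. If `k` lacks a neighbour, the crude bound 9 is used, and the
-- corresponding deficit in the bound equals one.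
lemma abs_removalSum_meanDist_le {z : ι → ℝ × β} (hz : Function.Injective fun i => (z i).1)
    (k : ι) :
    |removalSum (fun i => (z i).1) k (fun i j => meanDist b p (z j).1 (z i) +
        meanDist b p (z i).1 (z j) - meanDist₂ b p (z i).1 (z j).1) -
      (2 * meanDist b p (z k).1 (z k) - meanDist₂ b p (z k).1 (z k).1)| ≤
    4 * ∑ j, adjInd Finset.univ (fun i => (z i).1) k j * sectionDist b p (z k).1 (z j).1 +
    2 * ∑ i, adjInd Finset.univ (fun i => (z i).1) i k * sectionDist b p (z i).1 (z k).1 +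
    9 * (1 - ∑ i, adjInd Finset.univ (fun i => (z i).1) i k) +
    9 * (1 - ∑ j, adjInd Finset.univ (fun i => (z i).1) k j) := by
  set x := fun i => (z i).1 with hxdef
  have hl := sum_adjInd_left_le (s := Finset.univ) hz k
  have hr := sum_adjInd_right_le (s := Finset.univ) hz k
  have hP : 0 ≤ ∑ i, adjInd Finset.univ x i k * sectionDist b p (z i).1 (z k).1 :=
    Finset.sum_nonneg fun i _ => mul_nonneg (adjInd_nonneg _ _ _ _) (sectionDist_nonneg b _ _ _)
  have hS : 0 ≤ ∑ j, adjInd Finset.univ x k j * sectionDist b p (z k).1 (z j).1 :=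
    Finset.sum_nonneg fun i _ => mul_nonneg (adjInd_nonneg _ _ _ _) (sectionDist_nonneg b _ _ _)
  have hE0 := meanDist_nonneg b (p := p)
  have hE1 := meanDist_le_one b hp hp0 hp1
  have hF0 := meanDist₂_nonneg b (p := p)
  have hF1 := meanDist₂_le_one b hp hp0 hp1
  have hcrude : |removalSum x k (fun i j => meanDist b p (z j).1 (z i) +
        meanDist b p (z i).1 (z j) - meanDist₂ b p (z i).1 (z j).1) -
      (2 * meanDist b p (z k).1 (z k) - meanDist₂ b p (z k).1 (z k).1)| ≤ 9 := by
    have h1 := abs_removalSum_le k (e := 2) hz (w := fun i j => meanDist b p (z j).1 (z i) +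
        meanDist b p (z i).1 (z j) - meanDist₂ b p (z i).1 (z j).1) fun i j => by
      rw [abs_le]
      constructor <;> linarith [hE0 (z j).1 (z i), hE0 (z i).1 (z j), hE1 (z j).1 (z i),
        hE1 (z i).1 (z j), hF0 (z i).1 (z j).1, hF1 (z i).1 (z j).1]
    rw [abs_le] at h1 ⊢
    constructor <;> linarith [h1.1, h1.2, hE0 (z k).1 (z k), hE1 (z k).1 (z k),
      hF0 (z k).1 (z k).1, hF1 (z k).1 (z k).1]
  by_cases hpr : ∃ i, Adj Finset.univ x i k
  swap
  · push Not at hpr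
    have := sum_adjInd_left_eq_zero hpr fun _ => 1
    simp only [mul_one] at this
    rw [this]
    linarith
  by_cases hsu : ∃ j, Adj Finset.univ x k j
  swap
  · push Not at hsu
    have := sum_adjInd_right_eq_zero hsu fun _ => 1
    simp only [mul_one] at this
    rw [this]
    linarith
  obtain ⟨i, hi⟩ := hpr
  obtain ⟨j, hj⟩ := hsu
  have e1 := sum_adjInd_left_eq hz hi fun _ => 1
  have e2 := sum_adjInd_right_eq hz hj fun _ => 1
  simp only [mul_one] at e1 e2
  rw [e1, e2, sum_adjInd_left_eq hz hi fun i => sectionDist b p (z i).1 (z k).1,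
    sum_adjInd_right_eq hz hj fun j => sectionDist b p (z k).1 (z j).1]
  unfold removalSum
  rw [sum_adjInd_left_eq hz hi fun i => meanDist b p (z k).1 (z i) +
        meanDist b p (z i).1 (z k) - meanDist₂ b p (z i).1 (z k).1,
    sum_adjInd_right_eq hz hj fun j => meanDist b p (z j).1 (z k) +
        meanDist b p (z k).1 (z j) - meanDist₂ b p (z k).1 (z j).1,
    sum_adjInd_left_eq hz hi fun i => ∑ j, adjInd Finset.univ x k j *
      (meanDist b p (z j).1 (z i) + meanDist b p (z i).1 (z j) - meanDist₂ b p (z i).1 (z j).1),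
    sum_adjInd_right_eq hz hj fun j => meanDist b p (z j).1 (z i) +
        meanDist b p (z i).1 (z j) - meanDist₂ b p (z i).1 (z j).1]
  have f1 := abs_meanDist_sub_le b hp hp0 hp1 (z k).1 (z j).1 (z i)
  have f2 := abs_meanDist_sub_le b hp hp0 hp1 (z i).1 (z k).1 (z k)
  have f3 := abs_meanDist_sub_le b hp hp0 hp1 (z k).1 (z j).1 (z k)
  have f4 := abs_meanDist_sub_le b hp hp0 hp1 (z i).1 (z k).1 (z j)
  have f5 := abs_meanDist₂_sub_le b hp hp0 hp1 (z k).1 (z j).1 (z i).1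
  have f6 := abs_meanDist₂_sub_le b hp hp0 hp1 (z k).1 (z j).1 (z k).1
  rw [abs_le] at f1 f2 f3 f4 f5 f6 ⊢
  constructor <;> linarith [f1.1, f1.2, f2.1, f2.2, f3.1, f3.2, f4.1, f4.2, f5.1, f5.2, f6.1, f6.2]

end Removal

/-! ### Ranks as sums of indicators. -/

section Ranks

/-- The indicator of `y ≤ a`. -/
noncomputable def below (a y : ℝ) : ℝ := if y ≤ a then 1 else 0

lemma below_nonneg (a y : ℝ) : 0 ≤ below a y := by unfold below; split_ifs <;> norm_num

lemma below_le_one (a y : ℝ) : below a y ≤ 1 := by unfold below; split_ifs <;> norm_num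

lemma below_mono {a a' : ℝ} (h : a ≤ a') (y : ℝ) : below a y ≤ below a' y := by
  unfold below
  split_ifs with h1 h2 <;> norm_num
  exact h2 (h1.trans h)

lemma abs_below_sub_le_one (a a' y : ℝ) : |below a y - below a' y| ≤ 1 := by
  unfold below; split_ifs <;> norm_num

@[fun_prop]
lemma measurable_below {α : Type*} [MeasurableSpace α] {f g : α → ℝ} (hf : Measurable f)
    (hg : Measurable g) : Measurable fun x => below (f x) (g x) :=
  Measurable.ite (measurableSet_le hg hf) measurable_const measurable_const

variable {ι : Type*} [Fintype ι] [DecidableEq ι]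

/-- The number of responses with index in `s` that are at most `a`. -/
noncomputable def rankOf (s : Finset ι) (y : ι → ℝ) (a : ℝ) : ℝ := ∑ l ∈ s, below a (y l)

lemma rankOf_mono (s : Finset ι) (y : ι → ℝ) {a a' : ℝ} (h : a ≤ a') :
    rankOf s y a ≤ rankOf s y a' :=
  Finset.sum_le_sum fun _ _ => below_mono h _

lemma rankOf_nonneg (s : Finset ι) (y : ι → ℝ) (a : ℝ) : 0 ≤ rankOf s y a :=
  Finset.sum_nonneg fun _ _ => below_nonneg _ _

lemma rankOf_le_card (s : Finset ι) (y : ι → ℝ) (a : ℝ) : rankOf s y a ≤ Fintype.card ι := by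
  refine (Finset.sum_le_card_nsmul _ _ _ fun _ _ => below_le_one _ _).trans ?_
  rw [nsmul_eq_mul, mul_one]
  exact_mod_cast Finset.card_le_univ s

lemma rankOf_univ_eq (y : ι → ℝ) (k : ι) (a : ℝ) :
    rankOf Finset.univ y a = rankOf (Finset.univ.erase k) y a + below a (y k) :=
  (Finset.sum_erase_add _ _ (Finset.mem_univ k)).symm

/-- The count of the other responses and the indicator for `k` are both monotone in the threshold,
so their increments have the same sign and the absolute values add exactly. Thus an observation acts
on rank differences of other pairs only by separating them. -/
lemma abs_rankOf_sub_eq (y : ι → ℝ) (k : ι) (a a' : ℝ) :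
    |rankOf Finset.univ y a - rankOf Finset.univ y a'| =
      |rankOf (Finset.univ.erase k) y a - rankOf (Finset.univ.erase k) y a'| +
        |below a (y k) - below a' (y k)| := by
  rw [rankOf_univ_eq y k, rankOf_univ_eq y k a']
  rcases le_total a a' with h | h
  · have h1 := rankOf_mono (Finset.univ.erase k) y h
    have h2 := below_mono h (y k)
    rw [abs_of_nonpos (by linarith), abs_of_nonpos (by linarith), abs_of_nonpos (by linarith)]
    ring
  · have h1 := rankOf_mono (Finset.univ.erase k) y h
    have h2 := below_mono h (y k)
    rw [abs_of_nonneg (by linarith), abs_of_nonneg (by linarith), abs_of_nonneg (by linarith)]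
    ring

lemma abs_rankOf_sub_le_card (s : Finset ι) (y : ι → ℝ) (a a' : ℝ) :
    |rankOf s y a - rankOf s y a'| ≤ Fintype.card ι := by
  rw [abs_le]
  constructor <;> linarith [rankOf_nonneg s y a, rankOf_nonneg s y a', rankOf_le_card s y a,
    rankOf_le_card s y a']

end Ranks

/-! ### Approximation of the rank statistic and the change caused by deleting an observation. -/

section Remainder

variable (ν : Measure ℝ) [IsProbabilityMeasure ν]
variable {β : Type*} [MeasurableSpace β] (b : Measure β) [IsProbabilityMeasure b]
lemma measurable_meanDist_self {p : ℝ × β → ℝ} (hp : Measurable p) :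
    Measurable fun z : ℝ × β => meanDist b p z.1 z :=
  (measurable_meanDist b hp).comp (by fun_prop : Measurable fun z : ℝ × β => (z.1, z))

lemma measurable_meanDist₂_self {p : ℝ × β → ℝ} (hp : Measurable p) :
    Measurable fun z : ℝ × β => meanDist₂ b p z.1 z.1 :=
  (measurable_meanDist₂ b hp).comp (by fun_prop : Measurable fun z : ℝ × β => (z.1, z.1))

variable (q : ℝ × β → ℝ)

/-- The distribution function of the response. -/
noncomputable def respCdf (a : ℝ) : ℝ := (ν.prod b).real {z | q z ≤ a}

/-- The distribution function of the response, evaluated at the response. -/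
noncomputable def level (z : ℝ × β) : ℝ := respCdf ν b q (q z)

/-- The probability, given `x`, that `y` separates two independent responses. -/
noncomputable def sepMean (y x : ℝ) : ℝ :=
  ∫ w, ∫ w', |below (q (x, w)) y - below (q (x, w')) y| ∂b ∂b

/-- The probability that `y` separates two responses with the same covariate. -/
noncomputable def pairSep (y : ℝ) : ℝ := ∫ x, sepMean b q y x ∂ν

/-- The linear part of the statistic. -/
noncomputable def linPart (z : ℝ × β) : ℝ :=
  pairSep ν b q (q z) + 2 * meanDist b (level ν b q) z.1 z - meanDist₂ b (level ν b q) z.1 z.1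

/-- The normalized sum of rank differences, minus its approximation by the linear and the
degenerate part. -/
noncomputable def remainder {n : ℕ} (s : Finset (Fin n)) (z : Fin n → ℝ × β) : ℝ :=
  √n / ((n : ℝ) ^ 2 - 1) * adjSum s (fun i => (z i).1) (fun i j =>
    |rankOf s (fun l => q (z l)) (q (z i)) - rankOf s (fun l => q (z l)) (q (z j))|) -
  (√n)⁻¹ * (adjSum s (fun i => (z i).1) (fun i j => degDist b (level ν b q) (z i) (z j)) +
    ∑ i ∈ s, linPart ν b q (z i))

lemma respCdf_nonneg (a : ℝ) : 0 ≤ respCdf ν b q a := measureReal_nonneg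

lemma respCdf_le_one (a : ℝ) : respCdf ν b q a ≤ 1 := measureReal_le_one

lemma monotone_respCdf : Monotone (respCdf ν b q) := fun _ _ h =>
  measureReal_mono fun _ hz => le_trans hz h

variable {q} (hq : Measurable q)

include hq in
lemma measurable_level : Measurable (level ν b q) := (monotone_respCdf ν b q).measurable.comp hq

include hq in
lemma integral_below_eq (a : ℝ) : ∫ z, below a (q z) ∂(ν.prod b) = respCdf ν b q a := by
  have : (fun z => below a (q z)) = {z | q z ≤ a}.indicator 1 := by
    funext z
    simp [below, Set.indicator]
  rw [this, integral_indicator_one (measurableSet_le hq measurable_const)]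
  rfl

include hq in
lemma measurable_sepMean : Measurable (Function.uncurry (sepMean b q)) := by
  refine (StronglyMeasurable.integral_prod_right (f := fun (u : ℝ × ℝ) w =>
    ∫ w', |below (q (u.2, w)) u.1 - below (q (u.2, w')) u.1| ∂b) ?_).measurable
  refine Measurable.stronglyMeasurable ?_
  exact (StronglyMeasurable.integral_prod_right (f := fun (u : (ℝ × ℝ) × β) w' =>
    |below (q (u.1.2, u.2)) u.1.1 - below (q (u.1.2, w')) u.1.1|)
      (by fun_prop : Measurable _).stronglyMeasurable).measurable

include hq in
lemma integrable_abs_below_sub (y x x' : ℝ) (w : β) :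
    Integrable (fun w' => |below (q (x, w)) y - below (q (x', w')) y|) b :=
  Integrable.of_bound (by fun_prop : Measurable _).aestronglyMeasurable 1
    (ae_of_all _ fun w' => by simpa using abs_below_sub_le_one _ _ _)

include hq in
lemma integrable_integral_abs_below_sub (y x x' : ℝ) :
    Integrable (fun w => ∫ w', |below (q (x, w)) y - below (q (x', w')) y| ∂b) b := by
  refine Integrable.of_bound (Measurable.aestronglyMeasurable ?_) 1 (ae_of_all _ fun w => ?_)
  · exact (StronglyMeasurable.integral_prod_right (f := fun (w : β) w' =>
      |below (q (x, w)) y - below (q (x', w')) y|)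
        (by fun_prop : Measurable _).stronglyMeasurable).measurable
  · have := norm_integral_le_of_norm_le_const (μ := b)
      (f := fun w' => |below (q (x, w)) y - below (q (x', w')) y|) (C := 1)
      (ae_of_all _ fun w' => by simpa using abs_below_sub_le_one _ _ _)
    simpa using this

lemma sepMean_nonneg (y x : ℝ) : 0 ≤ sepMean b q y x :=
  integral_nonneg fun _ => integral_nonneg fun _ => abs_nonneg _

include hq in
lemma sepMean_le_one (y x : ℝ) : sepMean b q y x ≤ 1 := by
  refine (integral_mono (integrable_integral_abs_below_sub b hq y x x) (integrable_const (1 : ℝ))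
    fun w => ?_).trans (by simp)
  exact (integral_mono (integrable_abs_below_sub b hq y x x w) (integrable_const (1 : ℝ))
    fun w' => abs_below_sub_le_one _ _ _).trans (by simp)

include hq in
lemma measurable_pairSep : Measurable (pairSep ν b q) :=
  (StronglyMeasurable.integral_prod_right (f := fun y x => sepMean b q y x)
    (measurable_sepMean b hq).stronglyMeasurable).measurable

lemma pairSep_nonneg (y : ℝ) : 0 ≤ pairSep ν b q y := integral_nonneg fun _ => sepMean_nonneg b _ _

include hq in
lemma pairSep_le_one (y : ℝ) : pairSep ν b q y ≤ 1 := by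
  refine (integral_mono ?_ (integrable_const (1 : ℝ)) fun x => sepMean_le_one b hq y x).trans
    (by simp)
  refine Integrable.of_bound ((measurable_sepMean b hq).comp
    (by fun_prop : Measurable fun x : ℝ => (y, x))).aestronglyMeasurable 1 (ae_of_all _ fun x => ?_)
  simpa [abs_of_nonneg (sepMean_nonneg b y x)] using sepMean_le_one b hq y x

include hq in
lemma measurable_linPart : Measurable (linPart ν b q) := by
  have h1 : Measurable fun z : ℝ × β => pairSep ν b q (q z) := (measurable_pairSep ν b hq).comp hq
  exact (h1.add ((measurable_meanDist_self b (measurable_level ν b hq)).const_mul 2)).sub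
    (measurable_meanDist₂_self b (measurable_level ν b hq))

include hq in
lemma abs_linPart_le (z : ℝ × β) : |linPart ν b q z| ≤ 3 := by
  have hl := measurable_level ν b hq
  have l0 (z : ℝ × β) : 0 ≤ level ν b q z := respCdf_nonneg ν b q _
  have l1 (z : ℝ × β) : level ν b q z ≤ 1 := respCdf_le_one ν b q _
  have h1 := pairSep_nonneg ν b (q := q) (q z)
  have h2 := pairSep_le_one ν b hq (q z)
  have h3 := meanDist_nonneg b (p := level ν b q) z.1 z
  have h4 := meanDist_le_one b hl l0 l1 z.1 z
  have h5 := meanDist₂_nonneg b (p := level ν b q) z.1 z.1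
  have h6 := meanDist₂_le_one b hl l0 l1 z.1 z.1
  unfold linPart
  rw [abs_le]
  constructor <;> linarith

include hq in
lemma measurable_remainder {n : ℕ} (s : Finset (Fin n)) : Measurable (remainder ν b q s) := by
  have hdd := measurable_degDist b (measurable_level ν b hq)
  have hlin := measurable_linPart ν b hq
  have hr (i : Fin n) : Measurable fun z : Fin n → ℝ × β =>
      rankOf s (fun l => q (z l)) (q (z i)) := by
    unfold rankOf
    fun_prop
  unfold remainder adjSum
  fun_prop

include hq in
lemma abs_remainder_le {n : ℕ} (s : Finset (Fin n)) (z : Fin n → ℝ × β) :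
    |remainder ν b q s z| ≤ |√n / ((n : ℝ) ^ 2 - 1)| * (n * (n * n)) +
      (√n)⁻¹ * (n * (n * 2) + n * 3) := by
  have hl := measurable_level ν b hq
  have l0 (z : ℝ × β) : 0 ≤ level ν b q z := respCdf_nonneg ν b q _
  have l1 (z : ℝ × β) : level ν b q z ≤ 1 := respCdf_le_one ν b q _
  unfold remainder
  refine (abs_sub _ _).trans (add_le_add ?_ ?_)
  · rw [abs_mul]
    refine mul_le_mul_of_nonneg_left ?_ (abs_nonneg _)
    have := abs_adjSum_le_sq (s := s) (x := fun i => (z i).1) (w := fun i j =>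
      |rankOf s (fun l => q (z l)) (q (z i)) - rankOf s (fun l => q (z l)) (q (z j))|) (C := n)
      fun i j => by
        rw [abs_abs]
        simpa using abs_rankOf_sub_le_card s (fun l => q (z l)) (q (z i)) (q (z j))
    simpa using this
  · rw [abs_mul, abs_of_nonneg (by positivity : (0 : ℝ) ≤ (√n)⁻¹)]
    refine mul_le_mul_of_nonneg_left ((abs_add_le _ _).trans (add_le_add ?_ ?_)) (by positivity)
    · have := abs_adjSum_le_sq (s := s) (x := fun i => (z i).1) (w := fun i j =>
        degDist b (level ν b q) (z i) (z j)) (C := 2) fun i j => abs_degDist_le b hl l0 l1 _ _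
      simpa using this
    · refine (Finset.abs_sum_le_sum_abs _ _).trans ((Finset.sum_le_card_nsmul _ _ _
        fun i _ => abs_linPart_le ν b hq _).trans ?_)
      rw [nsmul_eq_mul]
      have : (s.card : ℝ) ≤ n := by
        have := Finset.card_le_univ s
        rw [Fintype.card_fin] at this
        exact_mod_cast this
      linarith

lemma remainder_update_erase {n : ℕ} (k : Fin n) (z : Fin n → ℝ × β) (a : ℝ × β) :
    remainder ν b q (Finset.univ.erase k) (Function.update z k a) =
      remainder ν b q (Finset.univ.erase k) z := by
  have hrank (c : ℝ) : rankOf (Finset.univ.erase k) (fun l => q (Function.update z k a l)) c =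
      rankOf (Finset.univ.erase k) (fun l => q (z l)) c := by
    unfold rankOf
    refine Finset.sum_congr rfl fun l hl => ?_
    simp only [Function.update_of_ne (Finset.ne_of_mem_erase hl)]
  unfold remainder
  congr 2
  · refine adjSum_update_erase (fun i hi => ?_) fun i j hi hj => ?_
    · rw [Function.update_of_ne hi]
    · rw [Function.update_of_ne hi, Function.update_of_ne hj, hrank, hrank]
  · congr 1
    · refine adjSum_update_erase (fun i hi => ?_) fun i j hi hj => ?_
      · rw [Function.update_of_ne hi]
      · rw [Function.update_of_ne hi, Function.update_of_ne hj]
    · refine Finset.sum_congr rfl fun l hl => ?_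
      simp only [Function.update_of_ne (Finset.ne_of_mem_erase hl)]

/-- The error of the empirical distribution function of the responses at `a`. -/
noncomputable def cdfError {n : ℕ} (z : Fin n → ℝ × β) (a : ℝ) : ℝ :=
  (n : ℝ)⁻¹ * rankOf Finset.univ (fun l => q (z l)) a - respCdf ν b q a

/-- The error of the empirical probability that `y` separates the responses of neighbours. -/
noncomputable def sepError {n : ℕ} (s : Finset (Fin n)) (z : Fin n → ℝ × β) (y : ℝ) : ℝ :=
  (n : ℝ)⁻¹ * adjSum s (fun i => (z i).1)
    (fun i j => |below (q (z i)) y - below (q (z j)) y|) - pairSep ν b q y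

/-- A bound for the change of the remainder when observation `k` is removed. -/
noncomputable def removalBound {n : ℕ} (z : Fin n → ℝ × β) (k : Fin n) : ℝ :=
  |sepError ν b (q := q) Finset.univ z (q (z k))| + 7 * (n : ℝ)⁻¹ +
  2 * ∑ i, adjInd Finset.univ (fun i => (z i).1) i k * |cdfError ν b (q := q) z (q (z i))| +
  2 * ∑ j, adjInd Finset.univ (fun i => (z i).1) k j * |cdfError ν b (q := q) z (q (z j))| +
  2 * |cdfError ν b (q := q) z (q (z k))| +
  (4 * ∑ j, adjInd Finset.univ (fun i => (z i).1) k j *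
      sectionDist b (level ν b q) (z k).1 (z j).1 +
    2 * ∑ i, adjInd Finset.univ (fun i => (z i).1) i k *
      sectionDist b (level ν b q) (z i).1 (z k).1 +
    9 * (1 - ∑ i, adjInd Finset.univ (fun i => (z i).1) i k) +
    9 * (1 - ∑ j, adjInd Finset.univ (fun i => (z i).1) k j))

include hq in
-- An observation acts in two ways: it raises the rank difference of the pairs it separates, and it
-- forms pairs with its neighbours. `linPart` contains the limit of both effects, `pairSep` for the
-- first and `2 * meanDist - meanDist₂` for the second, so only errors of empirical quantities and
-- differences between neighbouring sections are left. The normalization stays that of `n`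
-- observations when `k` is erased.
lemma abs_remainder_sub_le {n : ℕ} (hn : 2 ≤ n) {z : Fin n → ℝ × β}
    (hz : Function.Injective fun i => (z i).1) (k : Fin n) :
    |√n * (remainder ν b q Finset.univ z - remainder ν b q (Finset.univ.erase k) z)| ≤
      removalBound ν b (q := q) z k := by
  have hl := measurable_level ν b hq
  have l0 (z : ℝ × β) : 0 ≤ level ν b q z := respCdf_nonneg ν b q _
  have l1 (z : ℝ × β) : level ν b q z ≤ 1 := respCdf_le_one ν b q _
  have hn2 : (2 : ℝ) ≤ n := by exact_mod_cast hn
  have hn0 : (0 : ℝ) < n := by linarith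
  set x : Fin n → ℝ := fun i => (z i).1 with hx
  set y : Fin n → ℝ := fun i => q (z i) with hy
  set N : Fin n → Fin n → ℝ := fun i j =>
    |rankOf (Finset.univ.erase k) y (y i) - rankOf (Finset.univ.erase k) y (y j)| with hN
  set κ : Fin n → Fin n → ℝ := fun i j => |below (y i) (y k) - below (y j) (y k)| with hκ
  set c : Fin n → Fin n → ℝ := fun i j => degDist b (level ν b q) (z i) (z j) with hc
  set ψ : Fin n → Fin n → ℝ := fun i j => |level ν b q (z i) - level ν b q (z j)| with hψ
  set bn : ℝ := n / ((n : ℝ) ^ 2 - 1) with hbn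
  -- Each rank difference splits into the one among the other observations and the indicator that `y
  -- k` separates the pair; the former changes only through the pairs at `k`.
  have hW : adjSum Finset.univ x (fun i j => |rankOf Finset.univ y (y i) -
      rankOf Finset.univ y (y j)|) =
      adjSum (Finset.univ.erase k) x N + removalSum x k N + adjSum Finset.univ x κ := by
    rw [← adjSum_univ_eq hz k N, ← adjSum_add]
    congr 1
    funext i j
    exact abs_rankOf_sub_eq y k _ _
  have hC := adjSum_univ_eq hz k c
  have hg : ∑ i, linPart ν b q (z i) =
      ∑ i ∈ Finset.univ.erase k, linPart ν b q (z i) + linPart ν b q (z k) :=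
    (Finset.sum_erase_add _ _ (Finset.mem_univ k)).symm
  have hs1 : √(n : ℝ) * (√n / ((n : ℝ) ^ 2 - 1)) = bn := by
    rw [hbn, ← mul_div_assoc, Real.mul_self_sqrt hn0.le]
  have hs2 : √(n : ℝ) * (√n)⁻¹ = 1 := mul_inv_cancel₀ (Real.sqrt_pos.2 hn0).ne'
  -- The three groups compare the share of separated pairs with `pairSep`, normalized ranks with
  -- levels in the pairs at `k`, and the part removed by centring with its value at equal
  -- covariates.
  have hΔ : √n * (remainder ν b q Finset.univ z - remainder ν b q (Finset.univ.erase k) z) =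
      (bn * adjSum Finset.univ x κ - pairSep ν b q (y k)) +
      removalSum x k (fun i j => bn * N i j - ψ i j) +
      (removalSum x k (fun i j => ψ i j - c i j) - (2 * meanDist b (level ν b q) (z k).1 (z k) -
        meanDist₂ b (level ν b q) (z k).1 (z k).1)) := by
    have e1 : remainder ν b q Finset.univ z - remainder ν b q (Finset.univ.erase k) z =
        √n / ((n : ℝ) ^ 2 - 1) * (removalSum x k N + adjSum Finset.univ x κ) -
        (√n)⁻¹ * (removalSum x k c + linPart ν b q (z k)) := by
      change (√n / ((n : ℝ) ^ 2 - 1) * adjSum Finset.univ x (fun i j =>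
        |rankOf Finset.univ y (y i) - rankOf Finset.univ y (y j)|) -
          (√n)⁻¹ * (adjSum Finset.univ x c + ∑ i, linPart ν b q (z i))) -
        (√n / ((n : ℝ) ^ 2 - 1) * adjSum (Finset.univ.erase k) x N -
          (√n)⁻¹ * (adjSum (Finset.univ.erase k) x c +
            ∑ i ∈ Finset.univ.erase k, linPart ν b q (z i))) = _
      rw [hW, hC, hg]
      ring
    rw [e1, mul_sub, ← mul_assoc, ← mul_assoc, hs1, hs2, one_mul, removalSum_sub, removalSum_sub,
      removalSum_const_mul]
    unfold linPart
    ring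
  -- The weight `n / (n² - 1)` differs from `1 / n` by `1 / (n (n² - 1))`, and the rank differences
  -- and pair counts it multiplies are at most `n`.
  have hbn1 : |bn - (n : ℝ)⁻¹| * n ≤ (n : ℝ)⁻¹ := by
    have h1 : (0 : ℝ) < (n : ℝ) ^ 2 - 1 := by nlinarith
    have h2 : bn - (n : ℝ)⁻¹ = (n : ℝ)⁻¹ * ((n : ℝ) ^ 2 - 1)⁻¹ := by
      rw [hbn]
      field_simp
      ring
    rw [h2, abs_of_nonneg (by positivity), mul_right_comm, inv_mul_cancel₀ hn0.ne', one_mul]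
    exact inv_anti₀ hn0 (by nlinarith)
  have hκ1 (i j : Fin n) : |κ i j| ≤ 1 := by
    rw [hκ, abs_abs]
    exact abs_below_sub_le_one _ _ _
  have t1 : |bn * adjSum Finset.univ x κ - pairSep ν b q (y k)| ≤
      |sepError ν b (q := q) Finset.univ z (q (z k))| + (n : ℝ)⁻¹ := by
    have e : bn * adjSum Finset.univ x κ - pairSep ν b q (y k) =
        sepError ν b (q := q) Finset.univ z (q (z k)) + (bn - (n : ℝ)⁻¹) *
          adjSum Finset.univ x κ := by
      change _ = ((n : ℝ)⁻¹ * adjSum Finset.univ x κ - pairSep ν b q (y k)) + _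
      ring
    rw [e]
    refine (abs_add_le _ _).trans (add_le_add_right ?_ _)
    rw [abs_mul]
    refine le_trans ?_ hbn1
    have := abs_adjSum_le_card (s := Finset.univ) hz zero_le_one hκ1
    rw [Fintype.card_fin, mul_one] at this
    exact mul_le_mul_of_nonneg_left this (abs_nonneg _)
  have t2 : |removalSum x k (fun i j => bn * N i j - ψ i j)| ≤ 3 * (2 * (n : ℝ)⁻¹) +
      2 * ∑ i, adjInd Finset.univ x i k * |cdfError ν b (q := q) z (q (z i))| +
      2 * ∑ j, adjInd Finset.univ x k j * |cdfError ν b (q := q) z (q (z j))| +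
      2 * |cdfError ν b (q := q) z (q (z k))| := by
    refine abs_removalSum_le_sum k (a := fun i => |cdfError ν b (q := q) z (q (z i))|) hz
      (fun i => abs_nonneg _) (by positivity) fun i j => ?_
    have g1 : |(bn - (n : ℝ)⁻¹) * N i j| ≤ (n : ℝ)⁻¹ := by
      rw [abs_mul]
      refine le_trans (mul_le_mul_of_nonneg_left ?_ (abs_nonneg _)) hbn1
      rw [hN, abs_abs]
      simpa using abs_rankOf_sub_le_card (Finset.univ.erase k) y (y i) (y j)
    have g2 : N i j = |rankOf Finset.univ y (y i) - rankOf Finset.univ y (y j)| - κ i j := by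
      rw [abs_rankOf_sub_eq y k]
      simp [hN, hκ]
    have g3 : |(n : ℝ)⁻¹ * |rankOf Finset.univ y (y i) - rankOf Finset.univ y (y j)| - ψ i j| ≤
        |cdfError ν b (q := q) z (q (z i))| + |cdfError ν b (q := q) z (q (z j))| := by
      have e : (n : ℝ)⁻¹ * |rankOf Finset.univ y (y i) - rankOf Finset.univ y (y j)| =
          |(n : ℝ)⁻¹ * rankOf Finset.univ y (y i) - (n : ℝ)⁻¹ * rankOf Finset.univ y (y j)| := by
        rw [← mul_sub, abs_mul, abs_of_pos (inv_pos.2 hn0)]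
      rw [e]
      refine (abs_abs_sub_abs_le _ _).trans ?_
      have : (n : ℝ)⁻¹ * rankOf Finset.univ y (y i) - (n : ℝ)⁻¹ * rankOf Finset.univ y (y j) -
          (level ν b q (z i) - level ν b q (z j)) =
          cdfError ν b (q := q) z (q (z i)) - cdfError ν b (q := q) z (q (z j)) := by
        simp only [cdfError, level, hy]
        ring
      rw [this]
      exact abs_sub _ _
    have g4 : |(n : ℝ)⁻¹ * κ i j| ≤ (n : ℝ)⁻¹ := by
      rw [abs_mul, abs_of_pos (inv_pos.2 hn0)]
      exact mul_le_of_le_one_right (by positivity) (hκ1 i j)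
    have e : bn * N i j - ψ i j = (bn - (n : ℝ)⁻¹) * N i j +
        ((n : ℝ)⁻¹ * |rankOf Finset.univ y (y i) - rankOf Finset.univ y (y j)| - ψ i j) -
          (n : ℝ)⁻¹ * κ i j := by
      rw [g2]
      ring
    rw [e]
    rw [abs_le] at g1 g3 g4 ⊢
    constructor <;> linarith [g1.1, g1.2, g3.1, g3.2, g4.1, g4.2]
  have t3 := abs_removalSum_meanDist_le b hl l0 l1 hz k
  have e3 : (fun i j => ψ i j - c i j) = fun i j => meanDist b (level ν b q) (z j).1 (z i) +
        meanDist b (level ν b q) (z i).1 (z j) - meanDist₂ b (level ν b q) (z i).1 (z j).1 := by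
    funext i j
    simp only [hψ, hc, degDist]
    ring
  rw [hΔ, e3]
  unfold removalBound
  refine (abs_add_le _ _).trans (add_le_add ((abs_add_le _ _).trans ?_) t3)
  linarith

include hq in
lemma abs_cdfError_le_one {n : ℕ} (z : Fin n → ℝ × β) (a : ℝ) :
    |cdfError ν b (q := q) z a| ≤ 1 := by
  have h1 : (n : ℝ)⁻¹ * rankOf Finset.univ (fun l => q (z l)) a ≤ 1 := by
    have := rankOf_le_card Finset.univ (fun l => q (z l)) a
    rw [Fintype.card_fin] at this
    rw [inv_mul_eq_div]
    exact div_le_one_of_le₀ this (by positivity)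
  have h2 : 0 ≤ (n : ℝ)⁻¹ * rankOf Finset.univ (fun l => q (z l)) a :=
    mul_nonneg (by positivity) (rankOf_nonneg _ _ _)
  unfold cdfError
  rw [abs_le]
  constructor <;> linarith [respCdf_nonneg ν b q a, respCdf_le_one ν b q a]

include hq in
lemma abs_sepError_le_one {n : ℕ} {z : Fin n → ℝ × β} (hz : Function.Injective fun i => (z i).1)
    (y : ℝ) : |sepError ν b (q := q) Finset.univ z y| ≤ 1 := by
  have h1 : (n : ℝ)⁻¹ * adjSum Finset.univ (fun i => (z i).1)
      (fun i j => |below (q (z i)) y - below (q (z j)) y|) ≤ 1 := by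
    have := adjSum_le_card (s := Finset.univ) hz zero_le_one
      (w := fun i j => |below (q (z i)) y - below (q (z j)) y|) fun i j => abs_below_sub_le_one _ _ _
    rw [Fintype.card_fin, mul_one] at this
    rw [inv_mul_eq_div]
    exact div_le_one_of_le₀ this (by positivity)
  have h2 : 0 ≤ (n : ℝ)⁻¹ * adjSum Finset.univ (fun i => (z i).1)
      (fun i j => |below (q (z i)) y - below (q (z j)) y|) :=
    mul_nonneg (by positivity) (adjSum_nonneg fun _ _ => abs_nonneg _)
  unfold sepError
  rw [abs_le]
  constructor <;> linarith [pairSep_nonneg ν b (q := q) y, pairSep_le_one ν b hq y]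

lemma abs_sepError_le {n : ℕ} (s : Finset (Fin n)) (z : Fin n → ℝ × β) (hq : Measurable q)
    (y : ℝ) : |sepError ν b (q := q) s z y| ≤ n + 1 := by
  unfold sepError
  refine (abs_sub _ _).trans (add_le_add ?_ ?_)
  · have := abs_adjSum_le_sq (s := s) (x := fun i => (z i).1)
      (w := fun i j => |below (q (z i)) y - below (q (z j)) y|) (C := 1) fun i j => by
        rw [abs_abs]; exact abs_below_sub_le_one _ _ _
    rw [Fintype.card_fin, mul_one] at this
    rw [abs_mul, abs_of_nonneg (by positivity : (0 : ℝ) ≤ (n : ℝ)⁻¹)]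
    refine (mul_le_mul_of_nonneg_left this (by positivity)).trans ?_
    rcases Nat.eq_zero_or_pos n with rfl | hn
    · simp
    · have hn' : (0 : ℝ) < n := by exact_mod_cast hn
      rw [← mul_assoc, inv_mul_cancel₀ hn'.ne', one_mul]
  · rw [abs_of_nonneg (pairSep_nonneg ν b _)]
    exact pairSep_le_one ν b hq y

-- The terms add up to `1 + 7 + 2 + 2 + 2 + 24`. A uniform bound lets the square of a change be
-- estimated by a multiple of its first power, so that only the mean of `removalBound` has to
-- vanish.
include hq in
lemma removalBound_le {n : ℕ} (hn : 2 ≤ n) {z : Fin n → ℝ × β}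
    (hz : Function.Injective fun i => (z i).1) (k : Fin n) :
    removalBound ν b (q := q) z k ≤ 38 := by
  have hl := measurable_level ν b hq
  have l0 (z : ℝ × β) : 0 ≤ level ν b q z := respCdf_nonneg ν b q _
  have l1 (z : ℝ × β) : level ν b q z ≤ 1 := respCdf_le_one ν b q _
  have hn1 : (n : ℝ)⁻¹ ≤ 1 := inv_le_one_of_one_le₀ (by exact_mod_cast (by omega : 1 ≤ n))
  have aux (a c : Fin n → ℝ) (ha : ∀ i, 0 ≤ a i) (h1 : ∑ i, a i ≤ 1) (hc : ∀ i, c i ≤ 1) :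
      ∑ i, a i * c i ≤ 1 :=
    (Finset.sum_le_sum fun i _ => mul_le_of_le_one_right (ha i) (hc i)).trans h1
  have hρ (x x' : ℝ) : sectionDist b (level ν b q) x x' ≤ 1 :=
    (integral_mono (integrable_abs_section_sub b hl l0 l1 x x') (integrable_const (1 : ℝ))
      fun w => abs_level_sub_le_one l0 l1 _ _).trans (by simp)
  have hal (i j) := adjInd_nonneg Finset.univ (fun i => (z i).1) i j
  have hL := sum_adjInd_left_le (s := Finset.univ) hz k
  have hR := sum_adjInd_right_le (s := Finset.univ) hz k
  have hL0 : 0 ≤ ∑ i, adjInd Finset.univ (fun i => (z i).1) i k :=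
    Finset.sum_nonneg fun _ _ => hal _ _
  have hR0 : 0 ≤ ∑ i, adjInd Finset.univ (fun i => (z i).1) k i :=
    Finset.sum_nonneg fun _ _ => hal _ _
  have b1 := abs_sepError_le_one ν b hq hz (q (z k))
  have b2 := aux _ _ (fun i => hal i k) hL fun i => abs_cdfError_le_one ν b hq z (q (z i))
  have b3 := aux _ _ (fun i => hal k i) hR fun i => abs_cdfError_le_one ν b hq z (q (z i))
  have b4 := abs_cdfError_le_one ν b hq z (q (z k))
  have b5 := aux _ _ (fun i => hal k i) hR fun i => hρ (z k).1 (z i).1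
  have b6 := aux _ _ (fun i => hal i k) hL fun i => hρ (z i).1 (z k).1
  unfold removalBound
  linarith

/-- Summed over `k`, a sum over the neighbours of `k` on one side counts each index at most once.
The constant 25 consists of `7 * n * n⁻¹` and twice 9, once for each extremal index. -/
lemma sum_removalBound_le {n : ℕ} (hn : 2 ≤ n) {z : Fin n → ℝ × β}
    (hz : Function.Injective fun i => (z i).1) :
    ∑ k, removalBound ν b (q := q) z k ≤
      ∑ k, |sepError ν b (q := q) Finset.univ z (q (z k))| + 25 +
      6 * ∑ k, |cdfError ν b (q := q) z (q (z k))| +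
      6 * adjSum Finset.univ (fun i => (z i).1)
        (fun i j => sectionDist b (level ν b q) (z i).1 (z j).1) := by
  have hn0 : (n : ℝ) ≠ 0 := by
    have : n ≠ 0 := by omega
    exact_mod_cast this
  have h1 : ∑ k, ∑ i, adjInd Finset.univ (fun i => (z i).1) i k *
      |cdfError ν b (q := q) z (q (z i))| ≤ ∑ k, |cdfError ν b (q := q) z (q (z k))| := by
    rw [Finset.sum_comm]
    exact adjSum_fst_le hz (a := fun i => |cdfError ν b (q := q) z (q (z i))|) fun i => abs_nonneg _
  have h2 : ∑ k, ∑ j, adjInd Finset.univ (fun i => (z i).1) k j *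
      |cdfError ν b (q := q) z (q (z j))| ≤ ∑ k, |cdfError ν b (q := q) z (q (z k))| :=
    adjSum_snd_le hz (a := fun i => |cdfError ν b (q := q) z (q (z i))|) fun i => abs_nonneg _
  have h3 : ∑ k, ∑ j, adjInd Finset.univ (fun i => (z i).1) k j *
      sectionDist b (level ν b q) (z k).1 (z j).1 = adjSum Finset.univ (fun i => (z i).1)
        (fun i j => sectionDist b (level ν b q) (z i).1 (z j).1) := rfl
  have h4 : ∑ k, ∑ i, adjInd Finset.univ (fun i => (z i).1) i k *
      sectionDist b (level ν b q) (z i).1 (z k).1 = adjSum Finset.univ (fun i => (z i).1)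
        (fun i j => sectionDist b (level ν b q) (z i).1 (z j).1) := by
    rw [Finset.sum_comm]
    rfl
  have h5 := sum_one_sub_left_le hz
  have h6 := sum_one_sub_right_le hz
  unfold removalBound
  simp only [Finset.sum_add_distrib, ← Finset.mul_sum, h3, h4]
  have h7 : ∑ _k : Fin n, (n : ℝ)⁻¹ = 1 := by
    simp [hn0]
  rw [h7]
  linarith

end Remainder

/-! ### The variance of the remainder vanishes. -/

section RemainderVariance

variable (ν : Measure ℝ) [IsProbabilityMeasure ν] [NullSingletonClass ν]
variable {β : Type*} [MeasurableSpace β] (b : Measure β) [IsProbabilityMeasure b]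
variable {q : ℝ × β → ℝ} (hq : Measurable q)

include hq in
lemma measurable_sepError {n : ℕ} (s : Finset (Fin n)) :
    Measurable fun u : (Fin n → ℝ × β) × (ℝ × β) => sepError ν b (q := q) s u.1 (q u.2) := by
  have h1 : Measurable fun u : (Fin n → ℝ × β) × (ℝ × β) => pairSep ν b q (q u.2) :=
    (measurable_pairSep ν b hq).comp (hq.comp measurable_snd)
  unfold sepError adjSum
  fun_prop

include hq in
lemma measurable_cdfError {n : ℕ} :
    Measurable fun u : (Fin n → ℝ × β) × (ℝ × β) => cdfError ν b (q := q) u.1 (q u.2) := by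
  have h1 : Measurable fun u : (Fin n → ℝ × β) × (ℝ × β) => respCdf ν b q (q u.2) :=
    (monotone_respCdf ν b q).measurable.comp (hq.comp measurable_snd)
  unfold cdfError rankOf
  fun_prop

include hq in
lemma tendsto_integral_abs_cdfError (a : ℝ) :
    Tendsto (fun n : ℕ => ∫ z, |cdfError ν b (q := q) z a| ∂Measure.pi fun _ : Fin n => ν.prod b)
      atTop (𝓝 0) := by
  have h := tendsto_mean_abs_sub (ν.prod b) (d := fun z => below a (q z)) (by fun_prop) (B := 1)
    fun z => by
      rw [abs_of_nonneg (below_nonneg _ _)]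
      exact below_le_one _ _
  rw [integral_below_eq ν b hq] at h
  exact h

include hq in
-- For fixed `y`, separation is a bounded function of a pair of neighbours. Replacing the covariate
-- of the second by that of the first costs the distance of sections of the indicator, which
-- vanishes on average.
lemma tendsto_integral_abs_sepError (y : ℝ) :
    Tendsto (fun n : ℕ => ∫ z, |sepError ν b (q := q) Finset.univ z y|
      ∂Measure.pi fun _ : Fin n => ν.prod b) atTop (𝓝 0) := by
  set p : ℝ × β → ℝ := fun z => below (q z) y with hp
  have hpm : Measurable p := by fun_prop
  have hp1 (z : ℝ × β) : |p z| ≤ 1 := by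
    rw [abs_of_nonneg (below_nonneg _ _)]
    exact below_le_one _ _
  have hint (x x' : ℝ) : Integrable (fun w => |p (x, w) - p (x', w)|) b :=
    Integrable.of_bound (by fun_prop : Measurable _).aestronglyMeasurable 1
      (ae_of_all _ fun w => by simpa using abs_below_sub_le_one _ _ _)
  refine tendsto_adjSum_lln ν b (ψ := fun z z' => |p z - p z'|) (by fun_prop) (B := 1)
    (fun z z' => ?_) (ψ0 := sepMean b q y) ?_ (fun x => ?_) (r := sectionDist b p)
    (fun x x' => ?_) (measurable_sectionDist b hpm) (R := 1) (fun x x' => ?_)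
    (tendsto_adjSum_sectionDist b hpm hp1)
  · rw [abs_abs]
    exact abs_below_sub_le_one _ _ _
  · exact (measurable_sepMean b hq).comp (by fun_prop : Measurable fun x : ℝ => (y, x))
  · rw [abs_of_nonneg (sepMean_nonneg b y x)]
    exact sepMean_le_one b hq y x
  · have e1 (w : β) : |∫ w', |p (x, w) - p (x', w')| ∂b - ∫ w', |p (x, w) - p (x, w')| ∂b| ≤
        sectionDist b p x x' := by
      rw [← integral_sub (integrable_abs_below_sub b hq y x x' w)
        (integrable_abs_below_sub b hq y x x w)]
      refine (abs_integral_le_integral_abs).trans ?_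
      refine integral_mono_of_nonneg (ae_of_all _ fun _ => abs_nonneg _) (hint x x')
        (ae_of_all _ fun w' => ?_)
      refine (abs_abs_sub_abs_le _ _).trans (le_of_eq ?_)
      rw [sub_sub_sub_cancel_left]
    have e2 := integral_sub (integrable_integral_abs_below_sub b hq y x x')
      (integrable_integral_abs_below_sub b hq y x x)
    change |∫ w, ∫ w', |p (x, w) - p (x', w')| ∂b ∂b - sepMean b q y x| ≤ _
    rw [sepMean, ← e2]
    have := norm_integral_le_of_norm_le_const (μ := b) (f := fun w =>
      ∫ w', |p (x, w) - p (x', w')| ∂b - ∫ w', |p (x, w) - p (x, w')| ∂b)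
      (C := sectionDist b p x x') (ae_of_all _ e1)
    rwa [probReal_univ, mul_one, Real.norm_eq_abs] at this
  · rw [abs_of_nonneg (sectionDist_nonneg b p x x')]
    exact (integral_mono (hint x x') (integrable_const (1 : ℝ))
      fun w => abs_below_sub_le_one _ _ _).trans (by simp)

lemma tendsto_integral_of_abs_le_one {α : Type*} [MeasurableSpace α] {γ : ℕ → Type*}
    [∀ n, MeasurableSpace (γ n)] (l : Measure α) [IsProbabilityMeasure l]
    (Q : ∀ n, Measure (γ n)) [∀ n, IsProbabilityMeasure (Q n)] {G : ∀ n, γ n → α → ℝ}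
    (hG : ∀ n, Measurable (Function.uncurry (G n))) (h1 : ∀ n, ∀ᵐ z ∂Q n, ∀ u, |G n z u| ≤ 1)
    (hlim : ∀ u, Tendsto (fun n => ∫ z, |G n z u| ∂Q n) atTop (𝓝 0)) :
    Tendsto (fun n => ∫ u, ∫ z, |G n z u| ∂Q n ∂l) atTop (𝓝 0) := by
  have h := tendsto_integral_of_dominated_convergence (μ := l) (F := fun n u => ∫ z, |G n z u| ∂Q n)
    (f := fun _ => 0) (fun _ => 1) (fun n => ?_) (integrable_const _) (fun n => ?_)
    (ae_of_all _ hlim)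
  · simpa using h
  · refine StronglyMeasurable.aestronglyMeasurable ?_
    refine StronglyMeasurable.integral_prod_right (f := fun u z => |G n z u|) ?_
    have : Measurable fun v : α × γ n => |Function.uncurry (G n) (v.2, v.1)| :=
      ((hG n).comp measurable_swap).abs
    exact this.stronglyMeasurable
  · refine ae_of_all _ fun u => ?_
    have := norm_integral_le_of_norm_le_const (μ := Q n) (f := fun z => |G n z u|) (C := 1) (by
      filter_upwards [h1 n] with z hz
      simpa using hz u)
    simpa using this

include hq in
lemma tendsto_mean_sepError :
    Tendsto (fun n : ℕ => (n : ℝ)⁻¹ * ∑ k : Fin n, ∫ z, |sepError ν b (q := q) Finset.univ z (q (z k))|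
      ∂Measure.pi fun _ : Fin n => ν.prod b) atTop (𝓝 0) := by
  have hI := tendsto_integral_of_abs_le_one (ν.prod b)
    (fun n => Measure.pi fun _ : Fin n => ν.prod b)
    (G := fun n z u => sepError ν b (q := q) Finset.univ z (q u))
    (fun n => measurable_sepError ν b hq Finset.univ) (fun n => by
      filter_upwards [ae_injective_fst (ι := Fin n) ν b] with z hz u
      exact abs_sepError_le_one ν b hq hz _)
    (fun u => tendsto_integral_abs_sepError ν b hq (q u))
  have hlim := (tendsto_inv_atTop_nhds_zero_nat (𝕜 := ℝ)).const_mul (2 * 3) |>.add hI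
  simp only [mul_zero, add_zero] at hlim
  refine squeeze_zero' (Eventually.of_forall fun n => mul_nonneg (by positivity)
    (Finset.sum_nonneg fun k _ => integral_nonneg fun z => abs_nonneg _)) ?_ hlim
  filter_upwards [eventually_gt_atTop 0] with n hn
  have hn' : (0 : ℝ) < n := by exact_mod_cast hn
  rw [inv_mul_le_iff₀ hn']
  -- The level `q (z k)` belongs to the sample. Erasing `k` from the arrangement changes the error
  -- by at most `3 / n`, so the level may be treated as that of an independent observation.
  have key (k : Fin n) : ∫ z, |sepError ν b (q := q) Finset.univ z (q (z k))|
      ∂(Measure.pi fun _ : Fin n => ν.prod b) ≤ 2 * (3 * (n : ℝ)⁻¹) +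
      ∫ u, ∫ z, |sepError ν b (q := q) Finset.univ z (q u)|
        ∂(Measure.pi fun _ : Fin n => ν.prod b) ∂(ν.prod b) := by
    let G (s : Finset (Fin n)) (z : Fin n → ℝ × β) (u : ℝ × β) : ℝ := sepError ν b (q := q) s z (q u)
    have hG (s : Finset (Fin n)) : Measurable (Function.uncurry (G s)) := measurable_sepError ν b hq s
    have hGC (s : Finset (Fin n)) (z : Fin n → ℝ × β) (u : ℝ × β) : |G s z u| ≤ n + 1 :=
      abs_sepError_le ν b s z hq (q u)
    refine integral_abs_eval_le (ν.prod b) (hG Finset.univ) (hG (Finset.univ.erase k)) k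
      (fun z a u => ?_) (hGC _) (hGC _) ?_
    · simp only [G]
      unfold sepError
      congr 2
      refine adjSum_update_erase (fun i hi => ?_) fun i j hi hj => ?_
      · rw [Function.update_of_ne hi]
      · rw [Function.update_of_ne hi, Function.update_of_ne hj]
    · filter_upwards [ae_injective_fst (ι := Fin n) ν b] with z hz u
      simp only [G, sepError, sub_sub_sub_cancel_right]
      rw [← mul_sub, abs_mul, abs_of_pos (inv_pos.2 hn'), mul_comm 3]
      refine mul_le_mul_of_nonneg_left ?_ (by positivity)
      refine (abs_adjSum_sub_erase_le hz (Finset.mem_univ k) (B := 1) fun i j => ?_).trans (by simp)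
      rw [abs_abs]
      exact abs_below_sub_le_one _ _ _
  refine (Finset.sum_le_card_nsmul _ _ _ fun k _ => key k).trans (le_of_eq ?_)
  rw [Finset.card_univ, Fintype.card_fin, nsmul_eq_mul]
  ring

include hq in
lemma tendsto_mean_cdfError :
    Tendsto (fun n : ℕ => (n : ℝ)⁻¹ * ∑ k : Fin n, ∫ z, |cdfError ν b (q := q) z (q (z k))|
      ∂Measure.pi fun _ : Fin n => ν.prod b) atTop (𝓝 0) := by
  have hI := tendsto_integral_of_abs_le_one (ν.prod b)
    (fun n => Measure.pi fun _ : Fin n => ν.prod b)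
    (G := fun n z u => cdfError ν b (q := q) z (q u))
    (fun n => measurable_cdfError ν b hq) (fun n => ae_of_all _ fun z u =>
      abs_cdfError_le_one ν b hq z _)
    (fun u => tendsto_integral_abs_cdfError ν b hq (q u))
  have hlim := (tendsto_inv_atTop_nhds_zero_nat (𝕜 := ℝ)).const_mul 2 |>.add hI
  simp only [mul_zero, add_zero] at hlim
  refine squeeze_zero' (Eventually.of_forall fun n => mul_nonneg (by positivity)
    (Finset.sum_nonneg fun k _ => integral_nonneg fun z => abs_nonneg _)) ?_ hlim
  filter_upwards [eventually_gt_atTop 0] with n hn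
  have hn' : (0 : ℝ) < n := by exact_mod_cast hn
  rw [inv_mul_le_iff₀ hn']
  have key (k : Fin n) : ∫ z, |cdfError ν b (q := q) z (q (z k))|
      ∂(Measure.pi fun _ : Fin n => ν.prod b) ≤ 2 * (n : ℝ)⁻¹ +
      ∫ u, ∫ z, |cdfError ν b (q := q) z (q u)|
        ∂(Measure.pi fun _ : Fin n => ν.prod b) ∂(ν.prod b) := by
    -- Dropping the contribution of `z k` to the empirical distribution function, at most `1 / n`,
    -- gives a function that does not see coordinate `k`.
    refine integral_abs_eval_le (ν.prod b)
      (G := fun z u => cdfError ν b (q := q) z (q u)) (measurable_cdfError ν b hq)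
      (Gk := fun z u => cdfError ν b (q := q) z (q u) - (n : ℝ)⁻¹ * below (q u) (q (z k)))
      ((measurable_cdfError ν b hq).sub (by fun_prop)) k (fun z a u => ?_)
      (C := 2) (fun z u => (abs_cdfError_le_one ν b hq z _).trans one_le_two)
      (fun z u => ?_) (ae_of_all _ fun z u => ?_)
    · simp only [cdfError, rankOf_univ_eq _ k, Function.update_self]
      simp only [rankOf]
      have : ∑ l ∈ Finset.univ.erase k, below (q u) (q (Function.update z k a l)) =
          ∑ l ∈ Finset.univ.erase k, below (q u) (q (z l)) := by
        refine Finset.sum_congr rfl fun l hl => ?_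
        rw [Function.update_of_ne (Finset.ne_of_mem_erase hl)]
      rw [this]
      ring
    · refine (abs_sub _ _).trans ?_
      have h1 := abs_cdfError_le_one ν b hq z (q u)
      have h2 : (n : ℝ)⁻¹ ≤ 1 := inv_le_one_of_one_le₀ (by exact_mod_cast hn)
      rw [abs_mul, abs_of_nonneg (below_nonneg _ _), abs_of_pos (inv_pos.2 hn')]
      have h3 := mul_le_one₀ h2 (below_nonneg (q u) (q (z k))) (below_le_one _ _)
      linarith
    · rw [sub_sub_cancel, abs_mul, abs_of_nonneg (below_nonneg _ _), abs_of_pos (inv_pos.2 hn')]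
      exact mul_le_of_le_one_right (by positivity) (below_le_one _ _)
  refine (Finset.sum_le_card_nsmul _ _ _ fun k _ => key k).trans (le_of_eq ?_)
  rw [Finset.card_univ, Fintype.card_fin, nsmul_eq_mul]

include hq in
-- By Efron-Stein, with the erased statistics as approximations, the variance is at most `2 / n`
-- times the sum of the mean squares of the rescaled changes. Each square is at most `38 *
-- removalBound`, whence the factor `76`, and the averages composing `removalBound` tend to zero.
theorem tendsto_variance_remainder :
    Tendsto (fun n : ℕ => Var[remainder ν b q (Finset.univ : Finset (Fin n));
      Measure.pi fun _ : Fin n => ν.prod b]) atTop (𝓝 0) := by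
  have hl := measurable_level ν b hq
  have l0 (z : ℝ × β) : 0 ≤ level ν b q z := respCdf_nonneg ν b q _
  have l1 (z : ℝ × β) : level ν b q z ≤ 1 := respCdf_le_one ν b q _
  have hlim := ((((tendsto_mean_sepError ν b hq).add
    ((tendsto_inv_atTop_nhds_zero_nat (𝕜 := ℝ)).const_mul 25)).add
    ((tendsto_mean_cdfError ν b hq).const_mul 6)).add
    ((tendsto_adjSum_sectionDist (ν := ν) b hl fun z => by
      rw [abs_of_nonneg (l0 z)]; exact l1 z).const_mul 6)).const_mul 76
  simp only [mul_zero, add_zero] at hlim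
  refine squeeze_zero' (Eventually.of_forall fun n => variance_nonneg _ _) ?_ hlim
  filter_upwards [eventually_ge_atTop 2] with n hn
  have hn' : (0 : ℝ) < n := by exact_mod_cast (by omega : 0 < n)
  set Q := Measure.pi fun _ : Fin n => ν.prod b with hQ
  have hm (s : Finset (Fin n)) := measurable_remainder ν b hq s
  refine (variance_le_two_mul_sum (ν.prod b) (hm _) (fun z => abs_remainder_le ν b hq _ z)
    (g := fun k => remainder ν b q (Finset.univ.erase k)) (fun k => hm _)
    (fun k z => abs_remainder_le ν b hq _ z)
    (fun k z a => remainder_update_erase ν b k z a)).trans ?_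
  set CC := |√n / ((n : ℝ) ^ 2 - 1)| * (n * (n * n)) + (√n)⁻¹ * (n * (n * 2) + n * 3) with hCC
  have hi (k : Fin n) : Integrable (fun z => (remainder ν b q Finset.univ z -
      remainder ν b q (Finset.univ.erase k) z) ^ 2) Q := by
    refine Integrable.of_bound (((hm _).sub (hm _)).pow_const 2).aestronglyMeasurable
      ((CC + CC) ^ 2) (ae_of_all _ fun z => ?_)
    rw [Real.norm_eq_abs, abs_pow]
    exact pow_le_pow_left₀ (abs_nonneg _) ((abs_sub _ _).trans (add_le_add
      (abs_remainder_le ν b hq _ z) (abs_remainder_le ν b hq _ z))) 2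
  have i1 (k : Fin n) : Integrable (fun z => |sepError ν b (q := q) Finset.univ z (q (z k))|) Q := by
    refine Integrable.of_bound (((measurable_sepError ν b hq Finset.univ).comp
      (by fun_prop : Measurable fun z : Fin n → ℝ × β => (z, z k))).abs).aestronglyMeasurable (n + 1)
      (ae_of_all _ fun z => ?_)
    rw [Real.norm_eq_abs, abs_abs]
    exact abs_sepError_le ν b _ z hq _
  have i2 (k : Fin n) : Integrable (fun z => |cdfError ν b (q := q) z (q (z k))|) Q := by
    refine Integrable.of_bound (((measurable_cdfError ν b hq).comp
      (by fun_prop : Measurable fun z : Fin n → ℝ × β => (z, z k))).abs).aestronglyMeasurable 1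
      (ae_of_all _ fun z => ?_)
    rw [Real.norm_eq_abs, abs_abs]
    exact abs_cdfError_le_one ν b hq z _
  have hs1 (x x' : ℝ) : |sectionDist b (level ν b q) x x'| ≤ 1 := by
    rw [abs_of_nonneg (sectionDist_nonneg b _ x x')]
    exact (integral_mono (integrable_abs_section_sub b hl l0 l1 x x') (integrable_const (1 : ℝ))
      fun w => abs_level_sub_le_one l0 l1 _ _).trans (by simp)
  have hsm : Measurable fun x : Fin n → ℝ => adjSum Finset.univ x
      (fun i j => sectionDist b (level ν b q) (x i) (x j)) := by
    have : Measurable (Function.uncurry (sectionDist b (level ν b q))) := measurable_sectionDist b hl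
    unfold adjSum
    fun_prop
  have hmp := measurePreserving_fst_pi (ι := Fin n) ν b
  have i3 : Integrable (fun z : Fin n → ℝ × β => adjSum Finset.univ (fun i => (z i).1)
      (fun i j => sectionDist b (level ν b q) (z i).1 (z j).1)) Q := by
    refine Integrable.of_bound (hsm.comp hmp.measurable).aestronglyMeasurable (n * (n * 1))
      (ae_of_all _ fun z => ?_)
    have := abs_adjSum_le_sq (s := Finset.univ) (x := fun i => (z i).1) (w := fun i j =>
      sectionDist b (level ν b q) (z i).1 (z j).1) (C := 1) fun i j => hs1 _ _
    rw [Fintype.card_fin] at this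
    exact this
  have e3 : ∫ z, adjSum Finset.univ (fun i => (z i).1)
      (fun i j => sectionDist b (level ν b q) (z i).1 (z j).1) ∂Q =
      ∫ x, adjSum Finset.univ x (fun i j => sectionDist b (level ν b q) (x i) (x j))
        ∂(Measure.pi fun _ : Fin n => ν) :=
    integral_comp_measurePreserving hmp hsm.aestronglyMeasurable
  have iA : Integrable (fun z : Fin n → ℝ × β =>
      ∑ k, |sepError ν b (q := q) Finset.univ z (q (z k))|) Q := integrable_finsetSum _ fun k _ => i1 k
  have iB : Integrable (fun z : Fin n → ℝ × β => ∑ k, |cdfError ν b (q := q) z (q (z k))|) Q :=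
    integrable_finsetSum _ fun k _ => i2 k
  have iAB : Integrable (fun z : Fin n → ℝ × β =>
      ∑ k, |sepError ν b (q := q) Finset.univ z (q (z k))| + 25) Q := iA.add (integrable_const _)
  have iABC : Integrable (fun z : Fin n → ℝ × β =>
      ∑ k, |sepError ν b (q := q) Finset.univ z (q (z k))| + 25 +
      6 * ∑ k, |cdfError ν b (q := q) z (q (z k))|) Q := iAB.add (iB.const_mul 6)
  have iABCD : Integrable (fun z : Fin n → ℝ × β =>
      ∑ k, |sepError ν b (q := q) Finset.univ z (q (z k))| + 25 +
      6 * ∑ k, |cdfError ν b (q := q) z (q (z k))| +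
      6 * adjSum Finset.univ (fun i => (z i).1)
        (fun i j => sectionDist b (level ν b q) (z i).1 (z j).1)) Q := iABC.add (i3.const_mul 6)
  rw [← integral_finsetSum _ fun k _ => hi k]
  have hb : ∫ z, ∑ k, (remainder ν b q Finset.univ z -
      remainder ν b q (Finset.univ.erase k) z) ^ 2 ∂Q ≤ ∫ z, 38 * (n : ℝ)⁻¹ *
      (∑ k, |sepError ν b (q := q) Finset.univ z (q (z k))| + 25 +
      6 * ∑ k, |cdfError ν b (q := q) z (q (z k))| +
      6 * adjSum Finset.univ (fun i => (z i).1)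
        (fun i j => sectionDist b (level ν b q) (z i).1 (z j).1)) ∂Q := by
    refine integral_mono_ae (integrable_finsetSum _ fun k _ => hi k) (iABCD.const_mul _) ?_
    filter_upwards [ae_injective_fst (ι := Fin n) ν b] with z hz
    refine le_trans ?_ (mul_le_mul_of_nonneg_left (sum_removalBound_le ν b hn hz) (by positivity))
    rw [Finset.mul_sum]
    refine Finset.sum_le_sum fun k _ => ?_
    have h1 := abs_remainder_sub_le ν b hq hn hz k
    have h2 := removalBound_le ν b hq hn hz k
    have h3 : (n : ℝ) * (remainder ν b q Finset.univ z -
        remainder ν b q (Finset.univ.erase k) z) ^ 2 ≤ 38 * removalBound ν b (q := q) z k := by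
      have e : (n : ℝ) * (remainder ν b q Finset.univ z -
          remainder ν b q (Finset.univ.erase k) z) ^ 2 =
          |√n * (remainder ν b q Finset.univ z - remainder ν b q (Finset.univ.erase k) z)| ^ 2 := by
        rw [sq_abs, mul_pow, Real.sq_sqrt hn'.le]
      rw [e]
      nlinarith [abs_nonneg (√n * (remainder ν b q Finset.univ z -
        remainder ν b q (Finset.univ.erase k) z))]
    rw [mul_comm 38, mul_assoc, ← div_eq_inv_mul, le_div_iff₀ hn', mul_comm]
    exact h3
  refine (mul_le_mul_of_nonneg_left hb zero_le_two).trans (le_of_eq ?_)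
  rw [integral_const_mul, integral_add iABC (i3.const_mul 6), integral_add iAB (iB.const_mul 6),
    integral_add iA (integrable_const _), integral_const_mul, integral_const_mul, e3,
    integral_finsetSum _ fun k _ => i1 k, integral_finsetSum _ fun k _ => i2 k]
  simp only [integral_const, probReal_univ, one_smul]
  ring

end RemainderVariance

/-! ### Convergence of the mean square of the martingale differences. -/

section CentralLimit

variable (ν : Measure ℝ) [IsProbabilityMeasure ν] [NullSingletonClass ν]
variable {β : Type*} [MeasurableSpace β] (b : Measure β) [IsProbabilityMeasure b]

lemma sum_neighbourTerm {n : ℕ} (d : ℝ × β → ℝ) (c : ℝ × β → ℝ × β → ℝ) (z : Fin n → ℝ × β) :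
    ∑ j, neighbourTerm d c z j =
      ∑ j, d (z j) + adjSum Finset.univ (fun i => (z i).1) (fun i j => c (z i) (z j)) := by
  unfold neighbourTerm adjSum
  rw [Finset.sum_add_distrib, Finset.sum_comm (γ := Fin n)]

/-- The sum inside a term has at most one nonzero summand, since left neighbours are unique, so
squaring produces no products over different pairs. -/
lemma sum_neighbourTerm_sq {n : ℕ} (d : ℝ × β → ℝ) (c : ℝ × β → ℝ × β → ℝ) {z : Fin n → ℝ × β}
    (hz : Function.Injective fun i => (z i).1) :
    ∑ j, neighbourTerm d c z j ^ 2 = ∑ j, d (z j) ^ 2 +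
      adjSum Finset.univ (fun i => (z i).1)
        (fun i j => 2 * d (z j) * c (z i) (z j) + c (z i) (z j) ^ 2) := by
  have key (j : Fin n) : neighbourTerm d c z j ^ 2 = d (z j) ^ 2 +
      ∑ i, adjInd Finset.univ (fun i => (z i).1) i j *
        (2 * d (z j) * c (z i) (z j) + c (z i) (z j) ^ 2) := by
    unfold neighbourTerm
    by_cases h : ∃ i, Adj Finset.univ (fun i => (z i).1) i j
    · obtain ⟨i, hi⟩ := h
      rw [sum_adjInd_left_eq hz hi, sum_adjInd_left_eq hz hi]
      ring
    · push Not at h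
      rw [sum_adjInd_left_eq_zero h, sum_adjInd_left_eq_zero h]
      ring
  rw [Finset.sum_congr rfl fun j _ => key j, Finset.sum_add_distrib, Finset.sum_comm (γ := Fin n)]
  rfl

variable {p : ℝ × β → ℝ} (hp : Measurable p) (hp0 : ∀ z, 0 ≤ p z) (hp1 : ∀ z, p z ≤ 1)

/-- The conditional second moment of `degDist` at two responses with the same covariate. -/
noncomputable def degVar (p : ℝ × β → ℝ) (x : ℝ) : ℝ :=
  ∫ w, ∫ w', degDist b p (x, w) (x, w') ^ 2 ∂b ∂b

include hp in
lemma measurable_degDist_section (x x' : ℝ) :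
    Measurable fun u : β × β => degDist b p (x, u.1) (x', u.2) :=
  (measurable_degDist b hp).comp
    (by fun_prop : Measurable fun u : β × β => ((x, u.1), (x', u.2)))

include hp hp0 hp1 in
lemma degDist_sq_le (z z' : ℝ × β) : degDist b p z z' ^ 2 ≤ 4 := by
  have h := abs_degDist_le b hp hp0 hp1 z z'
  rw [← sq_abs]
  nlinarith [abs_nonneg (degDist b p z z')]

lemma degVar_nonneg (x : ℝ) : 0 ≤ degVar b p x :=
  integral_nonneg fun _ => integral_nonneg fun _ => sq_nonneg _

include hp in
lemma measurable_degVar : Measurable (degVar b p) := by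
  have hc := measurable_degDist b hp
  have h1 : Measurable fun u : (ℝ × β) × β => degDist b p (u.1.1, u.1.2) (u.1.1, u.2) ^ 2 :=
    (hc.comp (by fun_prop : Measurable fun u : (ℝ × β) × β =>
      ((u.1.1, u.1.2), (u.1.1, u.2)))).pow_const 2
  have h2 : StronglyMeasurable fun u : ℝ × β => ∫ w', degDist b p (u.1, u.2) (u.1, w') ^ 2 ∂b :=
    StronglyMeasurable.integral_prod_right h1.stronglyMeasurable
  exact (StronglyMeasurable.integral_prod_right h2).measurable

lemma norm_integral_le_of_bound {α : Type*} [MeasurableSpace α] {l : Measure α}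
    [IsProbabilityMeasure l] {f : α → ℝ} {C : ℝ} (h : ∀ a, |f a| ≤ C) : |∫ a, f a ∂l| ≤ C := by
  have := norm_integral_le_of_norm_le_const (μ := l) (f := f) (C := C) (ae_of_all _ h)
  simpa using this

include hp hp0 hp1 in
lemma degVar_le (x : ℝ) : degVar b p x ≤ 4 := by
  refine (le_abs_self _).trans (norm_integral_le_of_bound fun w => norm_integral_le_of_bound
    fun w' => ?_)
  rw [abs_of_nonneg (sq_nonneg _)]
  exact degDist_sq_le b hp hp0 hp1 _ _

include hp hp0 hp1 in
lemma integral_degDist_left (x : ℝ) (z : ℝ × β) : ∫ w, degDist b p (x, w) z ∂b = 0 := by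
  simp only [degDist_comm b hp hp0 hp1 _ z]
  exact integral_degDist_right b hp hp0 hp1 z x

include hp hp0 hp1 in
-- Both values of the kernel are at most 2, so the squares differ by at most four times their
-- difference, whose mean is at most `4 * sectionDist`.
lemma abs_integral_degDist_sq_sub_le (x x' : ℝ) :
    |∫ w, ∫ w', degDist b p (x, w) (x', w') ^ 2 ∂b ∂b - degVar b p x| ≤
      16 * sectionDist b p x x' := by
  have hi (x' : ℝ) (w : β) : Integrable (fun w' => degDist b p (x, w) (x', w') ^ 2) b := by
    refine Integrable.of_bound (((measurable_degDist_section b hp x x').comp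
      (by fun_prop : Measurable fun w' : β => (w, w'))).pow_const 2).aestronglyMeasurable 4
      (ae_of_all _ fun w' => ?_)
    rw [Real.norm_eq_abs, abs_of_nonneg (sq_nonneg _)]
    exact degDist_sq_le b hp hp0 hp1 _ _
  have hi2 (x' : ℝ) : Integrable (fun w => ∫ w', degDist b p (x, w) (x', w') ^ 2 ∂b) b := by
    refine Integrable.of_bound (StronglyMeasurable.aestronglyMeasurable ?_) 4
      (ae_of_all _ fun w => norm_integral_le_of_bound fun w' => ?_)
    · exact StronglyMeasurable.integral_prod_right
        ((measurable_degDist_section b hp x x').pow_const 2).stronglyMeasurable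
    · rw [abs_of_nonneg (sq_nonneg _)]
      exact degDist_sq_le b hp hp0 hp1 _ _
  have his : Integrable (fun w' => |p (x', w') - p (x, w')|) b :=
    integrable_abs_section_sub b hp hp0 hp1 x' x
  have es : ∫ w', |p (x', w') - p (x, w')| ∂b = sectionDist b p x x' := by
    simp only [abs_sub_comm (p (x', _))]
    rfl
  unfold degVar
  rw [← integral_sub (hi2 x') (hi2 x)]
  refine norm_integral_le_of_bound fun w => ?_
  rw [← integral_sub (hi x' w) (hi x w)]
  refine abs_integral_le_integral_abs.trans ?_
  have hb : ∫ w', |degDist b p (x, w) (x', w') ^ 2 - degDist b p (x, w) (x, w') ^ 2| ∂b ≤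
      ∫ w', (8 * |p (x', w') - p (x, w')| + 8 * sectionDist b p x x') ∂b := by
    refine integral_mono_of_nonneg (ae_of_all _ fun _ => abs_nonneg _)
      ((his.const_mul 8).add (integrable_const _)) (ae_of_all _ fun w' => ?_)
    have h1 := abs_degDist_sub_le b hp hp0 hp1 x x' w w'
    have h2 := abs_degDist_le b hp hp0 hp1 (x, w) (x', w')
    have h3 := abs_degDist_le b hp hp0 hp1 (x, w) (x, w')
    have h4 : |degDist b p (x, w) (x', w') + degDist b p (x, w) (x, w')| ≤ 4 :=
      (abs_add_le _ _).trans (by linarith)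
    simp only
    rw [sq_sub_sq, abs_mul]
    have := mul_le_mul h4 h1 (abs_nonneg _) (by norm_num)
    linarith
  refine hb.trans (le_of_eq ?_)
  rw [integral_add (his.const_mul 8) (integrable_const _), integral_const_mul, es]
  simp only [integral_const, probReal_univ, one_smul]
  ring

include hp hp0 hp1 in
-- The kernel is centred in either noise variable. Integrating first over the noise `w`, on which
-- `f` does not depend, kills the product.
lemma integral_mul_degDist (x x' : ℝ) {f : β → ℝ} (hf : Measurable f) {B : ℝ}
    (hB : ∀ w, |f w| ≤ B) : ∫ w, ∫ w', f w' * degDist b p (x, w) (x', w') ∂b ∂b = 0 := by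
  have hm : Measurable fun u : β × β => f u.2 * degDist b p (x, u.1) (x', u.2) :=
    (hf.comp measurable_snd).mul (measurable_degDist_section b hp x x')
  rw [integral_integral_swap]
  · simp only [integral_const_mul, integral_degDist_left b hp hp0 hp1, mul_zero, integral_zero]
  · refine Integrable.of_bound hm.aestronglyMeasurable (B * 2) (ae_of_all _ fun u => ?_)
    simp only [Function.uncurry, Real.norm_eq_abs]
    rw [abs_mul]
    exact mul_le_mul (hB _) (abs_degDist_le b hp hp0 hp1 _ _) (abs_nonneg _)
      ((abs_nonneg _).trans (hB u.2))

include hp hp0 hp1 in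
-- The cross terms between `d` and the kernel have conditional mean zero given the covariates. The
-- squared kernel at neighbours is replaced on average by its value at equal covariates, which is
-- `degVar`.
lemma tendsto_sum_neighbourTerm_sq {d : ℝ × β → ℝ} (hd : Measurable d) {B : ℝ}
    (hB : ∀ z, |d z| ≤ B) :
    Tendsto (fun n : ℕ => ∫ z, |(n : ℝ)⁻¹ * ∑ j, neighbourTerm d (degDist b p) z j ^ 2 -
      (∫ a, d a ^ 2 ∂(ν.prod b) + ∫ x, degVar b p x ∂ν)| ∂(Measure.pi fun _ : Fin n => ν.prod b))
      atTop (𝓝 0) := by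
  have hc := measurable_degDist b hp
  have hB0 : 0 ≤ B := by
    obtain ⟨a⟩ : Nonempty (ℝ × β) := nonempty_of_isProbabilityMeasure (ν.prod b)
    exact (abs_nonneg _).trans (hB a)
  set ψ : ℝ × β → ℝ × β → ℝ := fun z z' => 2 * d z' * degDist b p z z' + degDist b p z z' ^ 2 with hψ
  have hψm : Measurable (Function.uncurry ψ) := by
    have : Measurable fun u : (ℝ × β) × (ℝ × β) => degDist b p u.1 u.2 := hc
    simp only [hψ, Function.uncurry_def]
    fun_prop
  have hψb (z z' : ℝ × β) : |ψ z z'| ≤ 4 * B + 4 := by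
    refine (abs_add_le _ _).trans (add_le_add ?_ ?_)
    · rw [abs_mul, abs_mul, abs_of_pos (zero_lt_two' ℝ)]
      have := mul_le_mul (hB z') (abs_degDist_le b hp hp0 hp1 z z') (abs_nonneg _) hB0
      linarith
    · rw [abs_of_nonneg (sq_nonneg _)]
      exact degDist_sq_le b hp hp0 hp1 _ _
  have hψint (x x' : ℝ) : ∫ w, ∫ w', ψ (x, w) (x', w') ∂b ∂b =
      ∫ w, ∫ w', degDist b p (x, w) (x', w') ^ 2 ∂b ∂b := by
    have hm := measurable_degDist_section b hp x x'
    have hdm : Measurable fun w' : β => 2 * d (x', w') := by fun_prop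
    have m1 : Measurable fun u : β × β => 2 * d (x', u.2) * degDist b p (x, u.1) (x', u.2) :=
      (hdm.comp measurable_snd).mul hm
    have hb1 (w w' : β) : |2 * d (x', w') * degDist b p (x, w) (x', w')| ≤ 2 * B * 2 := by
      rw [abs_mul, abs_mul, abs_of_pos (zero_lt_two' ℝ)]
      exact mul_le_mul (by linarith [hB (x', w')]) (abs_degDist_le b hp hp0 hp1 _ _)
        (abs_nonneg _) (by positivity)
    have hb2 (w w' : β) : |degDist b p (x, w) (x', w') ^ 2| ≤ 4 := by
      rw [abs_of_nonneg (sq_nonneg _)]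
      exact degDist_sq_le b hp hp0 hp1 _ _
    have i1 (w : β) : Integrable (fun w' => 2 * d (x', w') * degDist b p (x, w) (x', w')) b :=
      Integrable.of_bound (m1.comp
        (by fun_prop : Measurable fun w' : β => (w, w'))).aestronglyMeasurable (2 * B * 2)
        (ae_of_all _ (hb1 w))
    have i2 (w : β) : Integrable (fun w' => degDist b p (x, w) (x', w') ^ 2) b :=
      Integrable.of_bound ((hm.comp
        (by fun_prop : Measurable fun w' : β => (w, w'))).pow_const 2).aestronglyMeasurable 4
        (ae_of_all _ (hb2 w))
    have j1 : Integrable (fun w => ∫ w', 2 * d (x', w') * degDist b p (x, w) (x', w') ∂b) b :=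
      Integrable.of_bound (StronglyMeasurable.integral_prod_right
        m1.stronglyMeasurable).aestronglyMeasurable _
        (ae_of_all _ fun w => norm_integral_le_of_bound (hb1 w))
    have j2 : Integrable (fun w => ∫ w', degDist b p (x, w) (x', w') ^ 2 ∂b) b :=
      Integrable.of_bound (StronglyMeasurable.integral_prod_right
        (hm.pow_const 2).stronglyMeasurable).aestronglyMeasurable _
        (ae_of_all _ fun w => norm_integral_le_of_bound (hb2 w))
    have e (w : β) : ∫ w', ψ (x, w) (x', w') ∂b = ∫ w', 2 * d (x', w') *
        degDist b p (x, w) (x', w') ∂b + ∫ w', degDist b p (x, w) (x', w') ^ 2 ∂b :=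
      integral_add (i1 w) (i2 w)
    simp only [e]
    rw [integral_add j1 j2, integral_mul_degDist b hp hp0 hp1 x x' hdm (B := 2 * B) fun w => by
      rw [abs_mul, abs_of_pos (zero_lt_two' ℝ)]
      linarith [hB (x', w)], zero_add]
  have hp1' (z : ℝ × β) : |p z| ≤ 1 := by
    rw [abs_of_nonneg (hp0 z)]
    exact hp1 z
  have h1 := tendsto_adjSum_lln ν b hψm hψb (measurable_degVar b hp) (fun x => by
      rw [abs_of_nonneg (degVar_nonneg b x)]
      linarith [degVar_le b hp hp0 hp1 x])
    (r := fun x x' => 16 * sectionDist b p x x') (fun x x' => by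
      rw [hψint]
      exact abs_integral_degDist_sq_sub_le b hp hp0 hp1 x x')
    ((measurable_sectionDist b hp).const_mul 16) (R := 16) (fun x x' => by
      rw [abs_of_nonneg (mul_nonneg (by norm_num) (sectionDist_nonneg b p x x'))]
      have : sectionDist b p x x' ≤ 1 := (integral_mono (integrable_abs_section_sub b hp hp0 hp1 x x')
        (integrable_const (1 : ℝ)) fun w => abs_level_sub_le_one hp0 hp1 _ _).trans (by simp)
      linarith) (by
      have := (tendsto_adjSum_sectionDist (ν := ν) b hp hp1').const_mul 16
      rw [mul_zero] at this
      refine this.congr fun n => ?_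
      simp only [adjSum_const_mul, integral_const_mul]
      ring)
  have h2 := tendsto_mean_abs_sub (ν.prod b) (d := fun z => d z ^ 2) (hd.pow_const 2) (B := B ^ 2)
    fun z => by
      rw [abs_pow]
      exact pow_le_pow_left₀ (abs_nonneg _) (hB z) 2
  have h3 := h2.add h1
  rw [add_zero] at h3
  refine squeeze_zero (fun n => integral_nonneg fun z => abs_nonneg _) (fun n => ?_) h3
  have m1 : Measurable fun z : Fin n → ℝ × β => |(n : ℝ)⁻¹ * ∑ i, d (z i) ^ 2 -
      ∫ a, d a ^ 2 ∂(ν.prod b)| := by fun_prop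
  have m2 : Measurable fun z : Fin n → ℝ × β => |(n : ℝ)⁻¹ * adjSum Finset.univ (fun i => (z i).1)
      (fun i j => ψ (z i) (z j)) - ∫ x, degVar b p x ∂ν| := by
    unfold adjSum
    fun_prop
  have i1 : Integrable (fun z : Fin n → ℝ × β => |(n : ℝ)⁻¹ * ∑ i, d (z i) ^ 2 -
      ∫ a, d a ^ 2 ∂(ν.prod b)|) (Measure.pi fun _ => ν.prod b) := by
    refine Integrable.of_bound m1.aestronglyMeasurable
      ((n : ℝ)⁻¹ * (n * B ^ 2) + |∫ a, d a ^ 2 ∂(ν.prod b)|) (ae_of_all _ fun z => ?_)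
    rw [Real.norm_eq_abs, abs_abs]
    refine (abs_sub _ _).trans (add_le_add_left ?_ _)
    rw [abs_mul, abs_of_nonneg (by positivity : (0 : ℝ) ≤ (n : ℝ)⁻¹)]
    refine mul_le_mul_of_nonneg_left ?_ (by positivity)
    refine (Finset.abs_sum_le_sum_abs _ _).trans ((Finset.sum_le_card_nsmul _ _ (B ^ 2)
      fun i _ => ?_).trans (by simp))
    rw [abs_pow]
    exact pow_le_pow_left₀ (abs_nonneg _) (hB _) 2
  have i2 : Integrable (fun z : Fin n → ℝ × β => |(n : ℝ)⁻¹ * adjSum Finset.univ (fun i => (z i).1)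
      (fun i j => ψ (z i) (z j)) - ∫ x, degVar b p x ∂ν|) (Measure.pi fun _ => ν.prod b) := by
    refine Integrable.of_bound m2.aestronglyMeasurable
      ((n : ℝ)⁻¹ * (n * (n * (4 * B + 4))) + |∫ x, degVar b p x ∂ν|) (ae_of_all _ fun z => ?_)
    rw [Real.norm_eq_abs, abs_abs]
    refine (abs_sub _ _).trans (add_le_add_left ?_ _)
    rw [abs_mul, abs_of_nonneg (by positivity : (0 : ℝ) ≤ (n : ℝ)⁻¹)]
    refine mul_le_mul_of_nonneg_left ?_ (by positivity)
    have := abs_adjSum_le_sq (s := Finset.univ) (x := fun i => (z i).1)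
      (w := fun i j => ψ (z i) (z j)) (C := 4 * B + 4) fun i j => hψb _ _
    rwa [Fintype.card_fin] at this
  rw [← integral_add i1 i2]
  refine integral_mono_of_nonneg (ae_of_all _ fun _ => abs_nonneg _) (i1.add i2) ?_
  filter_upwards [ae_injective_fst (ι := Fin n) ν b] with z hz
  rw [sum_neighbourTerm_sq d _ hz]
  refine le_trans (le_of_eq ?_) (abs_add_le _ _)
  congr 1
  simp only [hψ]
  ring

/-- The central limit theorem for bounded centred variables, for characteristic functions. -/
lemma tendsto_charFun_sum {α : Type*} [MeasurableSpace α] (l : Measure α) [IsProbabilityMeasure l]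
    {h : α → ℝ} (hh : Measurable h) {B : ℝ} (hB : ∀ a, |h a| ≤ B) (h0 : ∫ a, h a ∂l = 0) (s : ℝ) :
    Tendsto (fun n : ℕ => ∫ a, Complex.exp ((s * ((√n)⁻¹ * ∑ j, h (a j)) : ℝ) * Complex.I)
      ∂(Measure.pi fun _ : Fin n => l)) atTop
      (𝓝 (Complex.exp (-((s ^ 2 * ∫ a, h a ^ 2 ∂l : ℝ) : ℂ) / 2))) := by
  -- An auxiliary covariate, independent of the data, is attached; its atomless law is otherwise
  -- irrelevant. With zero pair terms, the neighbour theorem becomes the classical one.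
  set ν₀ : Measure ℝ := gaussianReal 0 1 with hν₀
  have : NullSingletonClass ν₀ := nullSingletonClass_gaussianReal one_ne_zero
  have hB0 : 0 ≤ B := by
    obtain ⟨a⟩ : Nonempty α := nonempty_of_isProbabilityMeasure l
    exact (abs_nonneg _).trans (hB a)
  have hmp (n : ℕ) : MeasurePreserving (fun (z : Fin n → ℝ × α) i => (z i).2)
      (Measure.pi fun _ => ν₀.prod l) (Measure.pi fun _ => l) :=
    measurePreserving_pi (fun _ : Fin n => ν₀.prod l) (fun _ : Fin n => l) (f := fun _ => Prod.snd)
      fun _ => measurePreserving_snd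
  have hN (n : ℕ) (z : Fin n → ℝ × α) (j : Fin n) :
      neighbourTerm (fun a : ℝ × α => h a.2) (fun _ _ => 0) z j = h (z j).2 := by
    simp [neighbourTerm]
  have hE : ∫ a, h a.2 ^ 2 ∂(ν₀.prod l) = ∫ a, h a ^ 2 ∂l :=
    integral_comp_measurePreserving measurePreserving_snd (hh.pow_const 2).aestronglyMeasurable
  have hlln := tendsto_mean_abs_sub (ν₀.prod l) (d := fun a => h a.2 ^ 2)
    ((hh.comp measurable_snd).pow_const 2) (B := B ^ 2) fun z => by
      rw [abs_pow]
      exact pow_le_pow_left₀ (abs_nonneg _) (hB _) 2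
  rw [hE] at hlln
  have key := tendsto_charFun_neighbourTerm ν₀ l (d := fun a : ℝ × α => h a.2) (c := fun _ _ => 0)
    (hh.comp measurable_snd) measurable_const (B := B) (fun z => hB _) (fun _ _ => by simpa using hB0)
    (fun _ => h0) (fun _ _ => by simp) (τ2 := ∫ a, h a ^ 2 ∂l) (integral_nonneg fun _ => sq_nonneg _)
    (by simpa only [hN] using hlln) (A := fun _ _ => 1) (fun _ => measurable_const)
    (fun _ _ => by simp) s
  simp only [hN, one_mul, integral_const, probReal_univ, one_smul, mul_one] at key
  have key2 := key.add_const (Complex.exp (-((s ^ 2 * ∫ a, h a ^ 2 ∂l : ℝ) : ℂ) / 2))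
  simp only [sub_add_cancel, zero_add] at key2
  refine key2.congr fun n => ?_
  refine integral_comp_measurePreserving (hmp n) (g := fun a : Fin n → α =>
    Complex.exp ((s * ((√n)⁻¹ * ∑ j, h (a j)) : ℝ) * Complex.I)) ?_
  exact (by fun_prop : Measurable _).aestronglyMeasurable

end CentralLimit

/-! ### The central limit theorem for the rank statistic. -/

section RankStatistic

variable (ν : Measure ℝ) [IsProbabilityMeasure ν] [NullSingletonClass ν]
variable {β : Type*} [MeasurableSpace β] (b : Measure β) [IsProbabilityMeasure b]
variable (q : ℝ × β → ℝ)

/-- The normalized sum of the rank differences of neighbours. -/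
noncomputable def rankStat {n : ℕ} (z : Fin n → ℝ × β) : ℝ :=
  √n / ((n : ℝ) ^ 2 - 1) * adjSum Finset.univ (fun i => (z i).1) (fun i j =>
    |rankOf Finset.univ (fun l => q (z l)) (q (z i)) -
      rankOf Finset.univ (fun l => q (z l)) (q (z j))|)

/-- The conditional mean of the linear part given the covariate. -/
noncomputable def linMean (x : ℝ) : ℝ := ∫ w, linPart ν b q (x, w) ∂b

/-- The fluctuation of the linear part around its conditional mean. -/
noncomputable def linFluct (z : ℝ × β) : ℝ := linPart ν b q z - linMean ν b q z.1

/-- The asymptotic variance of `rankStat`. -/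
noncomputable def rankVar : ℝ :=
  ∫ x, (linMean ν b q x - ∫ z, linPart ν b q z ∂(ν.prod b)) ^ 2 ∂ν +
    (∫ z, linFluct ν b q z ^ 2 ∂(ν.prod b) + ∫ x, degVar b (level ν b q) x ∂ν)

lemma norm_integral_exp_sub_le {α : Type*} [MeasurableSpace α] {Q : Measure α}
    [IsProbabilityMeasure Q] {f g : α → ℝ} (hf : Measurable f) (hg : Measurable g)
    (hi : Integrable (fun a => f a - g a) Q) (s : ℝ) :
    ‖∫ a, Complex.exp ((s * f a : ℝ) * Complex.I) ∂Q -
      ∫ a, Complex.exp ((s * g a : ℝ) * Complex.I) ∂Q‖ ≤ |s| * ∫ a, |f a - g a| ∂Q := by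
  have hfi {f : α → ℝ} (hf : Measurable f) :
      Integrable (fun a => Complex.exp ((s * f a : ℝ) * Complex.I)) Q :=
    Integrable.of_bound (by fun_prop : Measurable _).aestronglyMeasurable 1
      (ae_of_all _ fun a => (Complex.norm_exp_ofReal_mul_I _).le)
  rw [← integral_sub (hfi hf) (hfi hg), ← integral_const_mul]
  refine (norm_integral_le_integral_norm _).trans ?_
  refine integral_mono_of_nonneg (ae_of_all _ fun _ => norm_nonneg _) (hi.abs.const_mul _)
    (ae_of_all _ fun a => ?_)
  have e : Complex.exp ((s * f a : ℝ) * Complex.I) - Complex.exp ((s * g a : ℝ) * Complex.I) =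
      Complex.exp ((s * g a : ℝ) * Complex.I) *
        (Complex.exp (Complex.I * (s * (f a - g a) : ℝ)) - 1) := by
    rw [mul_sub, ← Complex.exp_add, mul_one]
    congr 2
    push_cast
    ring
  simp only
  rw [e, norm_mul, Complex.norm_exp_ofReal_mul_I, one_mul, ← abs_mul]
  exact Real.norm_exp_I_mul_ofReal_sub_one_le

variable {q} (hq : Measurable q)

include hq in
lemma measurable_linMean : Measurable (linMean ν b q) :=
  (StronglyMeasurable.integral_prod_right (f := fun x w => linPart ν b q (x, w))
    (measurable_linPart ν b hq).stronglyMeasurable).measurable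

include hq in
lemma abs_linMean_le (x : ℝ) : |linMean ν b q x| ≤ 3 :=
  norm_integral_le_of_bound fun _ => abs_linPart_le ν b hq _

include hq in
lemma integrable_linPart_section (x : ℝ) : Integrable (fun w => linPart ν b q (x, w)) b :=
  Integrable.of_bound ((measurable_linPart ν b hq).comp
    (by fun_prop : Measurable fun w : β => (x, w))).aestronglyMeasurable 3
    (ae_of_all _ fun _ => abs_linPart_le ν b hq _)

include hq in
lemma integrable_linPart : Integrable (linPart ν b q) (ν.prod b) :=
  Integrable.of_bound (measurable_linPart ν b hq).aestronglyMeasurable 3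
    (ae_of_all _ fun _ => abs_linPart_le ν b hq _)

include hq in
lemma measurable_linFluct : Measurable (linFluct ν b q) := by
  have h1 := measurable_linMean ν b hq
  have h2 := measurable_linPart ν b hq
  unfold linFluct
  fun_prop

include hq in
lemma abs_linFluct_le (z : ℝ × β) : |linFluct ν b q z| ≤ 6 :=
  (abs_sub _ _).trans (by linarith [abs_linPart_le ν b hq z, abs_linMean_le ν b hq z.1])

include hq in
lemma integral_linFluct (x : ℝ) : ∫ w, linFluct ν b q (x, w) ∂b = 0 := by
  change ∫ w, (linPart ν b q (x, w) - linMean ν b q x) ∂b = 0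
  rw [integral_sub (integrable_linPart_section ν b hq x) (integrable_const _)]
  simp [linMean]

include hq in
lemma integral_adjSum_degDist (n : ℕ) :
    ∫ z, adjSum Finset.univ (fun i => (z i).1) (fun i j => degDist b (level ν b q) (z i) (z j))
      ∂(Measure.pi fun _ : Fin n => ν.prod b) = 0 := by
  have hl := measurable_level ν b hq
  have l0 (z : ℝ × β) : 0 ≤ level ν b q z := respCdf_nonneg ν b q _
  have l1 (z : ℝ × β) : level ν b q z ≤ 1 := respCdf_le_one ν b q _
  rw [integral_adjSum_pair ν b (measurable_degDist b hl) (B := 2)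
    (fun z z' => abs_degDist_le b hl l0 l1 z z')]
  simp [integral_degDist_right b hl l0 l1, adjSum]

include hq in
-- Up to the remainder, the centred statistic is an iid sum in the covariates plus a martingale sum
-- in the noise. Given the covariates, the latter has a limit that does not depend on them, so the
-- characteristic function factorizes asymptotically and the variances add.
theorem tendsto_charFun_rankStat (s : ℝ) :
    Tendsto (fun n : ℕ => ∫ z, Complex.exp ((s * (rankStat q z - ∫ z', rankStat q z'
        ∂(Measure.pi fun _ : Fin n => ν.prod b)) : ℝ) * Complex.I)
      ∂(Measure.pi fun _ : Fin n => ν.prod b)) atTop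
      (𝓝 (Complex.exp (-((s ^ 2 * rankVar ν b q : ℝ) : ℂ) / 2))) := by
  have hl := measurable_level ν b hq
  have l0 (z : ℝ × β) : 0 ≤ level ν b q z := respCdf_nonneg ν b q _
  have l1 (z : ℝ × β) : level ν b q z ≤ 1 := respCdf_le_one ν b q _
  have hdeg := measurable_degDist b hl
  have hlin := measurable_linPart ν b hq
  have hmean := measurable_linMean ν b hq
  set m := ∫ z, linPart ν b q z ∂(ν.prod b) with hm
  set h : ℝ → ℝ := fun x => linMean ν b q x - m with hh
  have hhm : Measurable h := by fun_prop
  have hm3 : |m| ≤ 3 := norm_integral_le_of_bound fun _ => abs_linPart_le ν b hq _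
  have hhB (x : ℝ) : |h x| ≤ 6 :=
    (abs_sub _ _).trans (by linarith [abs_linMean_le ν b hq x])
  have hmi : ∫ x, linMean ν b q x ∂ν = m := (integral_prod _ (integrable_linPart ν b hq)).symm
  have hmint : Integrable (linMean ν b q) ν := Integrable.of_bound hmean.aestronglyMeasurable 3
    (ae_of_all _ fun _ => abs_linMean_le ν b hq _)
  have hh0 : ∫ x, h x ∂ν = 0 := by
    simp only [hh]
    rw [integral_sub hmint (integrable_const _), hmi]
    simp
  set V := ∫ z, linFluct ν b q z ^ 2 ∂(ν.prod b) + ∫ x, degVar b (level ν b q) x ∂ν with hV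
  have hV0 : 0 ≤ V := add_nonneg (integral_nonneg fun _ => sq_nonneg _)
    (integral_nonneg fun _ => degVar_nonneg b _)
  -- The exponential of the iid part depends on the covariates only and so can be carried through
  -- the martingale theorem.
  set A : (n : ℕ) → (Fin n → ℝ) → ℂ := fun n x =>
    Complex.exp ((s * ((√n)⁻¹ * ∑ j, h (x j)) : ℝ) * Complex.I) with hA
  have hmart := tendsto_charFun_neighbourTerm ν b (measurable_linFluct ν b hq) hdeg (B := 6)
    (abs_linFluct_le ν b hq) (fun z z' => (abs_degDist_le b hl l0 l1 z z').trans (by norm_num))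
    (integral_linFluct ν b hq) (integral_degDist_right b hl l0 l1) hV0
    (tendsto_sum_neighbourTerm_sq ν b hl l0 l1 (measurable_linFluct ν b hq) (abs_linFluct_le ν b hq))
    (A := A) (fun n => by simp only [hA]; fun_prop)
    (fun n x => (Complex.norm_exp_ofReal_mul_I _).le) s
  have hiid := tendsto_charFun_sum ν hhm hhB hh0 s
  have hfull := hmart.add (hiid.const_mul (Complex.exp (-((s ^ 2 * V : ℝ) : ℂ) / 2)))
  have hexp : Complex.exp (-((s ^ 2 * V : ℝ) : ℂ) / 2) *
      Complex.exp (-((s ^ 2 * ∫ a, h a ^ 2 ∂ν : ℝ) : ℂ) / 2) =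
      Complex.exp (-((s ^ 2 * rankVar ν b q : ℝ) : ℂ) / 2) := by
    rw [← Complex.exp_add, rankVar]
    congr 1
    simp only [hV, hh]
    push_cast
    ring
  simp only [hA, sub_add_cancel, zero_add, hexp] at hfull
  set L : (n : ℕ) → (Fin n → ℝ × β) → ℝ := fun n z => (√n)⁻¹ *
    (adjSum Finset.univ (fun i => (z i).1) (fun i j => degDist b (level ν b q) (z i) (z j)) +
    ∑ i, linPart ν b q (z i)) with hL
  have hLm (n : ℕ) : Measurable (L n) := by
    simp only [hL, adjSum]
    fun_prop
  have hrm (n : ℕ) : Measurable (remainder ν b q (Finset.univ : Finset (Fin n))) :=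
    measurable_remainder ν b hq _
  have hdec (n : ℕ) (z : Fin n → ℝ × β) : rankStat q z = L n z + remainder ν b q Finset.univ z := by
    simp only [rankStat, hL, remainder]
    ring
  have hri (n : ℕ) : Integrable (remainder ν b q (Finset.univ : Finset (Fin n)))
      (Measure.pi fun _ => ν.prod b) := Integrable.of_bound (hrm n).aestronglyMeasurable _
        (ae_of_all _ fun z => abs_remainder_le ν b hq _ z)
  have hrL2 (n : ℕ) : MemLp (remainder ν b q (Finset.univ : Finset (Fin n))) 2
      (Measure.pi fun _ => ν.prod b) := MemLp.of_bound (hrm n).aestronglyMeasurable _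
        (ae_of_all _ fun z => abs_remainder_le ν b hq _ z)
  have hai (n : ℕ) : Integrable (fun z : Fin n → ℝ × β => adjSum Finset.univ (fun i => (z i).1)
      (fun i j => degDist b (level ν b q) (z i) (z j))) (Measure.pi fun _ => ν.prod b) := by
    refine Integrable.of_bound (by unfold adjSum; fun_prop : Measurable _).aestronglyMeasurable
      (n * (n * 2)) (ae_of_all _ fun z => ?_)
    have := abs_adjSum_le_sq (s := Finset.univ) (x := fun i => (z i).1)
      (w := fun i j => degDist b (level ν b q) (z i) (z j)) (C := 2)
      fun i j => abs_degDist_le b hl l0 l1 _ _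
    rwa [Fintype.card_fin] at this
  have hii (n : ℕ) (i : Fin n) : Integrable (fun z : Fin n → ℝ × β => linPart ν b q (z i))
      (Measure.pi fun _ => ν.prod b) := by
    refine Integrable.of_bound (by fun_prop : Measurable _).aestronglyMeasurable 3
      (ae_of_all _ fun _ => abs_linPart_le ν b hq _)
  have hLi (n : ℕ) : Integrable (L n) (Measure.pi fun _ => ν.prod b) :=
    ((hai n).add (integrable_finsetSum _ fun i _ => hii n i)).const_mul _
  have hEL (n : ℕ) : ∫ z, L n z ∂(Measure.pi fun _ => ν.prod b) = (√n)⁻¹ * (n * m) := by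
    simp only [hL]
    rw [integral_const_mul, integral_add (hai n) (integrable_finsetSum _ fun i _ => hii n i),
      integral_adjSum_degDist ν b hq, integral_finsetSum _ fun i _ => hii n i, zero_add]
    have (i : Fin n) : ∫ z, linPart ν b q (z i) ∂(Measure.pi fun _ : Fin n => ν.prod b) = m :=
      integral_comp_measurePreserving (measurePreserving_eval (fun _ : Fin n => ν.prod b) i)
        hlin.aestronglyMeasurable
    simp [this]
  have hE (n : ℕ) : ∫ z, rankStat q z ∂(Measure.pi fun _ : Fin n => ν.prod b) = (√n)⁻¹ * (n * m) +
      ∫ z, remainder ν b q Finset.univ z ∂(Measure.pi fun _ : Fin n => ν.prod b) := by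
    simp only [hdec]
    rw [integral_add (hLi n) (hri n), hEL]
  have hmain (n : ℕ) : ∫ z, Complex.exp ((s * (L n z - (√n)⁻¹ * (n * m)) : ℝ) * Complex.I)
      ∂(Measure.pi fun _ : Fin n => ν.prod b) = ∫ z, Complex.exp
        ((s * ((√n)⁻¹ * ∑ j, h (z j).1) : ℝ) * Complex.I) * Complex.exp
        ((s * ((√n)⁻¹ * ∑ j, neighbourTerm (linFluct ν b q) (degDist b (level ν b q)) z j) : ℝ) *
          Complex.I) ∂(Measure.pi fun _ : Fin n => ν.prod b) := by
    refine integral_congr_ae (ae_of_all _ fun z => ?_)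
    simp only
    rw [← Complex.exp_add, sum_neighbourTerm]
    congr 1
    rw [← add_mul, ← Complex.ofReal_add, ← mul_add, ← mul_add]
    congr 4
    simp only [hL, hh, linFluct, Finset.sum_sub_distrib, Finset.sum_const, Finset.card_univ,
      Fintype.card_fin, nsmul_eq_mul]
    ring
  have hvar := (tendsto_variance_remainder ν b hq)
  have hsqrt := ((Real.continuous_sqrt.tendsto _).comp hvar).const_mul |s|
  simp only [Real.sqrt_zero, mul_zero, Function.comp_def] at hsqrt
  -- Characteristic functions differ by at most `|s|` times the `L¹`-distance, here at most the
  -- standard deviation of the remainder.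
  have hdiff : Tendsto (fun n : ℕ => (∫ z, Complex.exp ((s * (rankStat q z - ∫ z', rankStat q z'
        ∂(Measure.pi fun _ : Fin n => ν.prod b)) : ℝ) * Complex.I)
      ∂(Measure.pi fun _ : Fin n => ν.prod b)) -
      ∫ z, Complex.exp ((s * (L n z - (√n)⁻¹ * (n * m)) : ℝ) * Complex.I)
      ∂(Measure.pi fun _ : Fin n => ν.prod b)) atTop (𝓝 0) := by
    refine squeeze_zero_norm (fun n => ?_) hsqrt
    have e (z : Fin n → ℝ × β) : rankStat q z - ∫ z', rankStat q z'
        ∂(Measure.pi fun _ : Fin n => ν.prod b) - (L n z - (√n)⁻¹ * (n * m)) =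
        remainder ν b q Finset.univ z - ∫ z, remainder ν b q Finset.univ z
          ∂(Measure.pi fun _ : Fin n => ν.prod b) := by
      rw [hE, hdec]
      ring
    have hrs : Measurable fun z : Fin n → ℝ × β => rankStat q z := by
      simp only [hdec]
      exact (hLm n).add (hrm n)
    refine (norm_integral_exp_sub_le (hrs.sub_const _) ((hLm n).sub_const _) ?_ s).trans ?_
    · simp only [e]
      exact (hri n).sub (integrable_const _)
    · simp only [e]
      exact mul_le_mul_of_nonneg_left (integral_abs_sub_integral_le (hrL2 n)) (abs_nonneg _)
  have := hdiff.add hfull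
  rw [zero_add] at this
  refine this.congr fun n => ?_
  rw [hmain]
  ring

end RankStatistic

/-! ### Positivity of the limit variance. -/

section PositiveVariance

/-- An atomless distribution is concentrated on a set on which its distribution function is
injective. -/
lemma exists_injOn_cdf (μ : Measure ℝ) [IsProbabilityMeasure μ] [NullSingletonClass μ] :
    ∃ G ∈ ae μ, Set.InjOn (fun a => μ.real (Set.Iic a)) G := by
  -- These are the support points lying at the left end of a gap of the support. Each rational
  -- contributes at most one, so they form a countable and hence null set.
  set E : Set ℝ := ⋃ r : ℚ, {y | IsGreatest (μ.support ∩ Set.Iic (r : ℝ)) y} with hE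
  have hEc : E.Countable := by
    refine Set.countable_iUnion fun r => Set.Subsingleton.countable ?_
    intro y hy y' hy'
    exact hy.unique hy'
  have hE0 : Eᶜ ∈ ae μ := by
    rw [mem_ae_iff, compl_compl]
    exact hEc.measure_zero μ
  refine ⟨μ.support ∩ Eᶜ, inter_mem Measure.support_mem_ae hE0, ?_⟩
  -- If the distribution function agrees at `y < y'`, then no support point lies strictly between
  -- them, so `y` is the greatest support point below a rational in between and belongs to `E`.
  have key : ∀ y ∈ μ.support ∩ Eᶜ, ∀ y', y < y' → μ.real (Set.Iic y) ≠ μ.real (Set.Iic y') := by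
    intro y hy y' hlt heq
    obtain ⟨r, hr1, hr2⟩ := exists_rat_btwn hlt
    refine hy.2 (Set.mem_iUnion.2 ⟨r, ⟨hy.1, hr1.le⟩, fun v hv => ?_⟩)
    by_contra hyv
    push Not at hyv
    have hpos := (Measure.mem_support_iff_forall v).1 hv.1 (Set.Ioo y y')
      (Ioo_mem_nhds hyv (lt_of_le_of_lt hv.2 hr2))
    have hnull : μ.real (Set.Ioc y y') = 0 := by
      rw [← Set.Iic_sdiff_Iic, measureReal_sdiff (Set.Iic_subset_Iic.2 hlt.le) measurableSet_Iic, heq,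
        sub_self]
    rw [measureReal_eq_zero_iff] at hnull
    exact hpos.ne' (measure_mono_null Set.Ioo_subset_Ioc_self hnull)
  intro y hy y' hy' h
  rcases lt_trichotomy y y' with hlt | heq | hgt
  · exact absurd h (key y hy y' hlt)
  · exact heq
  · exact absurd h.symm (key y' hy' y hgt)

variable {β : Type*} [MeasurableSpace β] (b : Measure β) [IsProbabilityMeasure b]

/-- The distance is a degenerate kernel, up to functions of one of the two variables, only
for constant variables. -/
lemma ae_eq_of_ae_degenerate {f : β → ℝ} (hf : Measurable f) (h0 : ∀ w, 0 ≤ f w) (h1 : ∀ w, f w ≤ 1)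
    (h : ∀ᵐ u ∂b.prod b, |f u.1 - f u.2| - ∫ w, |f w - f u.1| ∂b - ∫ w, |f w - f u.2| ∂b +
      ∫ w', ∫ w, |f w - f w'| ∂b ∂b = 0) :
    ∀ᵐ u ∂b.prod b, f u.1 = f u.2 := by
  have hb (w w' : β) : |f w - f w'| ≤ 1 := by
    rw [abs_le]; constructor <;> linarith [h0 w, h0 w', h1 w, h1 w']
  have hbi (a : ℝ) : Integrable (fun w => |f w - a|) b := by
    refine Integrable.of_bound (by fun_prop : Measurable _).aestronglyMeasurable (1 + |a|)
      (ae_of_all _ fun w => ?_)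
    rw [Real.norm_eq_abs, abs_abs]
    refine (abs_sub _ _).trans (add_le_add_left ?_ _)
    rw [abs_of_nonneg (h0 w)]
    exact h1 w
  set e : ℝ → ℝ := fun a => ∫ w, |f w - a| ∂b with he
  have hlip : LipschitzWith 1 e := by
    refine LipschitzWith.of_dist_le_mul fun a a' => ?_
    rw [Real.dist_eq, Real.dist_eq, NNReal.coe_one, one_mul]
    simp only [he]
    rw [← integral_sub (hbi a) (hbi a')]
    refine norm_integral_le_of_bound fun w => ?_
    refine (abs_abs_sub_abs_le _ _).trans (le_of_eq ?_)
    rw [sub_sub_sub_cancel_left, abs_sub_comm]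
  set φ := ∫ w', ∫ w, |f w - f w'| ∂b ∂b with hφ
  set μ := b.map f with hμ
  have : IsProbabilityMeasure μ := Measure.isProbabilityMeasure_map hf.aemeasurable
  set G : ℝ × ℝ → ℝ := fun u => |u.1 - u.2| - e u.1 - e u.2 + φ with hG
  have hGc : Continuous G := by
    have := hlip.continuous
    simp only [hG]
    fun_prop
  have hG0 : (μ.prod μ) {u | G u ≠ 0} = 0 := by
    rw [hμ, Measure.map_prod_map b b hf hf, Measure.map_apply (by fun_prop)
      (isOpen_ne_fun hGc continuous_const).measurableSet]
    exact h
  -- The diagonal may be a null set, but `G` is continuous and vanishes almost everywhere for the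
  -- product measure, hence on all of the product of the supports.
  have hdiag : ∀ a ∈ μ.support, G (a, a) = 0 := by
    intro a ha
    by_contra hne
    have hopen : {u | G u ≠ 0} ∈ 𝓝 (a, a) := (isOpen_ne_fun hGc continuous_const).mem_nhds hne
    rw [nhds_prod_eq, mem_prod_iff] at hopen
    obtain ⟨U, hU, U', hU', hsub⟩ := hopen
    have h1 := (Measure.mem_support_iff_forall a).1 ha U hU
    have h2 := (Measure.mem_support_iff_forall a).1 ha U' hU'
    have h3 := measure_mono_null hsub hG0
    rw [Measure.prod_prod] at h3
    exact (mul_ne_zero h1.ne' h2.ne') h3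
  have hae : ∀ᵐ w ∂b, e (f w) = φ / 2 := by
    have : ∀ᵐ a ∂μ, e a = φ / 2 := by
      filter_upwards [Measure.support_mem_ae (μ := μ)] with a ha
      have := hdiag a ha
      simp only [hG, sub_self, abs_zero] at this
      linarith
    exact ae_of_ae_map hf.aemeasurable this
  -- On the diagonal the distance is zero, so the mean distance `e` is almost everywhere `φ / 2`,
  -- while its mean is `φ`.
  have hφ0 : φ = 0 := by
    have h2 : φ = φ / 2 := by
      conv_lhs => rw [hφ]
      rw [integral_congr_ae (g := fun _ => φ / 2) hae]
      simp
    linarith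
  have hm : Measurable fun u : β × β => |f u.1 - f u.2| := by fun_prop
  have hint : Integrable (fun u : β × β => |f u.1 - f u.2|) (b.prod b) :=
    Integrable.of_bound hm.aestronglyMeasurable 1 (ae_of_all _ fun u => by
      rw [Real.norm_eq_abs, abs_abs]
      exact hb _ _)
  have hz : ∫ u, |f u.1 - f u.2| ∂(b.prod b) = 0 := by
    rw [integral_prod_symm _ hint]
    exact hφ0
  rw [integral_eq_zero_iff_of_nonneg (fun u => abs_nonneg _) hint] at hz
  filter_upwards [hz] with u hu
  exact sub_eq_zero.1 (abs_eq_zero.1 hu)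

variable (ν : Measure ℝ) [IsProbabilityMeasure ν] {q : ℝ × β → ℝ} (hq : Measurable q)

lemma ae_level_eq_of_degVar_eq_zero {p : ℝ × β → ℝ} (hp : Measurable p) (hp0 : ∀ z, 0 ≤ p z)
    (hp1 : ∀ z, p z ≤ 1) {x : ℝ} (h : degVar b p x = 0) :
    ∀ᵐ u ∂b.prod b, p (x, u.1) = p (x, u.2) := by
  have hm := measurable_degDist_section b hp x x
  have hint : Integrable (fun u : β × β => degDist b p (x, u.1) (x, u.2) ^ 2) (b.prod b) := by
    refine Integrable.of_bound (hm.pow_const 2).aestronglyMeasurable 4 (ae_of_all _ fun u => ?_)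
    rw [Real.norm_eq_abs, abs_of_nonneg (sq_nonneg _)]
    exact degDist_sq_le b hp hp0 hp1 _ _
  have hz : ∫ u, degDist b p (x, u.1) (x, u.2) ^ 2 ∂(b.prod b) = 0 := by
    rw [integral_prod _ hint]
    exact h
  rw [integral_eq_zero_iff_of_nonneg (fun u => sq_nonneg _) hint] at hz
  refine ae_eq_of_ae_degenerate b (f := fun w => p (x, w)) (by fun_prop) (fun _ => hp0 _)
    (fun _ => hp1 _) ?_
  filter_upwards [hz] with u hu
  exact pow_eq_zero_iff two_ne_zero |>.1 hu

include hq in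
/-- If the degenerate part vanishes, then the response is a function of the covariate. -/
lemma exists_ae_eq_of_integral_degVar_eq_zero [NullSingletonClass ((ν.prod b).map q)]
    (h : ∫ x, degVar b (level ν b q) x ∂ν = 0) :
    ∃ w₀, ∀ᵐ z ∂ν.prod b, q z = q (z.1, w₀) := by
  have hl := measurable_level ν b hq
  have l0 (z : ℝ × β) : 0 ≤ level ν b q z := respCdf_nonneg ν b q _
  have l1 (z : ℝ × β) : level ν b q z ≤ 1 := respCdf_le_one ν b q _
  have hdi : Integrable (degVar b (level ν b q)) ν :=
    Integrable.of_bound (measurable_degVar b hl).aestronglyMeasurable 4 (ae_of_all _ fun x => by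
      rw [Real.norm_eq_abs, abs_of_nonneg (degVar_nonneg b x)]
      exact degVar_le b hl l0 l1 x)
  rw [integral_eq_zero_iff_of_nonneg (fun x => degVar_nonneg b x) hdi] at h
  have : IsProbabilityMeasure ((ν.prod b).map q) := Measure.isProbabilityMeasure_map hq.aemeasurable
  -- Vanishing degenerate variance only makes the levels constant given the covariate. Outside a
  -- null set a level determines the response.
  obtain ⟨G, hG, hinj⟩ := exists_injOn_cdf ((ν.prod b).map q)
  have hGq : ∀ᵐ z ∂ν.prod b, q z ∈ G := ae_of_ae_map hq.aemeasurable hG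
  have hGq' := Measure.ae_ae_of_ae_prod hGq
  have hcdf (z z' : ℝ × β) (he : level ν b q z = level ν b q z') (h1 : q z ∈ G) (h2 : q z' ∈ G) :
      q z = q z' := by
    refine hinj h1 h2 ?_
    simp only
    rw [map_measureReal_apply hq measurableSet_Iic, map_measureReal_apply hq measurableSet_Iic]
    exact he
  have hx : ∀ᵐ x ∂ν, ∀ᵐ u ∂b.prod b, q (x, u.1) = q (x, u.2) := by
    filter_upwards [h, hGq'] with x hx1 hx2
    have h1 : ∀ᵐ u ∂b.prod b, q (x, u.1) ∈ G :=
      Measure.quasiMeasurePreserving_fst.ae hx2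
    have h2 : ∀ᵐ u ∂b.prod b, q (x, u.2) ∈ G :=
      Measure.quasiMeasurePreserving_snd.ae hx2
    filter_upwards [ae_level_eq_of_degVar_eq_zero b hl l0 l1 hx1, h1, h2] with u hu hu1 hu2
    exact hcdf _ _ hu hu1 hu2
  have hms : MeasurableSet {t : ℝ × (β × β) | q (t.1, t.2.1) = q (t.1, t.2.2)} :=
    measurableSet_eq_fun (by fun_prop) (by fun_prop)
  have h3 : ∀ᵐ t ∂ν.prod (b.prod b), q (t.1, t.2.1) = q (t.1, t.2.2) :=
    (Measure.ae_prod_iff_ae_ae hms).2 hx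
  have hmp : MeasurePreserving (fun t : (ℝ × β) × β => (t.1.1, (t.1.2, t.2)))
      ((ν.prod b).prod b) (ν.prod (b.prod b)) := measurePreserving_prodAssoc ν b b
  have h4 : ∀ᵐ t ∂(ν.prod b).prod b, q t.1 = q (t.1.1, t.2) := hmp.quasiMeasurePreserving.ae h3
  have hmp2 : MeasurePreserving Prod.swap (b.prod (ν.prod b)) ((ν.prod b).prod b) :=
    Measure.measurePreserving_swap
  have h5 : ∀ᵐ t ∂b.prod (ν.prod b), q t.2 = q (t.2.1, t.1) := hmp2.quasiMeasurePreserving.ae h4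
  -- By Fubini some fixed noise value `w₀` works for almost every observation, and the section at
  -- `w₀` is the required function of the covariate.
  exact (Measure.ae_ae_of_ae_prod h5).exists

include hq in
theorem rankVar_pos [NullSingletonClass ((ν.prod b).map q)]
    (hdep : ¬ ∃ g : ℝ → ℝ, Measurable g ∧ ∀ᵐ z ∂ν.prod b, q z = g z.1) : 0 < rankVar ν b q := by
  have h1 : 0 ≤ ∫ x, (linMean ν b q x - ∫ z, linPart ν b q z ∂(ν.prod b)) ^ 2 ∂ν :=
    integral_nonneg fun _ => sq_nonneg _
  have h2 : 0 ≤ ∫ z, linFluct ν b q z ^ 2 ∂(ν.prod b) := integral_nonneg fun _ => sq_nonneg _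
  have h3 : 0 ≤ ∫ x, degVar b (level ν b q) x ∂ν := integral_nonneg fun _ => degVar_nonneg b _
  have h4 : ∫ x, degVar b (level ν b q) x ∂ν ≠ 0 := fun h => by
    obtain ⟨w₀, hw⟩ := exists_ae_eq_of_integral_degVar_eq_zero b ν hq h
    exact hdep ⟨fun x => q (x, w₀), by fun_prop, hw⟩
  have := lt_of_le_of_ne h3 h4.symm
  unfold rankVar
  linarith

end PositiveVariance

/-! ### Measurability and bounds of the coefficient, and its form without ties. -/

section Coefficient

variable {n : ℕ}

lemma natCard_setOf_eq_sum (p : Fin n → Prop) [DecidablePred p] :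
    (Nat.card {j : Fin n // p j} : ℝ) = ∑ j, if p j then 1 else 0 := by
  rw [Nat.card_eq_fintype_card, Fintype.card_subtype, Finset.sum_boole]

lemma rank_eq_rankOf (y : Fin n → ℝ) (i : Fin n) : (rank y i : ℝ) = rankOf Finset.univ y (y i) := by
  classical
  exact natCard_setOf_eq_sum fun j => y j ≤ y i

lemma upperRank_eq_sum (y : Fin n → ℝ) (i : Fin n) :
    (upperRank y i : ℝ) = ∑ j, below (y j) (y i) := by
  classical
  exact natCard_setOf_eq_sum fun j => y i ≤ y j

@[fun_prop]
lemma measurable_rank (i : Fin n) : Measurable fun y : Fin n → ℝ => (rank y i : ℝ) := by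
  simp only [rank_eq_rankOf, rankOf]
  fun_prop

@[fun_prop]
lemma measurable_upperRank (i : Fin n) : Measurable fun y : Fin n → ℝ => (upperRank y i : ℝ) := by
  simp only [upperRank_eq_sum]
  fun_prop

lemma measurable_rankVariation : Measurable fun y : Fin n → ℝ => rankVariation y := by
  unfold rankVariation
  refine Finset.measurable_fun_sum _ fun i _ => ?_
  by_cases h : i.val + 1 < n
  · simp only [h, dif_pos]
    have h1 := measurable_rank (⟨i.val + 1, h⟩ : Fin n)
    have h2 := measurable_rank i
    exact (h1.sub h2).abs
  · simp [h]

lemma measurableSet_injective : MeasurableSet {y : Fin n → ℝ | Function.Injective y} := by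
  have : {y : Fin n → ℝ | Function.Injective y} =
      ⋂ i, ⋂ j, {y | y i = y j → i = j} := by
    ext y
    simp [Function.Injective]
  rw [this]
  refine MeasurableSet.iInter fun i => MeasurableSet.iInter fun j => ?_
  by_cases h : i = j
  · simp [h]
  · simp only [h, imp_false]
    exact (measurableSet_eq_fun (by fun_prop) (by fun_prop)).compl

lemma measurable_xiOrdered : Measurable fun y : Fin n → ℝ => xiOrdered y := by
  classical
  have h1 := measurable_rankVariation (n := n)
  unfold xiOrdered
  refine Measurable.ite measurableSet_injective (by fun_prop) ?_
  refine Measurable.const_sub (Measurable.div (by fun_prop) (Measurable.const_mul ?_ _)) _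
  refine Finset.measurable_fun_sum _ fun i _ => ?_
  have h2 := measurable_upperRank i
  fun_prop

/-- Labels are distinct, so the lexicographic keys are distinct and the stability clause
characterizing `Tuple.sort` is vacuous. -/
lemma sortOrder_eq_iff (x : Fin n → ℝ) (τ σ : Equiv.Perm (Fin n)) :
    sortOrder x τ = σ ↔ ∀ i j, i ≤ j → x (σ i) < x (σ j) ∨
      x (σ i) = x (σ j) ∧ τ (σ i) ≤ τ (σ j) := by
  unfold sortOrder
  rw [eq_comm, Tuple.eq_sort_iff]
  constructor
  · rintro ⟨h, -⟩ i j hij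
    exact Prod.Lex.toLex_le_toLex.1 (h hij)
  · intro h
    refine ⟨fun i j hij => Prod.Lex.toLex_le_toLex.2 (h i j hij), fun i j hij he => ?_⟩
    have h2 : (x (σ i), τ (σ i)) = (x (σ j), τ (σ j)) := toLex.injective he
    have h3 : i = j := by simpa using congrArg Prod.snd h2
    exact absurd h3 hij.ne

lemma measurable_xi (τ : Equiv.Perm (Fin n)) : Measurable fun z : Fin n → ℝ × ℝ => xi z τ := by
  classical
  have hset (σ : Equiv.Perm (Fin n)) :
      MeasurableSet {z : Fin n → ℝ × ℝ | sortOrder (fun j => (z j).1) τ = σ} := by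
    have : {z : Fin n → ℝ × ℝ | sortOrder (fun j => (z j).1) τ = σ} =
        ⋂ i, ⋂ j, {z | i ≤ j → (z (σ i)).1 < (z (σ j)).1 ∨
          (z (σ i)).1 = (z (σ j)).1 ∧ τ (σ i) ≤ τ (σ j)} := by
      ext z
      simp [sortOrder_eq_iff]
    rw [this]
    refine MeasurableSet.iInter fun i => MeasurableSet.iInter fun j => ?_
    have hf (k : Fin n) : Measurable fun z : Fin n → ℝ × ℝ => (z k).1 := by fun_prop
    by_cases h : i ≤ j
    · simp only [h, true_imp_iff]
      exact (measurableSet_lt (hf (σ i)) (hf (σ j))).union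
        ((measurableSet_eq_fun (hf (σ i)) (hf (σ j))).inter (MeasurableSet.const _))
    · simp [h]
  -- Only finitely many arrangements are possible, and on the event that a given one occurs the
  -- coefficient is a function of permuted responses.
  have heq : (fun z : Fin n → ℝ × ℝ => xi z τ) = fun z => ∑ σ : Equiv.Perm (Fin n),
      if sortOrder (fun j => (z j).1) τ = σ then xiOrdered (fun i => (z (σ i)).2) else 0 := by
    funext z
    simp [xi]
  rw [heq]
  refine Finset.measurable_fun_sum _ fun σ _ => Measurable.ite (hset σ) ?_ measurable_const
  exact measurable_xiOrdered.comp (by fun_prop)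

/-- A nonzero integer has modulus at least one, and division by zero gives zero. As both
denominators of the coefficient are integers, it is bounded for each `n`, which is all that
integrability needs. -/
lemma abs_div_intCast_le (a : ℝ) (k : ℤ) : |a / k| ≤ |a| := by
  rcases eq_or_ne k 0 with rfl | hk
  · simp
  · rw [abs_div]
    refine div_le_self (abs_nonneg _) ?_
    exact_mod_cast Int.one_le_abs hk

lemma abs_rankVariation_le (y : Fin n → ℝ) : |rankVariation y| ≤ n * n := by
  unfold rankVariation
  refine (Finset.abs_sum_le_sum_abs _ _).trans ((Finset.sum_le_card_nsmul _ _ (n : ℝ)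
    fun i _ => ?_).trans (by simp))
  split_ifs with h
  · rw [abs_abs, rank_eq_rankOf, rank_eq_rankOf]
    simpa using abs_rankOf_sub_le_card Finset.univ y _ _
  · simp

lemma abs_xiOrdered_le (y : Fin n → ℝ) : |xiOrdered y| ≤ 1 + (3 + n) * (n * n) := by
  have h := abs_rankVariation_le y
  have hn : (0 : ℝ) ≤ n := Nat.cast_nonneg n
  unfold xiOrdered
  split_ifs
  · refine (abs_sub _ _).trans (add_le_add (by simp) ?_)
    have : (n : ℝ) ^ 2 - 1 = (((n : ℤ) ^ 2 - 1 : ℤ) : ℝ) := by push_cast; ring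
    rw [this]
    refine (abs_div_intCast_le _ _).trans ?_
    rw [abs_mul, abs_of_pos (by norm_num : (0 : ℝ) < 3)]
    nlinarith [abs_nonneg (rankVariation y)]
  · refine (abs_sub _ _).trans (add_le_add (by simp) ?_)
    have : 2 * ∑ i : Fin n, (upperRank y i : ℝ) * ((n : ℝ) - (upperRank y i : ℝ)) =
        ((2 * ∑ i : Fin n, (upperRank y i : ℤ) * ((n : ℤ) - (upperRank y i : ℤ)) : ℤ) : ℝ) := by
      push_cast
      ring
    rw [this]
    refine (abs_div_intCast_le _ _).trans ?_
    rw [abs_mul, abs_of_nonneg hn]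
    nlinarith [abs_nonneg (rankVariation y)]

lemma abs_xi_le (z : Fin n → ℝ × ℝ) (τ : Equiv.Perm (Fin n)) :
    |xi z τ| ≤ 1 + (3 + n) * (n * n) := abs_xiOrdered_le _

lemma rank_comp (y : Fin n → ℝ) (σ : Equiv.Perm (Fin n)) (i : Fin n) :
    (rank (fun i => y (σ i)) i : ℝ) = rankOf Finset.univ y (y (σ i)) := by
  rw [rank_eq_rankOf]
  exact Equiv.sum_comp σ fun j => below (y (σ i)) (y j)

lemma adj_sorted {x : Fin n → ℝ} {σ : Equiv.Perm (Fin n)} (h : StrictMono fun i => x (σ i))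
    (i j : Fin n) : Adj Finset.univ x (σ i) (σ j) ↔ i.val + 1 = j.val := by
  have hlt (i j : Fin n) : x (σ i) < x (σ j) ↔ i < j := h.lt_iff_lt
  have hle (i j : Fin n) : x (σ i) ≤ x (σ j) ↔ i ≤ j := h.le_iff_le
  unfold Adj
  constructor
  · rintro ⟨-, -, h1, h2⟩
    rw [hlt] at h1
    by_contra hne
    have hk : i.val + 1 < n := by omega
    have := h2 (σ ⟨i.val + 1, hk⟩) (Finset.mem_univ _)
    simp only [hle, Fin.le_def] at this
    have h1' : i.val < j.val := h1
    omega
  · intro hij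
    refine ⟨Finset.mem_univ _, Finset.mem_univ _, ?_, fun k _ => ?_⟩
    · rw [hlt, Fin.lt_def]
      omega
    · obtain ⟨k, rfl⟩ := σ.surjective k
      simp only [hle, Fin.le_def]
      omega

lemma adjSum_sorted {x : Fin n → ℝ} {σ : Equiv.Perm (Fin n)} (h : StrictMono fun i => x (σ i))
    (w : Fin n → Fin n → ℝ) : adjSum Finset.univ x w =
      ∑ i : Fin n, if h : i.val + 1 < n then w (σ i) (σ ⟨i.val + 1, h⟩) else 0 := by
  unfold adjSum
  rw [← Equiv.sum_comp σ]
  refine Finset.sum_congr rfl fun i _ => ?_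
  rw [← Equiv.sum_comp σ]
  split_ifs with hi
  · rw [Finset.sum_eq_single (⟨i.val + 1, hi⟩ : Fin n)]
    · rw [adjInd_of_adj ((adj_sorted h _ _).2 rfl), one_mul]
    · intro j _ hj
      rw [adjInd_of_not_adj fun ha => hj (Fin.ext ((adj_sorted h _ _).1 ha).symm), zero_mul]
    · simp
  · refine Finset.sum_eq_zero fun j _ => ?_
    rw [adjInd_of_not_adj fun ha => hi (((adj_sorted h _ _).1 ha).trans_lt j.isLt), zero_mul]

/-- Without ties, the coefficient is a sum over neighbouring covariates. -/
lemma xi_eq_adjSum {z : Fin n → ℝ × ℝ} (hx : Function.Injective fun i => (z i).1)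
    (hy : Function.Injective fun i => (z i).2) (τ : Equiv.Perm (Fin n)) :
    xi z τ = 1 - 3 * adjSum Finset.univ (fun i => (z i).1) (fun i j =>
      |rankOf Finset.univ (fun l => (z l).2) (z i).2 -
        rankOf Finset.univ (fun l => (z l).2) (z j).2|) / ((n : ℝ) ^ 2 - 1) := by
  set σ := sortOrder (fun j => (z j).1) τ with hσ
  have hmono : StrictMono fun i => (z (σ i)).1 := by
    refine Monotone.strictMono_of_injective (fun i j hij => ?_) (hx.comp σ.injective)
    rcases (sortOrder_eq_iff (fun j => (z j).1) τ σ).1 rfl i j hij with h | h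
    · exact h.le
    · exact h.1.le
  have hinj : Function.Injective fun i => (z (σ i)).2 := hy.comp σ.injective
  unfold xi xiOrdered
  rw [if_pos hinj, adjSum_sorted (x := fun i => (z i).1) hmono]
  congr 3
  unfold rankVariation
  refine Finset.sum_congr rfl fun i _ => ?_
  split_ifs with h
  · rw [abs_sub_comm]
    congr 2
    · exact rank_comp (fun l => (z l).2) σ i
    · exact rank_comp (fun l => (z l).2) σ ⟨i.val + 1, h⟩
  · rfl

end Coefficient

/-! ### From the plane to covariate and noise: asymptotic normality of the coefficient. -/

section Sample

variable {Ω : Type*} [MeasurableSpace Ω] {P : Measure Ω} [IsProbabilityMeasure P]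

/-- A variable whose joint distribution function with another variable is continuous has no
atoms. -/
lemma nullSingletonClass_map_of_continuous {U V : Ω → ℝ} (hU : Measurable U) (hV : Measurable V)
    (h : ∀ t, Continuous fun s => P.real {ω | U ω ≤ s ∧ V ω ≤ t}) :
    NullSingletonClass (P.map U) := by
  refine ⟨fun a => ?_⟩
  rw [Measure.map_apply hU (measurableSet_singleton a)]
  have hm (s t : ℝ) : MeasurableSet {ω | U ω ≤ s ∧ V ω ≤ t} :=
    (measurableSet_le hU measurable_const).inter (measurableSet_le hV measurable_const)
  have hma (t : ℝ) : MeasurableSet {ω | U ω = a ∧ V ω ≤ t} :=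
    (measurableSet_eq_fun hU measurable_const).inter (measurableSet_le hV measurable_const)
  -- This probability is at most every increment of the joint distribution function in its first
  -- variable up to `a`, hence zero by continuity; `t` then runs through the natural numbers.
  have hz (t : ℝ) : P {ω | U ω = a ∧ V ω ≤ t} = 0 := by
    have hlim : Tendsto (fun s => P.real {ω | U ω ≤ a ∧ V ω ≤ t} - P.real {ω | U ω ≤ s ∧ V ω ≤ t})
        (𝓝[<] a) (𝓝 0) := by
      have := (((h t).tendsto a).mono_left (nhdsWithin_le_nhds (s := Set.Iio a))).const_sub
        (P.real {ω | U ω ≤ a ∧ V ω ≤ t})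
      rwa [sub_self] at this
    have hle : P.real {ω | U ω = a ∧ V ω ≤ t} ≤ 0 := by
      refine ge_of_tendsto hlim ?_
      filter_upwards [self_mem_nhdsWithin] with s hs
      have hs' : s < a := hs
      have hsub : {ω | U ω ≤ s ∧ V ω ≤ t} ⊆ {ω | U ω ≤ a ∧ V ω ≤ t} :=
        fun ω hω => ⟨hω.1.trans hs'.le, hω.2⟩
      rw [← measureReal_sdiff hsub (hm s t)]
      refine measureReal_mono fun ω hω => ⟨⟨hω.1.le, hω.2⟩, fun h' => ?_⟩
      exact absurd (hω.1 ▸ h'.1) (not_le.2 hs')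
    exact (measureReal_eq_zero_iff).1 (le_antisymm hle measureReal_nonneg)
  have hsub : U ⁻¹' {a} ⊆ ⋃ k : ℕ, {ω | U ω = a ∧ V ω ≤ k} := fun ω hω => by
    obtain ⟨k, hk⟩ := exists_nat_ge (V ω)
    exact Set.mem_iUnion.2 ⟨k, hω, hk⟩
  exact measure_mono_null hsub (measure_iUnion_null fun k => hz k)

/-- A law on the plane is the law of `(x, q (x, w))` for a uniformly distributed `w` which is
independent of `x`. -/
lemma exists_measurePreserving_section (μ : Measure (ℝ × ℝ)) [IsProbabilityMeasure μ] :
    ∃ q : ℝ × unitInterval → ℝ, Measurable q ∧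
      MeasurePreserving (fun z => (z.1, q z)) (μ.fst.prod volume) μ := by
  obtain ⟨f, hf, hfκ⟩ := Kernel.exists_measurable_map_eq_unitInterval μ.condKernel
  refine ⟨Function.uncurry f, hf, by fun_prop, ?_⟩
  have hm : Measurable fun z : ℝ × unitInterval => (z.1, Function.uncurry f z) := by fun_prop
  ext s hs
  rw [Measure.map_apply hm hs, Measure.prod_apply (hm hs)]
  conv_rhs => rw [← μ.disintegrate μ.condKernel, Measure.compProd_apply hs]
  refine lintegral_congr fun x => ?_
  rw [← hfκ x, Measure.map_apply (by fun_prop) (measurable_prodMk_left hs)]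
  rfl

variable {X Y : ℕ → Ω → ℝ} (hX : ∀ k, Measurable (X k)) (hY : ∀ k, Measurable (Y k))

include hX hY in
lemma measurable_sample (n : ℕ) : Measurable (sample X Y n) := by
  unfold sample
  exact measurable_pi_lambda _ fun i => (hX i).prodMk (hY i)

include hX hY in
lemma measurePreserving_sample (hindep : iIndepFun (fun k ω => (X k ω, Y k ω)) P)
    (hident : ∀ k, IdentDistrib (fun ω => (X k ω, Y k ω)) (fun ω => (X 0 ω, Y 0 ω)) P P) (n : ℕ) :
    MeasurePreserving (sample X Y n) P
      (Measure.pi fun _ => P.map fun ω => (X 0 ω, Y 0 ω)) := by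
  refine ⟨measurable_sample hX hY n, ?_⟩
  have h1 : iIndepFun (fun (i : Fin n) ω => (X i ω, Y i ω)) P := hindep.precomp Fin.val_injective
  have h2 := (iIndepFun_iff_map_fun_eq_pi_map
    (fun i : Fin n => ((hX i).prodMk (hY i)).aemeasurable)).1 h1
  refine h2.trans ?_
  congr 1
  funext i
  exact (hident i).map_eq

lemma measurable_uncurry_xi {n : ℕ} :
    Measurable fun u : (Fin n → ℝ × ℝ) × Equiv.Perm (Fin n) => xi u.1 u.2 :=
  measurable_from_prod_countable_left fun τ => measurable_xi τ

include hX hY in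
lemma measurable_xiSample {τ : (n : ℕ) → Ω → Equiv.Perm (Fin n)} (hτ : ∀ n, Measurable (τ n))
    (n : ℕ) : Measurable (xiSample X Y τ n) :=
  measurable_uncurry_xi.comp ((measurable_sample hX hY n).prodMk (hτ n))

lemma ae_injective_pi_fst {n : ℕ} (μ : Measure (ℝ × ℝ)) [IsProbabilityMeasure μ]
    [NullSingletonClass μ.fst] :
    ∀ᵐ z ∂Measure.pi fun _ : Fin n => μ, Function.Injective fun i => (z i).1 :=
  (measurePreserving_pi (fun _ : Fin n => μ) (fun _ => μ.fst) (f := fun _ => Prod.fst)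
    fun _ => ⟨measurable_fst, rfl⟩).quasiMeasurePreserving.ae (ae_injective_pi μ.fst)

lemma ae_injective_pi_snd {n : ℕ} (μ : Measure (ℝ × ℝ)) [IsProbabilityMeasure μ]
    [NullSingletonClass μ.snd] :
    ∀ᵐ z ∂Measure.pi fun _ : Fin n => μ, Function.Injective fun i => (z i).2 :=
  (measurePreserving_pi (fun _ : Fin n => μ) (fun _ => μ.snd) (f := fun _ => Prod.snd)
    fun _ => ⟨measurable_snd, rfl⟩).quasiMeasurePreserving.ae (ae_injective_pi μ.snd)

lemma sqrt_mul_xi_eq {n : ℕ} {z : Fin n → ℝ × ℝ} (hx : Function.Injective fun i => (z i).1)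
    (hy : Function.Injective fun i => (z i).2) (τ : Equiv.Perm (Fin n)) :
    √n * xi z τ = √n - 3 * rankStat Prod.snd z := by
  rw [xi_eq_adjSum hx hy, rankStat]
  ring

lemma measurable_rankStat {β : Type*} [MeasurableSpace β] {q : ℝ × β → ℝ} (hq : Measurable q)
    {n : ℕ} : Measurable fun z : Fin n → ℝ × β => rankStat q z := by
  unfold rankStat adjSum rankOf
  fun_prop

/-- The central limit theorem for the coefficient of observations with continuous distribution
function. -/
theorem exists_asympNormal (hX : ∀ k, Measurable (X k)) (hY : ∀ k, Measurable (Y k))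
    (hindep : iIndepFun (fun k ω => (X k ω, Y k ω)) P)
    (hident : ∀ k, IdentDistrib (fun ω => (X k ω, Y k ω)) (fun ω => (X 0 ω, Y 0 ω)) P P)
    {τ : (n : ℕ) → Ω → Equiv.Perm (Fin n)} (hτ : ∀ n, Measurable (τ n))
    (hcont : Continuous (fun p : ℝ × ℝ => P.real {ω | X 0 ω ≤ p.1 ∧ Y 0 ω ≤ p.2}))
    (hdep : ¬ ∃ g : ℝ → ℝ, Measurable g ∧ ∀ᵐ ω ∂P, Y 0 ω = g (X 0 ω)) :
    ∃ σ : ℝ, 0 < σ ∧ AsympNormal P X Y τ σ := by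
  have hXY : Measurable fun ω => (X 0 ω, Y 0 ω) := (hX 0).prodMk (hY 0)
  set μ := P.map fun ω => (X 0 ω, Y 0 ω) with hμ
  have hμp : IsProbabilityMeasure μ := Measure.isProbabilityMeasure_map hXY.aemeasurable
  have hfst : μ.fst = P.map (X 0) := by
    rw [Measure.fst, hμ, Measure.map_map measurable_fst hXY]
    rfl
  have hsnd : μ.snd = P.map (Y 0) := by
    rw [Measure.snd, hμ, Measure.map_map measurable_snd hXY]
    rfl
  have hat1 : NullSingletonClass μ.fst := by
    rw [hfst]
    refine nullSingletonClass_map_of_continuous (hX 0) (hY 0) fun t => ?_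
    exact hcont.comp (by fun_prop : Continuous fun s : ℝ => (s, t))
  have hat2 : NullSingletonClass μ.snd := by
    rw [hsnd]
    refine nullSingletonClass_map_of_continuous (hY 0) (hX 0) fun t => ?_
    have := hcont.comp (by fun_prop : Continuous fun s : ℝ => (t, s))
    simp only [Function.comp_def] at this
    simpa only [and_comm] using this
  obtain ⟨q, hq, hmp⟩ := exists_measurePreserving_section μ
  set ν := μ.fst with hν
  have hqmap : (ν.prod volume).map q = μ.snd := by
    rw [Measure.snd, ← hmp.map_eq, Measure.map_map measurable_snd hmp.measurable]
    rfl
  have hat3 : NullSingletonClass ((ν.prod (volume : Measure unitInterval)).map q) := by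
    rw [hqmap]
    exact hat2
  have hdep' : ¬ ∃ g : ℝ → ℝ, Measurable g ∧
      ∀ᵐ z ∂ν.prod (volume : Measure unitInterval), q z = g z.1 := by
    rintro ⟨g, hg, hz⟩
    refine hdep ⟨g, hg, ?_⟩
    have hms : MeasurableSet {u : ℝ × ℝ | u.2 = g u.1} :=
      measurableSet_eq_fun (by fun_prop) (by fun_prop)
    have h1 : ∀ᵐ u ∂μ, u.2 = g u.1 := by
      rw [← hmp.map_eq]
      exact (ae_map_iff hmp.measurable.aemeasurable hms).2 hz
    exact ae_of_ae_map hXY.aemeasurable h1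
  have hpos := rankVar_pos volume ν hq hdep'
  set V := rankVar ν volume q with hV
  have hsq : (3 * √V) ^ 2 = 9 * V := by
    rw [mul_pow, Real.sq_sqrt hpos.le]
    norm_num
  refine ⟨3 * √V, by positivity, ?_⟩
  have hTm (n : ℕ) : Measurable (T P X Y τ n) :=
    ((measurable_xiSample hX hY hτ n).sub_const _).const_mul _
  refine ⟨fun n => (hTm n).aemeasurable, by fun_prop, ?_⟩
  refine ProbabilityMeasure.tendsto_iff_tendsto_charFun.2 fun t => ?_
  -- Almost surely `T` is `-3` times the centred rank statistic. The same factor explains the choice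
  -- `σ = 3 √V`.
  have hlim := tendsto_charFun_rankStat ν volume hq (-3 * t)
  have hgauss : charFun ((gaussianReal 0 (Real.toNNReal ((3 * √V) ^ 2))).map fun z : ℝ => z) t =
      Complex.exp (-(((-3 * t) ^ 2 * V : ℝ) : ℂ) / 2) := by
    rw [Measure.map_id', charFun_gaussianReal, Real.coe_toNNReal _ (sq_nonneg _), hsq]
    congr 1
    push_cast
    ring
  have hS := measurePreserving_sample hX hY hindep hident (P := P)
  have hΦ (n : ℕ) : MeasurePreserving (fun (z : Fin n → ℝ × unitInterval) i => ((z i).1, q (z i)))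
      (Measure.pi fun _ => ν.prod volume) (Measure.pi fun _ => μ) :=
    measurePreserving_pi (fun _ : Fin n => ν.prod (volume : Measure unitInterval)) (fun _ => μ)
      (f := fun _ z => (z.1, q z)) fun _ => hmp
  change Tendsto (fun n => charFun (P.map (T P X Y τ n)) t) atTop
    (𝓝 (charFun ((gaussianReal 0 (Real.toNNReal ((3 * √V) ^ 2))).map fun z : ℝ => z) t))
  rw [hgauss]
  refine hlim.congr fun n => ?_
  rw [charFun_apply_real, integral_map (hTm n).aemeasurable
    (by fun_prop : Measurable _).aestronglyMeasurable]
  have hrm : Measurable fun z : Fin n → ℝ × ℝ => rankStat Prod.snd z :=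
    measurable_rankStat measurable_snd
  set ES := ∫ z', rankStat q z' ∂(Measure.pi fun _ : Fin n => ν.prod (volume : Measure unitInterval))
    with hES
  have hESμ : ∫ z, rankStat Prod.snd z ∂(Measure.pi fun _ : Fin n => μ) = ES :=
    (integral_comp_measurePreserving (hΦ n) hrm.aestronglyMeasurable).symm
  have hESP : ∫ ω, rankStat Prod.snd (sample X Y n ω) ∂P = ES :=
    (integral_comp_measurePreserving (hS n) hrm.aestronglyMeasurable).trans hESμ
  -- Almost surely no ties occur, so the labels play no role.
  have hae : ∀ᵐ ω ∂P, √n * xiSample X Y τ n ω =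
      √n - 3 * rankStat Prod.snd (sample X Y n ω) := by
    have h1 := (hS n).quasiMeasurePreserving.ae (ae_injective_pi_fst μ)
    have h2 := (hS n).quasiMeasurePreserving.ae (ae_injective_pi_snd μ)
    filter_upwards [h1, h2] with ω hx hy
    exact sqrt_mul_xi_eq hx hy _
  have hrint : Integrable (fun ω => rankStat Prod.snd (sample X Y n ω)) P := by
    have h1 : Integrable (fun ω => √n * xiSample X Y τ n ω) P :=
      (Integrable.of_bound (measurable_xiSample hX hY hτ n).aestronglyMeasurable _
        (ae_of_all _ fun ω => abs_xi_le _ _)).const_mul _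
    have h2 := ((integrable_const (√(n : ℝ))).sub (h1.congr hae)).div_const 3
    refine h2.congr (ae_of_all _ fun ω => ?_)
    simp only [Pi.sub_apply]
    ring
  have hTae : ∀ᵐ ω ∂P, T P X Y τ n ω = -3 * (rankStat Prod.snd (sample X Y n ω) - ES) := by
    have hE : √n * ∫ ω, xiSample X Y τ n ω ∂P = √n - 3 * ES := by
      rw [← integral_const_mul, integral_congr_ae hae,
        integral_sub (integrable_const _) (hrint.const_mul 3), integral_const_mul, hESP]
      simp
    filter_upwards [hae] with ω hω
    rw [T, mul_sub, hω, hE]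
    ring
  have e1 : ∫ ω, Complex.exp (t * (T P X Y τ n ω : ℝ) * Complex.I) ∂P =
      ∫ ω, Complex.exp ((-3 * t * (rankStat Prod.snd (sample X Y n ω) - ES) : ℝ) * Complex.I) ∂P := by
    refine integral_congr_ae ?_
    filter_upwards [hTae] with ω hω
    rw [hω]
    congr 2
    push_cast
    ring
  have hGm : Measurable fun z : Fin n → ℝ × ℝ =>
      Complex.exp ((-3 * t * (rankStat Prod.snd z - ES) : ℝ) * Complex.I) := by fun_prop
  rw [e1, integral_comp_measurePreserving (hS n) (g := fun z : Fin n → ℝ × ℝ =>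
      Complex.exp ((-3 * t * (rankStat Prod.snd z - ES) : ℝ) * Complex.I)) hGm.aestronglyMeasurable]
  exact integral_comp_measurePreserving (hΦ n) hGm.aestronglyMeasurable

end Sample

/-! ### Averaging over a uniform independent randomization. -/

section Randomization

variable {Ω : Type*} [MeasurableSpace Ω] {P : Measure Ω} [IsProbabilityMeasure P]
variable {α δ : Type*} [Fintype α] [MeasurableSpace α] [MeasurableSingletonClass α]
  [MeasurableSpace δ] {R : Ω → α} {D : Ω → δ}

lemma IsUniformIndep.real_preimage_singleton (h : IsUniformIndep R D P) (a : α) :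
    P.real (R ⁻¹' {a}) = (Fintype.card α : ℝ)⁻¹ := by
  rw [← map_measureReal_apply h.1 (measurableSet_singleton a), h.2.1, Measure.real, uniformOn_univ,
    Measure.count_singleton]
  simp

lemma measurable_randomized (hR : Measurable R) (hD : Measurable D) {G : δ → α → ℝ}
    (hG : ∀ a, Measurable fun d => G d a) : Measurable fun ω => G (D ω) (R ω) :=
  (measurable_from_prod_countable_left (f := fun u : δ × α => G u.1 u.2) hG).comp (hD.prodMk hR)

/-- The mean of a function of the data and of a uniform independent randomization. -/
lemma IsUniformIndep.integral_eq (h : IsUniformIndep R D P) (hD : Measurable D) {G : δ → α → ℝ}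
    (hG : ∀ a, Measurable fun d => G d a) {C : ℝ} (hC : ∀ d a, |G d a| ≤ C) :
    ∫ ω, G (D ω) (R ω) ∂P = (Fintype.card α : ℝ)⁻¹ * ∑ a, ∫ ω, G (D ω) a ∂P := by
  classical
  have hind (a : α) : Measurable (Set.indicator ({a} : Set α) (fun _ => (1 : ℝ))) :=
    measurable_const.indicator (measurableSet_singleton a)
  have e (ω : Ω) : G (D ω) (R ω) = ∑ a, Set.indicator ({a} : Set α) (fun _ => (1 : ℝ)) (R ω) *
      G (D ω) a := by
    rw [Finset.sum_eq_single (R ω)]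
    · simp
    · intro a _ ha
      rw [Set.indicator_of_notMem (by simpa using ha.symm), zero_mul]
    · simp
  have key (a : α) : ∫ ω, Set.indicator ({a} : Set α) (fun _ => (1 : ℝ)) (R ω) * G (D ω) a ∂P =
      (Fintype.card α : ℝ)⁻¹ * ∫ ω, G (D ω) a ∂P := by
    have hi := h.2.2.comp (hind a) (hG a)
    have := hi.integral_fun_mul_eq_mul_integral ((hind a).comp h.1).aestronglyMeasurable
      ((hG a).comp hD).aestronglyMeasurable
    simp only [Function.comp_apply] at this
    rw [this]
    congr 1
    have e2 : (fun ω => Set.indicator ({a} : Set α) (fun _ => (1 : ℝ)) (R ω)) =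
        (R ⁻¹' {a}).indicator 1 := by
      funext ω
      simp [Set.indicator]
    rw [e2, integral_indicator_one (h.1 (measurableSet_singleton a)), h.real_preimage_singleton]
  simp only [e]
  rw [integral_finsetSum, Finset.mul_sum]
  · exact Finset.sum_congr rfl fun a _ => key a
  · intro a _
    refine Integrable.of_bound (((hind a).comp h.1).mul
      ((hG a).comp hD)).aestronglyMeasurable C (ae_of_all _ fun ω => ?_)
    rw [Real.norm_eq_abs]
    simp only [abs_mul]
    have h1 : |Set.indicator ({a} : Set α) (fun _ => (1 : ℝ)) (R ω)| ≤ 1 := by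
      by_cases hR : R ω ∈ ({a} : Set α) <;> simp [hR]
    exact (mul_le_of_le_one_left (abs_nonneg _) h1).trans (hC _ _)

/-- The conditional mean, given the data, of a function of the data and of a uniform independent
randomization. -/
lemma IsUniformIndep.condExp_eq (h : IsUniformIndep R D P) (hD : Measurable D) {G : δ → α → ℝ}
    (hG : ∀ a, Measurable fun d => G d a) {C : ℝ} (hC : ∀ d a, |G d a| ≤ C) :
    (fun ω => (Fintype.card α : ℝ)⁻¹ * ∑ a, G (D ω) a) =ᵐ[P]
      P[fun ω => G (D ω) (R ω) | MeasurableSpace.comap D inferInstance] := by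
  have hGi (a : α) : Integrable (fun ω => G (D ω) a) P :=
    Integrable.of_bound ((hG a).comp hD).aestronglyMeasurable C (ae_of_all _ fun ω => hC _ _)
  refine ae_eq_condExp_of_forall_setIntegral_eq hD.comap_le ?_ ?_ ?_ ?_
  · exact Integrable.of_bound (measurable_randomized h.1 hD hG).aestronglyMeasurable C
      (ae_of_all _ fun ω => hC _ _)
  · intro s _ _
    exact ((integrable_finsetSum _ fun a _ => hGi a).const_mul _).integrableOn
  · rintro s ⟨B, hB, rfl⟩ -
    have hGB (a : α) : Measurable fun d => B.indicator (fun d => G d a) d := (hG a).indicator hB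
    have h1 := h.integral_eq hD (G := fun d a => B.indicator (fun d => G d a) d) hGB (C := C)
      fun d a => by
        by_cases hd : d ∈ B
        · simpa [hd] using hC d a
        · simpa [hd] using (abs_nonneg _).trans (hC d a)
    have e (f : Ω → α) (ω : Ω) : B.indicator (fun d => G d (f ω)) (D ω) =
        (D ⁻¹' B).indicator (fun ω => G (D ω) (f ω)) ω := by
      by_cases hω : D ω ∈ B
      · rw [Set.indicator_of_mem hω, Set.indicator_of_mem (Set.mem_preimage.2 hω)]
      · rw [Set.indicator_of_notMem hω, Set.indicator_of_notMem (fun h => hω (Set.mem_preimage.1 h))]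
    have e1 : ∫ ω, B.indicator (fun d => G d (R ω)) (D ω) ∂P = ∫ ω in D ⁻¹' B, G (D ω) (R ω) ∂P := by
      rw [← integral_indicator (hD hB)]
      exact integral_congr_ae (ae_of_all _ fun ω => e R ω)
    have e2 (a : α) : ∫ ω, B.indicator (fun d => G d a) (D ω) ∂P = ∫ ω in D ⁻¹' B, G (D ω) a ∂P := by
      rw [← integral_indicator (hD hB)]
      exact integral_congr_ae (ae_of_all _ fun ω => e (fun _ => a) ω)
    rw [integral_const_mul, integral_finsetSum _ fun a _ => (hGi a).integrableOn, ← e1, h1]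
    simp only [e2]
  · have : Measurable fun d : δ => (Fintype.card α : ℝ)⁻¹ * ∑ a, G d a :=
      (Finset.measurable_fun_sum _ fun a _ => hG a).const_mul _
    exact (this.comp (comap_measurable D)).aestronglyMeasurable

end Randomization

/-! ### Averages over subsamples and Hoeffding's variance bound. -/

section Subsampling

variable {α : Type*} [MeasurableSpace α] (μ : Measure α) [IsProbabilityMeasure μ] {m n : ℕ}

lemma measurePreserving_comp_embedding (s : Fin m ↪ Fin n) :
    MeasurePreserving (fun (z : Fin n → α) k => z (s k)) (Measure.pi fun _ => μ)
      (Measure.pi fun _ => μ) := by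
  refine ⟨by fun_prop, ?_⟩
  have h1 : iIndepFun (fun (i : Fin n) (z : Fin n → α) => z i) (Measure.pi fun _ => μ) :=
    iIndepFun_pi (X := fun _ => id) fun _ => aemeasurable_id
  have h2 := (iIndepFun_iff_map_fun_eq_pi_map
    (fun k : Fin m => (measurable_pi_apply (s k)).aemeasurable)).1 (h1.precomp s.injective)
  refine h2.trans ?_
  congr 1
  funext k
  exact (measurePreserving_eval (fun _ : Fin n => μ) (s k)).map_eq

/-- The mean of a statistic over all subsamples. -/
noncomputable def subsampleMean (h : (Fin m → α) → ℝ) (z : Fin n → α) : ℝ :=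
  (Fintype.card (Fin m ↪ Fin n) : ℝ)⁻¹ * ∑ s : Fin m ↪ Fin n, h fun k => z (s k)

lemma subsampleMean_comp_perm (h : (Fin m → α) → ℝ) (z : Fin n → α) (π : Equiv.Perm (Fin n)) :
    subsampleMean h (fun i => z (π i)) = subsampleMean h z := by
  unfold subsampleMean
  congr 1
  exact Equiv.sum_comp (Equiv.embeddingCongr (Equiv.refl (Fin m)) π)
    fun s : Fin m ↪ Fin n => h fun k => z (s k)

/-- Consecutive blocks of indices. -/
def block (m n : ℕ) (l : Fin (n / m)) : Fin m ↪ Fin n where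
  toFun i := ⟨l * m + i, by
    have h1 : (l + 1) * m ≤ n / m * m := Nat.mul_le_mul_right m l.isLt
    have h2 := Nat.div_mul_le_self n m
    have h3 := i.isLt
    rw [Nat.add_mul, one_mul] at h1
    omega⟩
  inj' i j hij := by
    simp only [Fin.mk.injEq, Nat.add_left_cancel_iff] at hij
    exact Fin.ext hij

lemma block_ne {l l' : Fin (n / m)} (hl : l ≠ l') (i j : Fin m) : block m n l i ≠ block m n l' j := by
  intro h
  have h' : l.val * m + i.val = l'.val * m + j.val := congrArg Fin.val h
  have hm : 0 < m := i.pos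
  have h1 : (l.val * m + i.val) / m = l.val := by
    rw [Nat.add_comm, Nat.add_mul_div_right _ _ hm, Nat.div_eq_of_lt i.isLt, zero_add]
  have h2 : (l'.val * m + j.val) / m = l'.val := by
    rw [Nat.add_comm, Nat.add_mul_div_right _ _ hm, Nat.div_eq_of_lt j.isLt, zero_add]
  rw [h', h2] at h1
  exact hl (Fin.ext h1.symm)

variable {h : (Fin m → α) → ℝ} (hh : Measurable h) {C : ℝ} (hC : ∀ y, |h y| ≤ C)

include hh in
@[fun_prop]
lemma measurable_subsampleMean : Measurable fun z : Fin n → α => subsampleMean h z := by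
  unfold subsampleMean
  exact (Finset.measurable_fun_sum _ fun s _ => hh.comp (by fun_prop)).const_mul _

include hC in
lemma abs_subsampleMean_le (hC0 : 0 ≤ C) (z : Fin n → α) : |subsampleMean h z| ≤ C := by
  unfold subsampleMean
  rw [abs_mul, abs_of_nonneg (by positivity : (0 : ℝ) ≤ (Fintype.card (Fin m ↪ Fin n) : ℝ)⁻¹)]
  have h1 : |∑ s : Fin m ↪ Fin n, h fun k => z (s k)| ≤ Fintype.card (Fin m ↪ Fin n) * C := by
    refine (Finset.abs_sum_le_sum_abs _ _).trans ((Finset.sum_le_card_nsmul _ _ C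
      fun s _ => hC _).trans ?_)
    rw [nsmul_eq_mul, Finset.card_univ]
  refine (mul_le_mul_of_nonneg_left h1 (by positivity)).trans ?_
  rw [← mul_assoc]
  exact mul_le_of_le_one_left hC0 (inv_mul_le_one)

include hh in
lemma integral_block_mul_block (h0 : ∫ y, h y ∂(Measure.pi fun _ : Fin m => μ) = 0)
    {l l' : Fin (n / m)} (hl : l ≠ l') :
    ∫ z, h (fun k => z (block m n l k)) * h (fun k => z (block m n l' k))
      ∂(Measure.pi fun _ : Fin n => μ) = 0 := by
  classical
  have hind : iIndepFun (fun (i : Fin n) (z : Fin n → α) => z i) (Measure.pi fun _ => μ) :=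
    iIndepFun_pi (X := fun _ => id) fun _ => aemeasurable_id
  set S := Finset.univ.image (block m n l)
  set S' := Finset.univ.image (block m n l')
  have hdisj : Disjoint S S' := by
    rw [Finset.disjoint_left]
    intro i hi hi'
    obtain ⟨k, -, rfl⟩ := Finset.mem_image.1 hi
    obtain ⟨k', -, hk'⟩ := Finset.mem_image.1 hi'
    exact block_ne hl k k' hk'.symm
  have h1 := hind.indepFun_finset S S' hdisj fun i => measurable_pi_apply i
  have hr (l : Fin (n / m)) : Measurable fun v : (Finset.univ.image (block m n l)) → α =>
      h fun k => v ⟨block m n l k, Finset.mem_image_of_mem _ (Finset.mem_univ k)⟩ :=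
    hh.comp (by fun_prop)
  have h2 := h1.comp (hr l) (hr l')
  have hm (l : Fin (n / m)) : Measurable fun z : Fin n → α => h fun k => z (block m n l k) :=
    hh.comp (by fun_prop)
  have h3 := h2.integral_fun_mul_eq_mul_integral (hm l).aestronglyMeasurable
    (hm l').aestronglyMeasurable
  have h4 : ∫ z, h (fun k => z (block m n l k)) ∂(Measure.pi fun _ : Fin n => μ) = 0 :=
    (integral_comp_measurePreserving (measurePreserving_comp_embedding μ (block m n l))
      hh.aestronglyMeasurable).trans h0
  refine h3.trans ?_
  exact mul_eq_zero_of_left h4 _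

include hh hC in
/-- Hoeffding's bound for the variance of the mean over all subsamples. -/
lemma integral_subsampleMean_sq_le (h0 : ∫ y, h y ∂(Measure.pi fun _ : Fin m => μ) = 0)
    (hmn : 0 < n / m) :
    ∫ z, subsampleMean h z ^ 2 ∂(Measure.pi fun _ : Fin n => μ) ≤
      ((n / m : ℕ) : ℝ)⁻¹ * ∫ y, h y ^ 2 ∂(Measure.pi fun _ : Fin m => μ) := by
  have hC0 : 0 ≤ C := by
    obtain ⟨y⟩ : Nonempty (Fin m → α) :=
      nonempty_of_isProbabilityMeasure (Measure.pi fun _ : Fin m => μ)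
    exact (abs_nonneg _).trans (hC y)
  set Q := Measure.pi fun _ : Fin n => μ with hQ
  set K := n / m with hK
  have hK0 : (0 : ℝ) < K := by exact_mod_cast hmn
  set e : Fin K → Fin m ↪ Fin n := block m n with he
  set U : (Fin n → α) → ℝ := subsampleMean h with hU
  have hUm : Measurable U := measurable_subsampleMean hh
  have hUb : ∀ z, |U z| ≤ C := abs_subsampleMean_le hC hC0
  have hsm (s : Fin m ↪ Fin n) : Measurable fun z : Fin n → α => h fun k => z (s k) :=
    hh.comp (by fun_prop)
  have hbdd {f g : (Fin n → α) → ℝ} (hf : Measurable f) (hg : Measurable g)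
      (hfb : ∀ z, |f z| ≤ C) (hgb : ∀ z, |g z| ≤ C) : Integrable (fun z => f z * g z) Q :=
    Integrable.of_bound (hf.mul hg).aestronglyMeasurable (C * C) (ae_of_all _ fun z => by
      rw [Real.norm_eq_abs, abs_mul]
      exact mul_le_mul (hfb z) (hgb z) (abs_nonneg _) hC0)
  -- Some permutation of the sample carries `s` to `s'`; it preserves the law of the sample and
  -- leaves the average over all subsamples unchanged.
  have hcov (s s' : Fin m ↪ Fin n) : ∫ z, U z * h (fun k => z (s k)) ∂Q =
      ∫ z, U z * h (fun k => z (s' k)) ∂Q := by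
    obtain ⟨π, hπ⟩ := Equiv.Perm.exists_extending_pair s s' s.injective s'.injective
    have hmp := measurePreserving_comp_embedding μ (π.toEmbedding : Fin n ↪ Fin n)
    have := integral_comp_measurePreserving hmp (g := fun z => U z * h (fun k => z (s k)))
      (hUm.mul (hsm s)).aestronglyMeasurable
    rw [← this]
    refine integral_congr_ae (ae_of_all _ fun z => ?_)
    simp only [Equiv.coe_toEmbedding, hπ]
    congr 1
    exact subsampleMean_comp_perm h z π
  have hne : Nonempty (Fin m ↪ Fin n) := ⟨e ⟨0, hmn⟩⟩
  have hN : (0 : ℝ) < Fintype.card (Fin m ↪ Fin n) := by exact_mod_cast Fintype.card_pos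
  have hUU (s : Fin m ↪ Fin n) : ∫ z, U z * U z ∂Q = ∫ z, U z * h (fun k => z (s k)) ∂Q := by
    have e1 (z : Fin n → α) : U z * U z = (Fintype.card (Fin m ↪ Fin n) : ℝ)⁻¹ *
        ∑ s' : Fin m ↪ Fin n, U z * h fun k => z (s' k) := by
      rw [← Finset.mul_sum]
      conv_lhs => rw [hU, subsampleMean]
      rw [hU]
      simp only [subsampleMean]
      ring
    simp only [e1]
    rw [integral_const_mul, integral_finsetSum _ fun s' _ => hbdd hUm (hsm s') hUb fun z => hC _,
      Finset.sum_congr rfl fun s' _ => hcov s' s, Finset.sum_const, Finset.card_univ, nsmul_eq_mul,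
      ← mul_assoc, inv_mul_cancel₀ hN.ne', one_mul]
  set B : (Fin n → α) → ℝ := fun z => (K : ℝ)⁻¹ * ∑ l, h fun k => z (e l k) with hB
  have hBm : Measurable B := (Finset.measurable_fun_sum _ fun l _ => hsm (e l)).const_mul _
  -- Every single subsample has the same mean product with `U`, so `U` may be paired with the
  -- average `B` over disjoint blocks.
  have hUB : ∫ z, U z * U z ∂Q = ∫ z, U z * B z ∂Q := by
    have e1 (z : Fin n → α) : U z * B z = (K : ℝ)⁻¹ * ∑ l, U z * h fun k => z (e l k) := by
      rw [← Finset.mul_sum, hB]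
      ring
    simp only [e1]
    rw [integral_const_mul, integral_finsetSum _ fun l _ => hbdd hUm (hsm (e l)) hUb fun z => hC _,
      Finset.sum_congr rfl fun l _ => (hUU (e l)).symm, Finset.sum_const, Finset.card_univ,
      Fintype.card_fin, nsmul_eq_mul, ← mul_assoc, inv_mul_cancel₀ hK0.ne', one_mul]
  have hBb (z : Fin n → α) : |B z| ≤ C := by
    simp only [hB]
    rw [abs_mul, abs_of_pos (inv_pos.2 hK0), inv_mul_le_iff₀ hK0]
    refine (Finset.abs_sum_le_sum_abs _ _).trans ((Finset.sum_le_card_nsmul _ _ C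
      fun s _ => hC _).trans ?_)
    simp
  have hBB : ∫ z, B z * B z ∂Q = (K : ℝ)⁻¹ * ∫ y, h y ^ 2 ∂(Measure.pi fun _ : Fin m => μ) := by
    have e1 (z : Fin n → α) : B z * B z = (K : ℝ)⁻¹ * ((K : ℝ)⁻¹ *
        ∑ l, ∑ l', h (fun k => z (e l k)) * h (fun k => z (e l' k))) := by
      rw [← Finset.sum_mul_sum]
      simp only [hB]
      ring
    have hi (l l' : Fin K) : Integrable (fun z : Fin n → α =>
        h (fun k => z (e l k)) * h (fun k => z (e l' k))) Q :=
      hbdd (hsm _) (hsm _) (fun _ => hC _) fun _ => hC _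
    have e2 (l : Fin K) : ∑ l', ∫ z, h (fun k => z (e l k)) * h (fun k => z (e l' k)) ∂Q =
        ∫ y, h y ^ 2 ∂(Measure.pi fun _ : Fin m => μ) := by
      rw [Finset.sum_eq_single l]
      · rw [← integral_comp_measurePreserving (measurePreserving_comp_embedding μ (e l))
          (hh.pow_const 2).aestronglyMeasurable]
        refine integral_congr_ae (ae_of_all _ fun z => ?_)
        simp only [sq]
      · intro l' _ hl'
        exact integral_block_mul_block μ hh h0 hl'.symm
      · simp
    simp only [e1]
    rw [integral_const_mul, integral_const_mul,
      integral_finsetSum _ fun l _ => integrable_finsetSum _ fun l' _ => hi l l']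
    simp only [integral_finsetSum _ fun l' _ => hi _ l', e2]
    rw [Finset.sum_const, Finset.card_univ, Fintype.card_fin, nsmul_eq_mul, ← mul_assoc (K : ℝ)⁻¹ (K : ℝ),
      inv_mul_cancel₀ hK0.ne', one_mul]
  -- From `E U² = E U B ≤ E U² / 2 + E B² / 2` it follows that `E U² ≤ E B²`; and `B` averages
  -- independent centred variables.
  have hfin : ∫ z, U z * U z ∂Q ≤ ∫ z, B z * B z ∂Q := by
    have iUU := hbdd hUm hUm hUb hUb
    have iBB := hbdd hBm hBm hBb hBb
    have h1 : ∫ z, U z * B z ∂Q ≤ ∫ z, (2⁻¹ * (U z * U z) + 2⁻¹ * (B z * B z)) ∂Q := by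
      refine integral_mono (hbdd hUm hBm hUb hBb) ((iUU.const_mul _).add (iBB.const_mul _))
        fun z => ?_
      simp only
      nlinarith [sq_nonneg (U z - B z)]
    rw [integral_add (iUU.const_mul _) (iBB.const_mul _), integral_const_mul, integral_const_mul,
      ← hUB] at h1
    linarith
  rw [hBB] at hfin
  simpa only [sq] using hfin

end Subsampling

/-! ### Convergence in distribution together with second moments. -/

section Moments

variable {Ω Ω' : Type*} [MeasurableSpace Ω] [MeasurableSpace Ω'] {P : Measure Ω}
  [IsProbabilityMeasure P] {Q : Measure Ω'} [IsProbabilityMeasure Q] {W : ℕ → Ω → ℝ} {Z : Ω' → ℝ}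

lemma tendsto_integral_of_tendstoInDistribution (hW : TendstoInDistribution W atTop Z (fun _ => P) Q)
    {g : ℝ → ℝ} (hg : Continuous g) {B : ℝ} (hB : ∀ x, |g x| ≤ B) :
    Tendsto (fun n => ∫ ω, g (W n ω) ∂P) atTop (𝓝 (∫ ω, g (Z ω) ∂Q)) := by
  have h := ProbabilityMeasure.tendsto_iff_forall_integral_tendsto.1 hW.tendsto
    (BoundedContinuousFunction.ofNormedAddCommGroup g hg B hB)
  have e (n : ℕ) : ∫ x, g x ∂(P.map (W n)) = ∫ ω, g (W n ω) ∂P :=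
    integral_map (hW.forall_aemeasurable n) hg.aestronglyMeasurable
  have e' : ∫ x, g x ∂(Q.map Z) = ∫ ω, g (Z ω) ∂Q :=
    integral_map hW.aemeasurable_limit hg.aestronglyMeasurable
  rw [← e']
  refine Tendsto.congr e ?_
  exact h

lemma tendsto_integral_min {f : Ω' → ℝ} (hf : Integrable f Q) (h0 : ∀ ω, 0 ≤ f ω) :
    Tendsto (fun M : ℕ => ∫ ω, min (f ω) M ∂Q) atTop (𝓝 (∫ ω, f ω ∂Q)) := by
  refine tendsto_integral_of_dominated_convergence f (fun M => ?_) hf (fun M => ?_)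
    (ae_of_all _ fun ω => ?_)
  · exact (hf.aemeasurable.min aemeasurable_const).aestronglyMeasurable
  · refine ae_of_all _ fun ω => ?_
    rw [Real.norm_eq_abs, abs_of_nonneg (le_min (h0 ω) (Nat.cast_nonneg M))]
    exact min_le_left _ _
  · obtain ⟨N, hN⟩ := exists_nat_ge (f ω)
    refine tendsto_const_nhds.congr' ?_
    filter_upwards [eventually_ge_atTop N] with M hM
    rw [min_eq_left]
    exact hN.trans (by exact_mod_cast hM)

/-- The lower half of the portmanteau theorem for nonnegative continuous functions. -/
lemma eventually_integral_gt (hW : TendstoInDistribution W atTop Z (fun _ => P) Q)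
    {g : ℝ → ℝ} (hg : Continuous g) (h0 : ∀ x, 0 ≤ g x) (hgZ : Integrable (fun ω => g (Z ω)) Q)
    (hgW : ∀ n, Integrable (fun ω => g (W n ω)) P) {c : ℝ} (hc : c < ∫ ω, g (Z ω) ∂Q) :
    ∀ᶠ n in atTop, c < ∫ ω, g (W n ω) ∂P := by
  obtain ⟨M, hM⟩ := ((tendsto_integral_min hgZ fun ω => h0 _).eventually (lt_mem_nhds hc)).exists
  have h := tendsto_integral_of_tendstoInDistribution hW (g := fun x => min (g x) M)
    (hg.min continuous_const) (B := M) fun x => by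
      rw [abs_of_nonneg (le_min (h0 x) (Nat.cast_nonneg M))]
      exact min_le_right _ _
  filter_upwards [h.eventually (lt_mem_nhds hM)] with n hn
  refine hn.trans_le (integral_mono_of_nonneg (ae_of_all _ fun ω => le_min (h0 _) (Nat.cast_nonneg M))
    (hgW n) (ae_of_all _ fun ω => min_le_left _ _))

/-- Convergence in distribution and of second moments implies convergence of the means of
continuous functions of quadratic growth. -/
theorem tendsto_integral_of_quadratic_growth
    (hW : TendstoInDistribution W atTop Z (fun _ => P) Q)
    (hWi : ∀ n, Integrable (fun ω => W n ω ^ 2) P) (hZi : Integrable (fun ω => Z ω ^ 2) Q)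
    (h2 : Tendsto (fun n => ∫ ω, W n ω ^ 2 ∂P) atTop (𝓝 (∫ ω, Z ω ^ 2 ∂Q)))
    {f : ℝ → ℝ} (hf : Continuous f) {C : ℝ} (hC : ∀ x, |f x| ≤ C * (1 + x ^ 2)) :
    Tendsto (fun n => ∫ ω, f (W n ω) ∂P) atTop (𝓝 (∫ ω, f (Z ω) ∂Q)) := by
  have hquadW (n : ℕ) : Integrable (fun ω => C * (1 + W n ω ^ 2)) P :=
    ((integrable_const _).add (hWi n)).const_mul _
  have hquadZ : Integrable (fun ω => C * (1 + Z ω ^ 2)) Q :=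
    ((integrable_const _).add hZi).const_mul _
  have lower {f : ℝ → ℝ} (hf : Continuous f) (hC : ∀ x, |f x| ≤ C * (1 + x ^ 2)) {c : ℝ}
      (hc : c < ∫ ω, f (Z ω) ∂Q) : ∀ᶠ n in atTop, c < ∫ ω, f (W n ω) ∂P := by
    have hfW (n : ℕ) : Integrable (fun ω => f (W n ω)) P :=
      (hquadW n).mono' (hf.measurable.comp_aemeasurable
        (hW.forall_aemeasurable n)).aestronglyMeasurable (ae_of_all _ fun ω => hC _)
    have hfZ : Integrable (fun ω => f (Z ω)) Q :=
      hquadZ.mono' (hf.measurable.comp_aemeasurable hW.aemeasurable_limit).aestronglyMeasurable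
        (ae_of_all _ fun ω => hC _)
    set ε := (∫ ω, f (Z ω) ∂Q - c) / 2 with hε
    have hε0 : 0 < ε := by linarith
    have hgi : ∫ ω, (f (Z ω) + C * (1 + Z ω ^ 2)) ∂Q =
        ∫ ω, f (Z ω) ∂Q + C * (1 + ∫ ω, Z ω ^ 2 ∂Q) := by
      rw [integral_add hfZ hquadZ, integral_const_mul, integral_add (integrable_const _) hZi]
      simp
    -- Adding `C (1 + x²)` makes the function nonnegative, so the lower half of the portmanteau
    -- theorem applies; the added mean converges by assumption and is subtracted again.
    have h1 := eventually_integral_gt hW (g := fun x => f x + C * (1 + x ^ 2)) (by fun_prop)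
      (fun x => by linarith [neg_abs_le (f x), hC x]) (hfZ.add hquadZ)
      (fun n => (hfW n).add (hquadW n))
      (c := ∫ ω, f (Z ω) ∂Q + C * (1 + ∫ ω, Z ω ^ 2 ∂Q) - ε) (by rw [hgi]; linarith)
    have h3 := (h2.const_add 1).const_mul C
    filter_upwards [h1, h3.eventually (gt_mem_nhds (lt_add_of_pos_right _ hε0))] with n hn1 hn2
    rw [integral_add (hfW n) (hquadW n), integral_const_mul,
      integral_add (integrable_const _) (hWi n)] at hn1
    simp only [integral_const, probReal_univ, one_smul] at hn1
    linarith
  rw [tendsto_order]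
  refine ⟨fun c hc => lower hf hC hc, fun c hc => ?_⟩
  -- The growth condition is symmetric, so the upper bound is the lower bound for `-f`.
  have := lower (f := fun x => -f x) hf.neg (fun x => by rw [abs_neg]; exact hC x) (c := -c) (by
    rw [integral_neg]
    linarith)
  filter_upwards [this] with n hn
  rw [integral_neg] at hn
  linarith

/-- Convergence in distribution and uniform square-integrability imply convergence of second
moments. -/
theorem tendsto_integral_sq_of_uniformIntegrable
    (hW : TendstoInDistribution W atTop Z (fun _ => P) Q) (hWm : ∀ n, Measurable (W n))
    (hWi : ∀ n, Integrable (fun ω => W n ω ^ 2) P) (hZi : Integrable (fun ω => Z ω ^ 2) Q)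
    (hUI : UniformIntegrable W 2 P) :
    Tendsto (fun n => ∫ ω, W n ω ^ 2 ∂P) atTop (𝓝 (∫ ω, Z ω ^ 2 ∂Q)) := by
  rw [tendsto_order]
  refine ⟨fun c hc => eventually_integral_gt hW (by fun_prop) (fun x => sq_nonneg x) hZi hWi hc,
    fun c hc => ?_⟩
  set δ := (c - ∫ ω, Z ω ^ 2 ∂Q) / 2 with hδ
  have hδ0 : 0 < δ := by linarith
  obtain ⟨-, hUI2⟩ := (uniformIntegrable_iff one_le_two ENNReal.ofNat_ne_top).1 hUI
  obtain ⟨K, hK⟩ := hUI2 (√δ) (Real.sqrt_pos.2 hδ0)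
  -- The square is at most its truncation at `K²` plus the square on `|W| ≥ K`. Uniform
  -- integrability with tolerance `√δ` in the `L²`-norm bounds the latter by `δ` for all `n` at
  -- once.
  have htail (n : ℕ) : ∫ ω, W n ω ^ 2 ∂P ≤ ∫ ω, min (W n ω ^ 2) (K ^ 2 : ℝ) ∂P + δ := by
    set S := {ω | K ≤ ‖W n ω‖₊} with hS
    have hSm : MeasurableSet S := measurableSet_le measurable_const (hWm n).nnnorm
    have hmem : MemLp (S.indicator (W n)) 2 P :=
      ((memLp_two_iff_integrable_sq (hWm n).aestronglyMeasurable).2 (hWi n)).indicator hSm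
    have h1 : ∫ ω, (S.indicator (W n) ω) ^ 2 ∂P ≤ δ := by
      have h2 := hK n
      rw [hmem.eLpNorm_eq_integral_rpow_norm two_ne_zero ENNReal.ofNat_ne_top] at h2
      have h3 := (ENNReal.ofReal_le_ofReal_iff (Real.sqrt_nonneg δ)).1 h2
      have h4 : ∫ ω, ‖S.indicator (W n) ω‖ ^ (2 : ENNReal).toReal ∂P =
          ∫ ω, (S.indicator (W n) ω) ^ 2 ∂P := by
        refine integral_congr_ae (ae_of_all _ fun ω => ?_)
        simp only [ENNReal.toReal_ofNat, Real.rpow_ofNat, Real.norm_eq_abs, sq_abs]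
      rw [h4, ENNReal.toReal_ofNat, ← one_div, ← Real.sqrt_eq_rpow] at h3
      exact (Real.sqrt_le_sqrt_iff hδ0.le).1 h3
    have hmin : Integrable (fun ω => min (W n ω ^ 2) (K ^ 2 : ℝ)) P :=
      (hWi n).inf (integrable_const _)
    have hind : Integrable (fun ω => (S.indicator (W n) ω) ^ 2) P := hmem.integrable_sq
    have h5 : ∫ ω, W n ω ^ 2 ∂P ≤
        ∫ ω, (min (W n ω ^ 2) (K ^ 2 : ℝ) + (S.indicator (W n) ω) ^ 2) ∂P := by
      refine integral_mono (hWi n) (hmin.add hind) fun ω => ?_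
      simp only
      by_cases hω : ω ∈ S
      · rw [Set.indicator_of_mem hω]
        have : 0 ≤ min (W n ω ^ 2) (K ^ 2 : ℝ) := le_min (sq_nonneg _) (sq_nonneg _)
        linarith
      · rw [Set.indicator_of_notMem hω, min_eq_left]
        · simp
        · have h6 : ‖W n ω‖₊ < K := not_le.1 hω
          have h7 : |W n ω| < K := by
            have : (‖W n ω‖₊ : ℝ) < K := by exact_mod_cast h6
            simpa using this
          rw [← sq_abs (W n ω)]
          exact pow_le_pow_left₀ (abs_nonneg _) h7.le 2
    rw [integral_add hmin hind] at h5
    linarith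
  have hlim := tendsto_integral_of_tendstoInDistribution hW (g := fun x => min (x ^ 2) (K ^ 2 : ℝ))
    (by fun_prop) (B := K ^ 2) fun x => by
      rw [abs_of_nonneg (le_min (sq_nonneg _) (sq_nonneg _))]
      exact min_le_right _ _
  have hle : ∫ ω, min (Z ω ^ 2) (K ^ 2 : ℝ) ∂Q ≤ ∫ ω, Z ω ^ 2 ∂Q :=
    integral_mono_of_nonneg (ae_of_all _ fun ω => le_min (sq_nonneg _) (sq_nonneg _)) hZi
      (ae_of_all _ fun ω => min_le_left _ _)
  have hlt : ∫ ω, min (Z ω ^ 2) (K ^ 2 : ℝ) ∂Q < c - δ := by linarith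
  filter_upwards [hlim.eventually (gt_mem_nhds hlt)] with n hn
  linarith [htail n]

end Moments

/-! ### The bootstrap coefficient and the conclusion. -/

section Bootstrap

variable {Ω : Type*} [MeasurableSpace Ω] {P : Measure Ω} [IsProbabilityMeasure P]
  {X Y : ℕ → Ω → ℝ} (hX : ∀ k, Measurable (X k)) (hY : ∀ k, Measurable (Y k))
  (hindep : iIndepFun (fun k ω => (X k ω, Y k ω)) P)
  (hident : ∀ k, IdentDistrib (fun ω => (X k ω, Y k ω)) (fun ω => (X 0 ω, Y 0 ω)) P P)
  {τ : (n : ℕ) → Ω → Equiv.Perm (Fin n)} (hτ : ∀ n, IsUniformIndep (τ n) (sample X Y n) P)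
  {m : ℕ → ℕ} {S : (n : ℕ) → Ω → (Fin (m n) ↪ Fin n)}
  {ρ : (n : ℕ) → Ω → Equiv.Perm (Fin (m n))}
  (hSρ : ∀ n, IsUniformIndep (fun ω => (S n ω, ρ n ω)) (sample X Y n) P)

lemma measurable_xi_subsample {k n : ℕ} (a : (Fin k ↪ Fin n) × Equiv.Perm (Fin k)) :
    Measurable fun z : Fin n → ℝ × ℝ => xi (fun i => z (a.1 i)) a.2 := by
  have h : Measurable fun (z : Fin n → ℝ × ℝ) (i : Fin k) => z (a.1 i) :=
    measurable_pi_lambda _ fun i => measurable_pi_apply (a.1 i)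
  exact (measurable_xi a.2).comp h

include hX hY hSρ in
lemma measurable_xiBoot (n : ℕ) : Measurable (xiBoot X Y m S ρ n) :=
  measurable_randomized (hSρ n).1 (measurable_sample hX hY n)
    (G := fun z a => xi (fun i => z (a.1 i)) a.2) measurable_xi_subsample

include hX hY hindep hident hτ hSρ in
/-- The subsample has the same law as a sample. -/
lemma identDistrib_xiBoot (n : ℕ) :
    IdentDistrib (xiBoot X Y m S ρ n) (xiSample X Y τ (m n)) P P := by
  classical
  have hτm (n : ℕ) := (hτ n).1
  refine ⟨(measurable_xiBoot hX hY hSρ n).aemeasurable,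
    (measurable_xiSample hX hY hτm (m n)).aemeasurable, ?_⟩
  have hne : Nonempty (Fin (m n) ↪ Fin n) := by
    obtain ⟨ω⟩ : Nonempty Ω := nonempty_of_isProbabilityMeasure P
    exact ⟨S n ω⟩
  have hp1 : IsProbabilityMeasure (P.map (xiBoot X Y m S ρ n)) :=
    Measure.isProbabilityMeasure_map (measurable_xiBoot hX hY hSρ n).aemeasurable
  have hp2 : IsProbabilityMeasure (P.map (xiSample X Y τ (m n))) :=
    Measure.isProbabilityMeasure_map (measurable_xiSample hX hY hτm (m n)).aemeasurable
  refine Measure.ext fun B hB => ?_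
  refine (ENNReal.toReal_eq_toReal_iff' (measure_ne_top _ _) (measure_ne_top _ _)).1 ?_
  change (P.map (xiBoot X Y m S ρ n)).real B = (P.map (xiSample X Y τ (m n))).real B
  set ψ : ℝ → ℝ := B.indicator 1 with hψ
  have hψm : Measurable ψ := measurable_one.indicator hB
  have hψ1 (x : ℝ) : |ψ x| ≤ 1 := by
    by_cases hx : x ∈ B <;> simp [hψ, hx]
  have e {f : Ω → ℝ} (hf : Measurable f) : (P.map f).real B = ∫ ω, ψ (f ω) ∂P := by
    rw [← integral_indicator_one hB, integral_map hf.aemeasurable hψm.aestronglyMeasurable]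
  have hμ := (hX 0).prodMk (hY 0)
  have hS := measurePreserving_sample hX hY hindep hident (P := P)
  set μ := P.map fun ω => (X 0 ω, Y 0 ω) with hμdef
  have : IsProbabilityMeasure μ := Measure.isProbabilityMeasure_map hμ.aemeasurable
  have hm1 (r : Equiv.Perm (Fin (m n))) : Measurable fun y : Fin (m n) → ℝ × ℝ => ψ (xi y r) :=
    hψm.comp (measurable_xi r)
  rw [e (measurable_xiBoot hX hY hSρ n), e (measurable_xiSample hX hY hτm (m n))]
  have h1 := (hSρ n).integral_eq (measurable_sample hX hY n)
    (G := fun z a => ψ (xi (fun i => z (a.1 i)) a.2))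
    (fun a => hψm.comp (measurable_xi_subsample a)) (C := 1) fun _ _ => hψ1 _
  have h2 := (hτ (m n)).integral_eq (measurable_sample hX hY (m n))
    (G := fun y r => ψ (xi y r)) hm1 (C := 1) fun _ _ => hψ1 _
  have e1 (a : (Fin (m n) ↪ Fin n) × Equiv.Perm (Fin (m n))) :
      ∫ ω, ψ (xi (fun i => sample X Y n ω (a.1 i)) a.2) ∂P =
        ∫ y, ψ (xi y a.2) ∂(Measure.pi fun _ : Fin (m n) => μ) := by
    rw [← integral_comp_measurePreserving ((measurePreserving_comp_embedding μ a.1).comp (hS n))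
      (hm1 a.2).aestronglyMeasurable]
    rfl
  have e2 (r : Equiv.Perm (Fin (m n))) : ∫ ω, ψ (xi (sample X Y (m n) ω) r) ∂P =
      ∫ y, ψ (xi y r) ∂(Measure.pi fun _ : Fin (m n) => μ) :=
    integral_comp_measurePreserving (hS (m n)) (hm1 r).aestronglyMeasurable
  simp only [e1] at h1
  simp only [e2] at h2
  refine h1.trans (Eq.trans ?_ h2.symm)
  rw [Fintype.sum_prod_type]
  dsimp only
  rw [Finset.sum_const, Finset.card_univ, nsmul_eq_mul, Fintype.card_prod]
  have hN : (Fintype.card (Fin (m n) ↪ Fin n) : ℝ) ≠ 0 := by exact_mod_cast Fintype.card_ne_zero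
  push_cast
  field_simp

lemma memLp_xiSample (hX : ∀ k, Measurable (X k)) (hY : ∀ k, Measurable (Y k))
    (hτm : ∀ n, Measurable (τ n)) (n : ℕ) : MemLp (xiSample X Y τ n) 2 P :=
  MemLp.of_bound (measurable_xiSample hX hY hτm n).aestronglyMeasurable _
    (ae_of_all _ fun _ => abs_xi_le _ _)

lemma integral_T_sq (hX : ∀ k, Measurable (X k)) (hY : ∀ k, Measurable (Y k))
    (hτm : ∀ n, Measurable (τ n)) (n : ℕ) :
    ∫ ω, T P X Y τ n ω ^ 2 ∂P = n * Var[xiSample X Y τ n; P] := by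
  rw [variance_eq_integral (measurable_xiSample hX hY hτm n).aemeasurable, ← integral_const_mul]
  refine integral_congr_ae (ae_of_all _ fun ω => ?_)
  simp only [T]
  rw [mul_pow, Real.sq_sqrt (Nat.cast_nonneg n)]

include hX hY hindep hident hτ hSρ in
/-- The conditional mean of the subsample coefficient has a small variance. -/
lemma variance_condExp_xiBoot_le {n : ℕ} (hmn : 0 < n / m n) :
    Var[P[xiBoot X Y m S ρ n | sampleSigma X Y n]; P] ≤
      ((n / m n : ℕ) : ℝ)⁻¹ * Var[xiSample X Y τ (m n); P] := by
  have hτm (n : ℕ) := (hτ n).1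
  have hne : Nonempty (Fin (m n) ↪ Fin n) := by
    obtain ⟨ω⟩ : Nonempty Ω := nonempty_of_isProbabilityMeasure P
    exact ⟨S n ω⟩
  have hμ := (hX 0).prodMk (hY 0)
  have hS := measurePreserving_sample hX hY hindep hident (P := P)
  set μ := P.map fun ω => (X 0 ω, Y 0 ω) with hμdef
  have : IsProbabilityMeasure μ := Measure.isProbabilityMeasure_map hμ.aemeasurable
  set N : ℝ := ((Fintype.card (Equiv.Perm (Fin (m n))) : ℕ) : ℝ) with hN
  have hN0 : 0 < N := by
    rw [hN]
    exact_mod_cast Fintype.card_pos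
  have hM0 : (Fintype.card (Fin (m n) ↪ Fin n) : ℝ) ≠ 0 := by exact_mod_cast Fintype.card_ne_zero
  set Q := Measure.pi fun _ : Fin (m n) => μ with hQ
  set C : ℝ := 1 + (3 + (m n : ℝ)) * (m n * m n) with hC
  set θ := ∫ ω, xiSample X Y τ (m n) ω ∂P with hθ
  have hmean {ψ : ℝ → ℝ} (hψ : Measurable ψ) {B : ℝ} (hB : ∀ y r, |ψ (xi (n := m n) y r)| ≤ B) :
      ∫ ω, ψ (xiSample X Y τ (m n) ω) ∂P = N⁻¹ * ∑ r, ∫ y, ψ (xi y r) ∂Q := by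
    have h2 := (hτ (m n)).integral_eq (measurable_sample hX hY (m n))
      (G := fun y r => ψ (xi y r)) (fun r => hψ.comp (measurable_xi r)) (C := B) hB
    refine h2.trans ?_
    congr 1
    exact Finset.sum_congr rfl fun r _ => integral_comp_measurePreserving (hS (m n))
      (g := fun y => ψ (xi y r)) (hψ.comp (measurable_xi r)).aestronglyMeasurable
  have hθC : |θ| ≤ C := norm_integral_le_of_bound fun _ => abs_xi_le _ _
  -- Averaging over the tie-breaking labels leaves a kernel of the observations alone, and by
  -- Cauchy-Schwarz its variance is at most that of the coefficient.
  set h : (Fin (m n) → ℝ × ℝ) → ℝ := fun y => N⁻¹ * ∑ r, (xi y r - θ) with hh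
  have hdm (r : Equiv.Perm (Fin (m n))) : Measurable fun y : Fin (m n) → ℝ × ℝ => xi y r - θ :=
    (measurable_xi r).sub_const _
  have hdb (y : Fin (m n) → ℝ × ℝ) (r : Equiv.Perm (Fin (m n))) : |xi y r - θ| ≤ C + C :=
    (abs_sub _ _).trans (add_le_add (abs_xi_le y r) hθC)
  have hdi (r : Equiv.Perm (Fin (m n))) : Integrable (fun y => xi y r - θ) Q :=
    Integrable.of_bound (hdm r).aestronglyMeasurable (C + C) (ae_of_all _ fun y => hdb y r)
  have hhm : Measurable h := (Finset.measurable_fun_sum _ fun r _ => hdm r).const_mul _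
  have hhb (y : Fin (m n) → ℝ × ℝ) : |h y| ≤ C + C := by
    simp only [hh]
    rw [abs_mul, abs_of_pos (inv_pos.2 hN0), inv_mul_le_iff₀ hN0]
    refine (Finset.abs_sum_le_sum_abs _ _).trans ((Finset.sum_le_card_nsmul _ _ (C + C)
      fun r _ => hdb y r).trans ?_)
    rw [nsmul_eq_mul, Finset.card_univ]
  have hθi : Integrable (xiSample X Y τ (m n)) P := (memLp_xiSample hX hY hτm (m n)).integrable
    one_le_two
  have h0 : ∫ y, h y ∂Q = 0 := by
    simp only [hh]
    rw [integral_const_mul, integral_finsetSum _ fun r _ => hdi r,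
      ← hmean (ψ := fun x => x - θ) (by fun_prop) hdb, integral_sub hθi (integrable_const _)]
    simp [hθ]
  have hh2 : ∫ y, h y ^ 2 ∂Q ≤ Var[xiSample X Y τ (m n); P] := by
    rw [variance_eq_integral (measurable_xiSample hX hY hτm (m n)).aemeasurable,
      hmean (ψ := fun x => (x - θ) ^ 2) (by fun_prop) (B := (C + C) ^ 2) fun y r => by
        rw [abs_pow]
        exact pow_le_pow_left₀ (abs_nonneg _) (hdb y r) 2]
    have hsi (r : Equiv.Perm (Fin (m n))) : Integrable (fun y => (xi y r - θ) ^ 2) Q :=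
      Integrable.of_bound ((hdm r).pow_const 2).aestronglyMeasurable ((C + C) ^ 2)
        (ae_of_all _ fun y => by
          rw [Real.norm_eq_abs, abs_pow]
          exact pow_le_pow_left₀ (abs_nonneg _) (hdb y r) 2)
    rw [← integral_finsetSum _ fun r _ => hsi r, ← integral_const_mul]
    refine integral_mono_of_nonneg (ae_of_all _ fun y => sq_nonneg _)
      ((integrable_finsetSum _ fun r _ => hsi r).const_mul _) (ae_of_all _ fun y => ?_)
    simp only [hh]
    rw [mul_pow, sq N⁻¹, mul_assoc]
    refine mul_le_mul_of_nonneg_left ?_ (inv_pos.2 hN0).le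
    rw [inv_mul_le_iff₀ hN0]
    have := sq_sum_le_card_mul_sum_sq (s := Finset.univ)
      (f := fun r : Equiv.Perm (Fin (m n)) => xi y r - θ)
    rwa [Finset.card_univ] at this
  have hcond := (hSρ n).condExp_eq (measurable_sample hX hY n)
    (G := fun z a => xi (fun i => z (a.1 i)) a.2) measurable_xi_subsample (C := C)
    fun _ _ => abs_xi_le _ _
  -- The conditional mean averages over subsamples and labels together; after centring it is the
  -- subsample average of `h`.
  have hU (z : Fin n → ℝ × ℝ) :
      (Fintype.card ((Fin (m n) ↪ Fin n) × Equiv.Perm (Fin (m n))) : ℝ)⁻¹ *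
        ∑ a : (Fin (m n) ↪ Fin n) × Equiv.Perm (Fin (m n)), xi (fun i => z (a.1 i)) a.2 - θ =
      subsampleMean h z := by
    simp only [subsampleMean, hh]
    rw [Fintype.sum_prod_type, Fintype.card_prod]
    simp only [Finset.sum_sub_distrib, Finset.sum_const, Finset.card_univ, nsmul_eq_mul, mul_sub,
      ← Finset.mul_sum]
    rw [← hN]
    push_cast
    rw [← hN]
    field_simp
  have hEc : ∫ ω, (P[xiBoot X Y m S ρ n | sampleSigma X Y n]) ω ∂P = θ := by
    rw [integral_condExp (measurable_sample hX hY n).comap_le]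
    exact (identDistrib_xiBoot hX hY hindep hident hτ hSρ n).integral_eq
  rw [variance_eq_integral (stronglyMeasurable_condExp.mono
    (measurable_sample hX hY n).comap_le).measurable.aemeasurable, hEc]
  have hae : ∫ ω, ((P[xiBoot X Y m S ρ n | sampleSigma X Y n]) ω - θ) ^ 2 ∂P =
      ∫ ω, subsampleMean h (sample X Y n ω) ^ 2 ∂P := by
    refine integral_congr_ae ?_
    filter_upwards [hcond] with ω hω
    rw [← hU]
    exact congrArg (fun v => (v - θ) ^ 2) hω.symm
  rw [hae, integral_comp_measurePreserving (hS n) (g := fun z => subsampleMean h z ^ 2)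
    ((measurable_subsampleMean hhm).pow_const 2).aestronglyMeasurable]
  exact (integral_subsampleMean_sq_le μ hhm hhb h0 hmn).trans
    (mul_le_mul_of_nonneg_left hh2 (by positivity))

lemma tendsto_div_atTop (hmn : (fun n => (m n : ℝ)) =o[atTop] (fun n => (n : ℝ)))
    (hm : Tendsto m atTop atTop) : Tendsto (fun n => n / m n) atTop atTop := by
  rw [tendsto_atTop]
  intro K
  have h := hmn.bound (show (0 : ℝ) < ((K : ℝ) + 1)⁻¹ by positivity)
  filter_upwards [h, hm.eventually_gt_atTop 0] with n hn hm0
  rw [Real.norm_natCast, Real.norm_natCast, inv_mul_eq_div, le_div_iff₀ (by positivity)] at hn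
  rw [Nat.le_div_iff_mul_le hm0]
  have : m n * (K + 1) ≤ n := by exact_mod_cast hn
  nlinarith

include hX hY hindep hident hτ hSρ in
/-- The bootstrap: convergence of the moments of order two from the central limit theorem and
uniform square-integrability. -/
theorem bootMomentsConverge (hm : Tendsto m atTop atTop)
    (hUI : UniformIntegrable (T P X Y τ) 2 P) {σ : ℝ} (hσ : AsympNormal P X Y τ σ)
    (hmn : (fun n => (m n : ℝ)) =o[atTop] (fun n => (n : ℝ))) :
    BootMomentsConverge P X Y m S ρ σ := by
  have hτm (n : ℕ) := (hτ n).1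
  set γ := gaussianReal 0 (Real.toNNReal (σ ^ 2)) with hγ
  have hγ2 : MemLp (fun z : ℝ => z) 2 γ := memLp_id_gaussianReal 2
  have hγi : Integrable (fun z : ℝ => z ^ 2) γ := hγ2.integrable_sq
  have hγm : ∫ z, z ^ 2 ∂γ = σ ^ 2 := by
    have h1 : Var[id; γ] = σ ^ 2 := by
      rw [hγ, variance_id_gaussianReal, Real.coe_toNNReal _ (sq_nonneg _)]
    rw [variance_eq_integral aemeasurable_id] at h1
    simpa [hγ, integral_id_gaussianReal] using h1
  have hxim (n : ℕ) := measurable_xiSample hX hY hτm n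
  have hTm (n : ℕ) : Measurable (T P X Y τ n) := ((hxim n).sub_const _).const_mul _
  have hTL (n : ℕ) : MemLp (T P X Y τ n) 2 P :=
    ((memLp_xiSample hX hY hτm n).sub (memLp_const _)).const_mul _
  have hT2 := tendsto_integral_sq_of_uniformIntegrable hσ hTm (fun n => (hTL n).integrable_sq)
    hγi hUI
  rw [hγm] at hT2
  have hT2m : Tendsto (fun n => ∫ ω, T P X Y τ (m n) ω ^ 2 ∂P) atTop (𝓝 (σ ^ 2)) := hT2.comp hm
  have hid := identDistrib_xiBoot hX hY hindep hident hτ hSρ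
  set A : ℕ → Ω → ℝ := fun n ω => √(m n) * xiBoot X Y m S ρ n ω with hA
  have hbm (n : ℕ) := measurable_xiBoot hX hY hSρ n
  have hbL (n : ℕ) : MemLp (xiBoot X Y m S ρ n) 2 P :=
    MemLp.of_bound (hbm n).aestronglyMeasurable _ (ae_of_all _ fun _ => abs_xi_le _ _)
  have hAm (n : ℕ) : Measurable (A n) := (hbm n).const_mul _
  have hAL (n : ℕ) : MemLp (A n) 2 P := (hbL n).const_mul _
  have hle (n : ℕ) : sampleSigma X Y n ≤ ‹MeasurableSpace Ω› := (measurable_sample hX hY n).comap_le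
  have hcm (n : ℕ) : Measurable (P[A n | sampleSigma X Y n]) :=
    (stronglyMeasurable_condExp.mono (hle n)).measurable
  have hcL (n : ℕ) : MemLp (P[A n | sampleSigma X Y n]) 2 P := (hAL n).condExp one_le_two
  have hcond (n : ℕ) : P[A n | sampleSigma X Y n] =ᵐ[P] fun ω =>
      √(m n) * (P[xiBoot X Y m S ρ n | sampleSigma X Y n]) ω :=
    condExp_smul (√(m n : ℝ)) (xiBoot X Y m S ρ n) (sampleSigma X Y n)
  have hTB (n : ℕ) : TBoot P X Y m S ρ n =ᵐ[P] fun ω => A n ω - (P[A n | sampleSigma X Y n]) ω := by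
    filter_upwards [hcond n] with ω hω
    rw [hω, TBoot, mul_sub]
  have hTBm (n : ℕ) : Measurable (TBoot P X Y m S ρ n) :=
    ((hbm n).sub (stronglyMeasurable_condExp.mono (hle n)).measurable).const_mul _
  have hTBL (n : ℕ) : MemLp (TBoot P X Y m S ρ n) 2 P :=
    (memLp_congr_ae (hTB n)).2 ((hAL n).sub (hcL n))
  have hvarA (n : ℕ) : Var[A n; P] = ∫ ω, T P X Y τ (m n) ω ^ 2 ∂P := by
    rw [integral_T_sq hX hY hτm, hA, variance_const_mul, (hid n).variance_eq,
      Real.sq_sqrt (Nat.cast_nonneg _)]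
  have hbv (n : ℕ) : ∫ ω, bootVariance P X Y m S ρ n ω ∂P = ∫ ω, TBoot P X Y m S ρ n ω ^ 2 ∂P := by
    have h1 : ∫ ω, bootVariance P X Y m S ρ n ω ∂P =
        ∫ ω, (A n ω - (P[A n | sampleSigma X Y n]) ω) ^ 2 ∂P := integral_condExp (hle n)
    rw [h1]
    refine integral_congr_ae ?_
    filter_upwards [hTB n] with ω hω
    rw [hω]
  -- This is the law of total variance, with the total variance equal to `E T_m²` because the
  -- subsample has the law of a sample.
  have hdec (n : ℕ) : ∫ ω, TBoot P X Y m S ρ n ω ^ 2 ∂P =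
      ∫ ω, T P X Y τ (m n) ω ^ 2 ∂P - Var[P[A n | sampleSigma X Y n]; P] := by
    have h1 : ∫ ω, bootVariance P X Y m S ρ n ω ∂P + Var[P[A n | sampleSigma X Y n]; P] =
        Var[A n; P] := integral_condVar_add_variance_condExp (hle n) (hAL n)
    rw [hbv, hvarA] at h1
    linarith
  have hK := tendsto_div_atTop hmn hm
  -- The variance is at most `E T_m² / ⌊n/m⌋`, with a convergent numerator and, by `m = o(n)`, an
  -- unbounded denominator.
  have hvc : Tendsto (fun n => Var[P[A n | sampleSigma X Y n]; P]) atTop (𝓝 0) := by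
    have h1 : Tendsto (fun n => ((n / m n : ℕ) : ℝ)⁻¹ * ∫ ω, T P X Y τ (m n) ω ^ 2 ∂P) atTop
        (𝓝 (0 * σ ^ 2)) :=
      ((tendsto_inv_atTop_nhds_zero_nat (𝕜 := ℝ)).comp hK).mul hT2m
    rw [zero_mul] at h1
    refine squeeze_zero' (Eventually.of_forall fun n => variance_nonneg _ _) ?_ h1
    filter_upwards [hK.eventually_gt_atTop 0] with n hn
    rw [variance_congr (hcond n), variance_const_mul, Real.sq_sqrt (Nat.cast_nonneg _),
      integral_T_sq hX hY hτm]
    have := mul_le_mul_of_nonneg_left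
      (variance_condExp_xiBoot_le hX hY hindep hident hτ hSρ hn) (Nat.cast_nonneg (α := ℝ) (m n))
    linarith
  have hTB2 : Tendsto (fun n => ∫ ω, TBoot P X Y m S ρ n ω ^ 2 ∂P) atTop (𝓝 (σ ^ 2)) := by
    have := hT2m.sub hvc
    rw [sub_zero] at this
    exact this.congr fun n => (hdec n).symm
  -- Centred at the unconditional mean, the bootstrap coefficient has exactly the law of `T_m`. It
  -- differs from `TBoot` by the centred conditional mean, whose variance vanishes.
  set W : ℕ → Ω → ℝ := fun n ω =>
    √(m n) * (xiBoot X Y m S ρ n ω - ∫ ω', xiSample X Y τ (m n) ω' ∂P) with hW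
  have hWid (n : ℕ) : IdentDistrib (W n) (T P X Y τ (m n)) P P :=
    (hid n).comp (u := fun x => √(m n) * (x - ∫ ω', xiSample X Y τ (m n) ω' ∂P)) (by fun_prop)
  have hWm (n : ℕ) : Measurable (W n) := ((hbm n).sub_const _).const_mul _
  have hWd : TendstoInDistribution W atTop (fun z : ℝ => z) (fun _ => P) γ := by
    refine ⟨fun n => (hWm n).aemeasurable, by fun_prop, ?_⟩
    refine (hσ.tendsto.comp hm).congr fun n => ?_
    exact Subtype.ext (hWid n).map_eq.symm
  have hdiff (n : ℕ) : eLpNorm (TBoot P X Y m S ρ n - W n) 2 P =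
      ENNReal.ofReal (√(Var[P[A n | sampleSigma X Y n]; P])) := by
    have hEA : ∫ ω, (P[A n | sampleSigma X Y n]) ω ∂P =
        √(m n) * ∫ ω', xiSample X Y τ (m n) ω' ∂P := by
      rw [integral_condExp (hle n), ← (hid n).integral_eq, ← integral_const_mul]
    have h1 : TBoot P X Y m S ρ n - W n =ᵐ[P] fun ω =>
        -((P[A n | sampleSigma X Y n]) ω - ∫ ω', (P[A n | sampleSigma X Y n]) ω' ∂P) := by
      filter_upwards [hTB n] with ω hω
      rw [Pi.sub_apply, hω, hEA]
      simp only [hA, hW]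
      ring
    have h2 : MemLp (fun ω => -((P[A n | sampleSigma X Y n]) ω -
        ∫ ω', (P[A n | sampleSigma X Y n]) ω' ∂P)) 2 P := ((hcL n).sub (memLp_const _)).neg
    rw [eLpNorm_congr_ae h1, h2.eLpNorm_eq_integral_rpow_norm two_ne_zero ENNReal.ofNat_ne_top,
      variance_eq_integral (hcm n).aemeasurable, Real.sqrt_eq_rpow, ENNReal.toReal_ofNat, one_div]
    simp only [norm_neg, Real.rpow_ofNat, Real.norm_eq_abs, sq_abs]
  have hTBd : TendstoInDistribution (TBoot P X Y m S ρ) atTop (fun z : ℝ => z) (fun _ => P) γ := by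
    refine tendstoInDistribution_of_tendstoInMeasure_sub _ _ hWd ?_ fun n => (hTBm n).aemeasurable
    refine tendstoInMeasure_of_tendsto_eLpNorm two_ne_zero
      (fun n => ((hTBm n).sub (hWm n)).aestronglyMeasurable) aestronglyMeasurable_zero ?_
    have h1 : Tendsto (fun n => ENNReal.ofReal (√(Var[P[A n | sampleSigma X Y n]; P]))) atTop
        (𝓝 (ENNReal.ofReal (√0))) :=
      (ENNReal.continuous_ofReal.tendsto _).comp ((Real.continuous_sqrt.tendsto _).comp hvc)
    rw [Real.sqrt_zero, ENNReal.ofReal_zero] at h1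
    refine h1.congr fun n => ?_
    rw [sub_zero]
    exact (hdiff n).symm
  have hmapγ : (gaussianReal 0 1).map (fun z => σ * z) = γ := by
    rw [gaussianReal_map_const_mul, mul_zero, mul_one, hγ]
    congr 1
    exact (Real.toNNReal_of_nonneg (sq_nonneg σ)).symm
  refine ⟨fun f C hf hC0 hC => ⟨fun n => ?_, ?_, ?_⟩, hTB2, hTB2.congr fun n => (hbv n).symm⟩
  · have h1 : Integrable (fun ω => C * (1 + TBoot P X Y m S ρ n ω ^ 2)) P :=
      ((integrable_const _).add (hTBL n).integrable_sq).const_mul _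
    exact h1.mono' (hf.measurable.comp (hTBm n)).aestronglyMeasurable (ae_of_all _ fun ω => hC _)
  · have h1 : Integrable f γ := by
      have h2 : Integrable (fun z : ℝ => C * (1 + z ^ 2)) γ :=
        ((integrable_const _).add hγi).const_mul _
      exact h2.mono' hf.aestronglyMeasurable (ae_of_all _ hC)
    rw [← hmapγ] at h1
    exact (integrable_map_measure hf.aestronglyMeasurable (by fun_prop)).1 h1
  · have h1 := tendsto_integral_of_quadratic_growth hTBd (fun n => (hTBL n).integrable_sq) hγi
      (by rw [hγm]; exact hTB2) hf hC
    rw [← hmapγ, integral_map (by fun_prop) hf.aestronglyMeasurable] at h1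
    exact h1

end Bootstrap

end Chatterjee

theorem corollary1 {Ω : Type*} [MeasurableSpace Ω] (P : Measure Ω) [IsProbabilityMeasure P]
    (X Y : ℕ → Ω → ℝ) (hX : ∀ k, Measurable (X k)) (hY : ∀ k, Measurable (Y k))
    -- the observations are independent and identically distributed
    (hindep : iIndepFun (fun k ω => (X k ω, Y k ω)) P)
    (hident : ∀ k, IdentDistrib (fun ω => (X k ω, Y k ω)) (fun ω => (X 0 ω, Y 0 ω)) P P)
    -- random tie-breaking in the sample
    (τ : (n : ℕ) → Ω → Equiv.Perm (Fin n))
    (hτ : ∀ n, Chatterjee.IsUniformIndep (τ n) (Chatterjee.sample X Y n) P)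
    -- resampling without replacement, and random tie-breaking in the bootstrap sample
    (m : ℕ → ℕ) (hm : Tendsto m atTop atTop)
    (S : (n : ℕ) → Ω → (Fin (m n) ↪ Fin n)) (ρ : (n : ℕ) → Ω → Equiv.Perm (Fin (m n)))
    (hSρ : ∀ n, Chatterjee.IsUniformIndep (fun ω => (S n ω, ρ n ω)) (Chatterjee.sample X Y n) P)
    -- the sequence `T_n` is uniformly square-integrable
    (hUI : UniformIntegrable (Chatterjee.T P X Y τ) 2 P) :
    (∀ σ : ℝ, 0 < σ → Chatterjee.AsympNormal P X Y τ σ →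
      (fun n => (m n : ℝ)) =o[atTop] (fun n => Real.sqrt (n : ℝ)) →
      Chatterjee.BootMomentsConverge P X Y m S ρ σ) ∧
    (Continuous (fun p : ℝ × ℝ => P.real {ω | X 0 ω ≤ p.1 ∧ Y 0 ω ≤ p.2}) →
      (¬ ∃ g : ℝ → ℝ, Measurable g ∧ ∀ᵐ ω ∂P, Y 0 ω = g (X 0 ω)) →
      (fun n => (m n : ℝ)) =o[atTop] (fun n => (n : ℝ)) →
      ∃ σ : ℝ, 0 < σ ∧ Chatterjee.AsympNormal P X Y τ σ ∧
        Chatterjee.BootMomentsConverge P X Y m S ρ σ) := by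
  refine ⟨fun σ _ hσ hmn => ?_, fun hcont hdep hmn => ?_⟩
  · refine Chatterjee.bootMomentsConverge hX hY hindep hident hτ hSρ hm hUI hσ ?_
    -- Since `√n ≤ n` for `n ≥ 1`, the rate in (i) implies `m = o(n)`, the only rate the bootstrap
    -- argument uses.
    refine hmn.trans_isBigO (IsBigO.of_bound 1 ?_)
    filter_upwards [eventually_ge_atTop 1] with n hn
    have hn' : (1 : ℝ) ≤ n := by exact_mod_cast hn
    rw [one_mul, Real.norm_of_nonneg (Real.sqrt_nonneg _), Real.norm_natCast,
      Real.sqrt_le_left (by positivity)]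
    nlinarith
  · obtain ⟨σ, hσ0, hσ⟩ := Chatterjee.exists_asympNormal hX hY hindep hident (fun n => (hτ n).1)
      hcont hdep
    exact ⟨σ, hσ0, hσ, Chatterjee.bootMomentsConverge hX hY hindep hident hτ hSρ hm hUI hσ hmn⟩
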